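/- **Setting.** Let $\bar{\mathbb Q}$ be the field of algebraic numbers in $\mathbb C$, and let $k$ be a real quadratic field with ring of integers $\mathcal O$. Let $\mathfrak f\ne\mathcal O$ be an integral ideal with $\mathfrak f\cap\mathbb Z=f\mathbb Z$, $f>0$. Let $W_{\mathfrak f}$ be the set of pairs $(\xi,I)$ where $I$ is a nonzero fractional ideal of $k$ and $\xi$ is a character of the additive group $I$ with values in the roots of unity, such that $\{a\in\mathcal O:\xi(ax)=1\ \forall x\in I\}=\mathfrak f$. Write $k_+^\times$ for the totally positive elements of $k^\times$ and $E_{\mathfrak f+}$ for the group of totally positive units congruent to $1$ modulo $\mathfrak f$. Call $(\xi,I)$ and $(\xi',I')$ equivalent if there is $c\in k_+^\times$ with $I'=cI$ and $\xi'(cx)=\xi(x)$ for all $x\in I$. Let $p$ be a prime number, $T_p$ the set of primes of $\mathcal O$ above $p$, $\mathbb C_p$ the completion of an algebraic closure of $\mathbb Q_p$, and $j:\bar{\mathbb Q}\to\mathbb C_p$ an embedding. For the class $\mathfrak w$ of $(\xi,I)$ put, for $\Re(s)>1$, $$Z_{T_p}(s;\mathfrak w)=\sum_{a}\frac{\xi(a)}{|I:(a)|^s},$$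 where $a$ runs over the $a\in I\cap k_+^\times$ with $aI^{-1}$ prime to $T_p$, modulo the action of $E_{\mathfrak f+}$; this depends only on $\mathfrak w$. For $\mathbb Q$-linearly independent $\tau_1,\tau_2\in I\cap k_+^\times$ with $\xi(\tau_1),\xi(\tau_2)\neq1$ put $$C(\tau_1,\tau_2)=\{\lambda\tau_1+\mu\tau_2:\lambda,\mu\in\mathbb Q,\ \lambda>0,\ \mu\ge0\},$$ $$P(\tau_1,\tau_2)=\{\lambda\tau_1+\mu\tau_2:\lambda,\mu\in\mathbb Q,\ 0<\lambda\le1,\ 0\le\mu<1\},$$ and, for $\Re(s)>1$, $$z_{T_p}(s;\xi,I,\tau_1,\tau_2)=\sum_{a\in I\cap C(\tau_1,\tau_2),\ p\nmid|I:(a)|}\frac{\xi(a)}{(N_{k/\mathbb Q}\,a)^s}.$$ For an ordering $\iota=(\iota_1,\iota_2)$ of the two embeddings $k\to\bar{\mathbb Q}$ write $(1+X)^{\iota(a)}=(1+X_1)^{\iota_1(a)}(1+X_2)^{\iota_2(a)}$ (formal binomial series) and $$F_\iota(X;\xi,I,\tau_1,\tau_2)=\frac{\sum_{a\in I\cap P(\tau_1,\tau_2)}\xi(a)(1+X)^{\iota(a)}}{(1-\xi(\tau_1)(1+X)^{\iota(\tau_1)})(1-\xi(\tau_2)(1+X)^{\iota(\tau_2)})}\in\bar{\mathbb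 Q}[[X_1,X_2]].$$ Let $w_p$ be the number of roots of unity in $\mathbb Q_p$, $\mathcal M(p)=\{m\in\mathbb Z:m\le0,\ m\equiv1\bmod w_p\}$ and $D(p)=1+2\mathbb Z_p$. The $p$-adic functions $Z^{(j)}_{T_p,p}(\cdot;\mathfrak w)$ and $z^{(j)}_{T_p,p}(\cdot;\xi,I,\tau_1,\tau_2)$ are the continuous functions $D(p)\to\mathbb C_p$ whose value at each $m\in\mathcal M(p)$ is the image under $j$ of the (algebraic) value at $m$ of the meromorphic continuation to $\mathbb C$ of $Z_{T_p}(s;\mathfrak w)$, respectively of $z_{T_p}(s;\xi,I,\tau_1,\tau_2)$, this continuation being analytic at $m$. Let $\omega:\mathbb Z_p^\times\to\mu(\mathbb Q_p)$ be the Teichmüller character, so that $\langle x\rangle=\omega(x)^{-1}x$ lies in $1+p\mathbb Z_p$ (in $1+4\mathbb Z_2$ if $p=2$), and put $$c_n=\sum_{\zeta^p=1}(\zeta-1)^n=p\sum_{0\le r\le n/p}(-1)^{n-pr}\binom n{pr}.$$ **Statement.** Let $(\xi,I)\in W_{\mathfrak f}$ have class $\mathfrak w$. Assume that $p$ is prime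 to $\mathfrak f$, that $p$ splits in $k$ ($p\mathcal O=\mathfrak p_1\mathfrak p_2$ with primes $\mathfrak p_1\ne\mathfrak p_2$), and that $I$ is prime to $p$. Let $\varepsilon$ be any generator of $E_{\mathfrak f+}$ and $\rho$ any element of $I\cap k_+^\times$ with $\xi(\rho)\ne1$. Then the functions $Z^{(j)}_{T_p,p}(\cdot;\mathfrak w)$ and $z^{(j)}_{T_p,p}(\cdot;\xi,I,\rho,\varepsilon\rho)$ exist and are unique, the norm $NI$ lies in $\mathbb Z_p^\times$, and $$Z^{(j)}_{T_p,p}(s;\mathfrak w)=\omega(NI)\langle NI\rangle^s\,z^{(j)}_{T_p,p}(s;\xi,I,\rho,\varepsilon\rho)\qquad\text{for all }s\in D(p).$$ In particular, for either ordering $\iota$, if $F^j$ is obtained from $F_\iota(X;\xi,I,\rho,\varepsilon\rho)$ by applying $j$ to the coefficients and $(1+X_1)^{-1}(1+X_2)^{-1}F^j=\sum_{i,l\ge0}a_{i,l}X_1^iX_2^l$, then $$Z^{(j)}_{T_p,p}(1;\mathfrak w)=\frac{NI}{p^2}\sum_{i,l\ge0}\frac{c_{i+1}c_{l+1}a_{i,l}}{(i+1)(l+1)}\in\mathbb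 Z_p[\mu_f],$$ where the double series converges $p$-adically and $\mu_f$ is the group of $f$-th roots of unity in $\mathbb C_p$. -/

import Mathlib

open scoped nonZeroDivisors
open NumberField IsDedekindDomain

namespace PadicTwisted

/-- The field of algebraic numbers, as a subfield of `ℂ`. -/
abbrev QBar : Type := ↥(algebraicClosure ℚ ℂ)

section Complex

variable {k : Type*} [Field k] [NumberField k]

set_option linter.unusedSectionVars false

/-- The nonzero elements that are positive at every real place. -/
def TotallyPositive (a : k) : Prop := a ≠ 0 ∧ ∀ φ : k →+* ℝ, 0 < φ a

theorem TotallyPositive.mul {a b : k} (ha : TotallyPositive a) (hb : TotallyPositive b) :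
    TotallyPositive (a * b) :=
  ⟨mul_ne_zero ha.1 hb.1, fun φ => by rw [map_mul]; exact mul_pos (ha.2 φ) (hb.2 φ)⟩

theorem TotallyPositive.inv {a : k} (ha : TotallyPositive a) : TotallyPositive a⁻¹ :=
  ⟨inv_ne_zero ha.1, fun φ => by rw [map_inv₀]; exact inv_pos.mpr (ha.2 φ)⟩

theorem TotallyPositive.one : TotallyPositive (1 : k) :=
  ⟨one_ne_zero, fun φ => by rw [map_one]; exact one_pos⟩

/-- The annihilator `{a ∈ 𝓞 : ξ(a x) = 1 for all x ∈ I}` of a character `ξ` of a fractional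
ideal `I`. -/
def charAnnihilator (I : FractionalIdeal (𝓞 k)⁰ k) (ξ : AddChar (I : Submodule (𝓞 k) k) QBar) : Ideal (𝓞 k) where
  carrier := {a | ∀ x : (I : Submodule (𝓞 k) k), ξ (a • x) = 1}
  zero_mem' x := by simp
  add_mem' {a b} ha hb x := by rw [add_smul, AddChar.map_add_eq_mul, ha x, hb x, one_mul]
  smul_mem' c a ha x := by
    rw [smul_eq_mul, mul_comm, mul_smul]
    exact ha (c • x)

/-- The set `W_𝔣` of pairs `(ξ, I)`: a nonzero fractional ideal `I` of `k` and a character `ξ` of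
the additive group of `I`, with values in the roots of unity, whose annihilator is `𝔣`. -/
structure CharPair (𝔣 : Ideal (𝓞 k)) where
  /-- The fractional ideal. -/
  I : FractionalIdeal (𝓞 k)⁰ k
  /-- The character. -/
  ξ : AddChar (I : Submodule (𝓞 k) k) QBar
  ne_zero : I ≠ 0
  isOfFinOrder : ∀ x : (I : Submodule (𝓞 k) k), IsOfFinOrder (ξ x)
  annihilator : charAnnihilator I ξ = 𝔣

/-- The fractional ideal of a pair, as a submodule of `k`. -/
abbrev CharPair.mod {𝔣 : Ideal (𝓞 k)} (P : CharPair 𝔣) : Submodule (𝓞 k) k := P.I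

variable {𝔣 : Ideal (𝓞 k)}

/-- `(ξ, I)` and `(ξ', I')` are equivalent when `I' = c I` and `ξ' (c x) = ξ x` on `I` for some
totally positive `c`. -/
def CharPair.Equiv (P Q : CharPair 𝔣) : Prop :=
  ∃ c : k, TotallyPositive c ∧
    (∀ x : k, c * x ∈ Q.mod ↔ x ∈ P.mod) ∧
    ∀ (x : k) (hx : x ∈ P.mod) (hx' : c * x ∈ Q.mod), Q.ξ ⟨c * x, hx'⟩ = P.ξ ⟨x, hx⟩

theorem CharPair.Equiv.equivalence : Equivalence (CharPair.Equiv (𝔣 := 𝔣)) where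
  refl P := ⟨1, TotallyPositive.one, fun x => by rw [one_mul], fun x hx hx' => by
    congr 2; exact one_mul x⟩
  symm := by
    rintro P Q ⟨c, hc, h1, h2⟩
    have key : ∀ x : k, c * (c⁻¹ * x) = x := fun x => mul_inv_cancel_left₀ hc.1 x
    refine ⟨c⁻¹, hc.inv, fun x => by rw [← h1, key], fun x hx hx' => ?_⟩
    have h3 : c * (c⁻¹ * x) ∈ Q.mod := by rw [key]; exact hx
    rw [← h2 _ hx' h3]
    congr 2
    exact key x
  trans := by
    rintro P Q R ⟨c, hc, h1, h2⟩ ⟨d, hd, h3, h4⟩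
    refine ⟨d * c, hd.mul hc, fun x => by rw [mul_assoc, h3, h1], fun x hx hx' => ?_⟩
    have hcx : c * x ∈ Q.mod := (h1 x).2 hx
    have hdcx : d * (c * x) ∈ R.mod := (h3 _).2 hcx
    rw [← h2 x hx hcx, ← h4 _ hcx hdcx]
    congr 2
    exact mul_assoc d c x

instance CharPair.setoid (𝔣 : Ideal (𝓞 k)) : Setoid (CharPair 𝔣) :=
  ⟨CharPair.Equiv, CharPair.Equiv.equivalence⟩

/-- The set `𝔚_{𝔣+}` of equivalence classes of pairs `(ξ, I)`. -/
def CharClass (𝔣 : Ideal (𝓞 k)) : Type _ := Quotient (CharPair.setoid 𝔣)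

/-- The class of a pair. -/
def CharPair.toClass (P : CharPair 𝔣) : CharClass 𝔣 := Quotient.mk _ P

/-- The group `E_{𝔣+}` of totally positive units congruent to `1` modulo `𝔣`. -/
def unitsPlus (𝔣 : Ideal (𝓞 k)) : Subgroup (𝓞 k)ˣ where
  carrier := {u | (u : 𝓞 k) - 1 ∈ 𝔣 ∧ TotallyPositive (algebraMap (𝓞 k) k u)}
  one_mem' := ⟨by simp, by simpa using TotallyPositive.one⟩
  mul_mem' {u v} hu hv := by
    refine ⟨?_, by simpa using hu.2.mul hv.2⟩
    have h : ((u * v : (𝓞 k)ˣ) : 𝓞 k) - 1 = u * ((v : 𝓞 k) - 1) + ((u : 𝓞 k) - 1) := by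
      push_cast; ring
    rw [h]
    exact 𝔣.add_mem (𝔣.mul_mem_left _ hv.1) hu.1
  inv_mem' {u} hu := by
    refine ⟨?_, ?_⟩
    · have h : ((u⁻¹ : (𝓞 k)ˣ) : 𝓞 k) - 1 = -((u⁻¹ : (𝓞 k)ˣ) : 𝓞 k) * ((u : 𝓞 k) - 1) := by
        rw [mul_sub, neg_mul, Units.inv_mul]; ring
      rw [h]
      exact 𝔣.mul_mem_left _ hu.1
    · have h : algebraMap (𝓞 k) k ((u⁻¹ : (𝓞 k)ˣ) : 𝓞 k) = (algebraMap (𝓞 k) k u)⁻¹ := by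
        apply eq_inv_of_mul_eq_one_left
        rw [← map_mul, Units.inv_mul, map_one]
      rw [h]
      exact hu.2.inv

/-- The index `|I : (a)|` of the principal fractional ideal `(a)` in `I`. -/
noncomputable def idealIndex (I : FractionalIdeal (𝓞 k)⁰ k) (a : k) : ℕ :=
  (Submodule.span (𝓞 k) {a}).toAddSubgroup.relIndex (I : Submodule (𝓞 k) k).toAddSubgroup

/-- The set `S(I, +, T)` of totally positive `a ∈ I` such that the ideal `a I⁻¹` is prime to
every prime in `T`. -/
def CharPair.S (P : CharPair 𝔣) (T : Set (HeightOneSpectrum (𝓞 k))) : Set P.mod :=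
  {a | TotallyPositive (a : k) ∧
    ∀ v ∈ T, FractionalIdeal.count k v (FractionalIdeal.spanSingleton (𝓞 k)⁰ (a : k) * P.I⁻¹) = 0}

/-- Two elements of `S(I, +, T)` are in the same orbit of `E_{𝔣+}`. -/
def CharPair.orbitSetoid (P : CharPair 𝔣) (T : Set (HeightOneSpectrum (𝓞 k))) :
    Setoid (P.S T) where
  r a b := ∃ u ∈ unitsPlus 𝔣, (b : P.mod) = (u : 𝓞 k) • (a : P.mod)
  iseqv :=
    { refl := fun a => ⟨1, one_mem _, by simp⟩
      symm := by
        rintro a b ⟨u, hu, h⟩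
        exact ⟨u⁻¹, inv_mem hu, by rw [h, smul_smul, Units.inv_mul, one_smul]⟩
      trans := by
        rintro a b c ⟨u, hu, h⟩ ⟨v, hv, h'⟩
        exact ⟨v * u, mul_mem hv hu, by rw [h', h, smul_smul, Units.val_mul]⟩ }

theorem CharPair.ξ_smul (P : CharPair 𝔣) {u : (𝓞 k)ˣ} (hu : u ∈ unitsPlus 𝔣) (a : P.mod) :
    P.ξ ((u : 𝓞 k) • a) = P.ξ a := by
  have h1 : (u : 𝓞 k) - 1 ∈ charAnnihilator P.I P.ξ := by rw [P.annihilator]; exact hu.1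
  have h2 : (u : 𝓞 k) • a = ((u : 𝓞 k) - 1) • a + a := by
    apply Subtype.ext
    simp only [Submodule.coe_add, Submodule.coe_smul, sub_smul, one_smul, sub_add_cancel]
  rw [h2, AddChar.map_add_eq_mul, h1 a, one_mul]

theorem idealIndex_smul (I : FractionalIdeal (𝓞 k)⁰ k) (u : (𝓞 k)ˣ) (a : k) :
    idealIndex I ((u : 𝓞 k) • a) = idealIndex I a := by
  unfold idealIndex
  rw [Submodule.span_singleton_smul_eq u.isUnit a]

/-- The summand `ξ(a) / |I : (a)| ^ s`, as a function on `S(I, +, T) / E_{𝔣+}`. -/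
noncomputable def CharPair.term (P : CharPair 𝔣) (T : Set (HeightOneSpectrum (𝓞 k))) (s : ℂ) :
    Quotient (P.orbitSetoid T) → ℂ :=
  Quotient.lift (s := P.orbitSetoid T)
    (fun a => (P.ξ (a : P.mod) : ℂ) / (idealIndex P.I ((a : P.mod) : k) : ℂ) ^ s) (by
      rintro a b ⟨u, hu, h⟩
      simp only [h, P.ξ_smul hu, Submodule.coe_smul, idealIndex_smul])

/-- The Dirichlet series `Z_T(s; ξ, I, 𝔣+) = ∑ ξ(a) / |I : (a)| ^ s`, over
`a ∈ S(I, +, T) / E_{𝔣+}`, for `Re s > 1`. -/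
noncomputable def CharPair.zeta (P : CharPair 𝔣) (T : Set (HeightOneSpectrum (𝓞 k))) (s : ℂ) : ℂ :=
  ∑' c : Quotient (P.orbitSetoid T), P.term T s c

theorem CharPair.Equiv.I_eq {P Q : CharPair 𝔣} {c : k} (hc : c ≠ 0)
    (h1 : ∀ x : k, c * x ∈ Q.mod ↔ x ∈ P.mod) :
    Q.I = FractionalIdeal.spanSingleton (𝓞 k)⁰ c * P.I := by
  ext y
  rw [FractionalIdeal.mem_singleton_mul]
  have hy : c * (c⁻¹ * y) = y := mul_inv_cancel_left₀ hc y
  constructor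
  · intro h
    refine ⟨c⁻¹ * y, ?_, hy.symm⟩
    have h' := (h1 (c⁻¹ * y)).1 (by rw [hy]; exact h)
    exact h'
  · rintro ⟨x, hx, rfl⟩
    exact (h1 x).2 hx

theorem idealIndex_mul {I J : FractionalIdeal (𝓞 k)⁰ k} {c : k} (hc : c ≠ 0)
    (h1 : ∀ x : k, c * x ∈ (J : Submodule (𝓞 k) k) ↔ x ∈ (I : Submodule (𝓞 k) k)) (a : k) :
    idealIndex J (c * a) = idealIndex I a := by
  unfold idealIndex
  rw [← AddSubgroup.relIndex_map_map_of_injective (f := AddMonoidHom.mulLeft c)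
    (Submodule.span (𝓞 k) {a}).toAddSubgroup (I : Submodule (𝓞 k) k).toAddSubgroup
    (mul_right_injective₀ hc)]
  congr 1
  · ext y
    simp only [Submodule.mem_toAddSubgroup, AddSubgroup.mem_map, Submodule.mem_span_singleton,
      AddMonoidHom.coe_mulLeft]
    constructor
    · rintro ⟨r, rfl⟩
      exact ⟨r • a, ⟨r, rfl⟩, by rw [mul_smul_comm]⟩
    · rintro ⟨_, ⟨r, rfl⟩, rfl⟩
      exact ⟨r, by rw [mul_smul_comm]⟩
  · ext y
    simp only [Submodule.mem_toAddSubgroup, AddSubgroup.mem_map, AddMonoidHom.coe_mulLeft]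
    have hy : c * (c⁻¹ * y) = y := mul_inv_cancel_left₀ hc y
    constructor
    · intro h
      exact ⟨c⁻¹ * y, (h1 _).1 (by rw [hy]; exact h), hy⟩
    · rintro ⟨x, hx, rfl⟩
      exact (h1 x).2 hx

/-- Equivalent pairs have the same twisted zeta function. -/
theorem CharPair.zeta_congr (P Q : CharPair 𝔣) (h : P ≈ Q) :
    (fun T s => P.zeta T s) = fun T s => Q.zeta T s := by
  obtain ⟨c, hc, h1, h2⟩ := h
  have hc0 : c ≠ 0 := hc.1
  have hI := CharPair.Equiv.I_eq hc0 h1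
  have hkey : ∀ x : k, c * (c⁻¹ * x) = x := fun x => mul_inv_cancel_left₀ hc0 x
  funext T s
  have hcount : ∀ a : k, FractionalIdeal.spanSingleton (𝓞 k)⁰ (c * a) * Q.I⁻¹ =
      FractionalIdeal.spanSingleton (𝓞 k)⁰ a * P.I⁻¹ := by
    intro a
    have hs : FractionalIdeal.spanSingleton (𝓞 k)⁰ c ≠ 0 :=
      FractionalIdeal.spanSingleton_ne_zero_iff.2 hc0
    rw [hI, mul_inv, ← FractionalIdeal.spanSingleton_mul_spanSingleton]
    rw [mul_comm (FractionalIdeal.spanSingleton (𝓞 k)⁰ c), mul_assoc,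
      mul_inv_cancel_left₀ hs]
  let e : P.S T ≃ Q.S T :=
    { toFun := fun a => ⟨⟨c * ((a : P.mod) : k), (h1 _).2 (a : P.mod).2⟩,
        hc.mul a.2.1, fun v hv => by
          have := a.2.2 v hv
          rwa [← hcount] at this⟩
      invFun := fun b => ⟨⟨c⁻¹ * ((b : Q.mod) : k), (h1 _).1 (by rw [hkey]; exact (b : Q.mod).2)⟩,
        hc.inv.mul b.2.1, fun v hv => by
          have := b.2.2 v hv
          rw [← hcount, hkey]
          exact this⟩
      left_inv := fun a => by
        apply Subtype.ext
        apply Subtype.ext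
        exact inv_mul_cancel_left₀ hc0 _
      right_inv := fun b => by
        apply Subtype.ext
        apply Subtype.ext
        exact hkey _ }
  have he : ∀ a b, (P.orbitSetoid T).r a b ↔ (Q.orbitSetoid T).r (e a) (e b) := by
    intro a b
    refine exists_congr fun u => and_congr_right fun _ => ?_
    rw [Subtype.ext_iff, Subtype.ext_iff]
    change ((b : P.mod) : k) = (u : 𝓞 k) • ((a : P.mod) : k) ↔
      c * ((b : P.mod) : k) = (u : 𝓞 k) • (c * ((a : P.mod) : k))
    rw [← mul_smul_comm, mul_right_inj' hc0]
  unfold CharPair.zeta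
  rw [← (Quotient.congr (ra := P.orbitSetoid T) (rb := Q.orbitSetoid T) e he).tsum_eq]
  congr 1
  funext q
  induction q using Quotient.inductionOn with
  | _ a =>
    change (P.ξ (a : P.mod) : ℂ) / (idealIndex P.I ((a : P.mod) : k) : ℂ) ^ s =
      (Q.ξ ⟨c * ((a : P.mod) : k), (h1 _).2 (a : P.mod).2⟩ : ℂ) /
        (idealIndex Q.I (c * ((a : P.mod) : k)) : ℂ) ^ s
    rw [idealIndex_mul hc0 h1, h2 _ (a : P.mod).2]

/-- The twisted zeta function `Z_T(s; 𝔴)` of a class `𝔴`, for `Re s > 1`. -/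
noncomputable def CharClass.zeta (𝔴 : CharClass 𝔣) (T : Set (HeightOneSpectrum (𝓞 k))) (s : ℂ) :
    ℂ :=
  Quotient.lift (fun (P : CharPair 𝔣) T s => P.zeta T s) CharPair.zeta_congr 𝔴 T s

/-- The primes of `k` dividing `p`. -/
def primesAbove (k : Type*) [Field k] [NumberField k] (p : ℕ) : Set (HeightOneSpectrum (𝓞 k)) :=
  {v | (p : 𝓞 k) ∈ v.asIdeal}

/-- The half-open cone `{λ τ₁ + μ τ₂ : λ, μ ∈ ℚ, 0 < λ, 0 ≤ μ}`. -/
def cone (τ₁ τ₂ : k) : Set k :=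
  {a | ∃ l m : ℚ, 0 < l ∧ 0 ≤ m ∧ a = l • τ₁ + m • τ₂}

/-- The half-open parallelogram `{λ τ₁ + μ τ₂ : λ, μ ∈ ℚ, 0 < λ ≤ 1, 0 ≤ μ < 1}`. -/
def parallelogram (τ₁ τ₂ : k) : Set k :=
  {a | ∃ l m : ℚ, 0 < l ∧ l ≤ 1 ∧ 0 ≤ m ∧ m < 1 ∧ a = l • τ₁ + m • τ₂}

/-- The series `z_{T_p}(s; ξ, I, τ₁, τ₂) = ∑ ξ(a) / (ι₁(a) ι₂(a)) ^ s` over the `a` in `I` and in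
the cone on `τ₁, τ₂` with `p ∤ |I : (a)|`, for `Re s > 1`. -/
noncomputable def CharPair.coneZeta (P : CharPair 𝔣) (p : ℕ) (τ₁ τ₂ : P.mod) (s : ℂ) : ℂ :=
  ∑' a : {a : P.mod // (a : k) ∈ cone (τ₁ : k) (τ₂ : k) ∧ ¬ p ∣ idealIndex P.I (a : k)},
    (P.ξ a.1 : ℂ) / (∏ φ : k →+* ℂ, φ (a.1 : k)) ^ s

/-- The power series `(1 + X₁) ^ u₁ * (1 + X₂) ^ u₂`, product of two formal binomial series. -/
noncomputable def binomialSeries (u : Fin 2 → QBar) : MvPowerSeries (Fin 2) QBar :=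
  fun n => Ring.choose (u 0) (n 0) * Ring.choose (u 1) (n 1)

/-- The power series `F_ι(X; ξ, I, τ₁, τ₂)`. -/
noncomputable def CharPair.shintaniSeries (P : CharPair 𝔣) (ι : Fin 2 → (k →+* QBar))
    (τ₁ τ₂ : P.mod) : MvPowerSeries (Fin 2) QBar :=
  (∑ᶠ a ∈ {a : P.mod | (a : k) ∈ parallelogram (τ₁ : k) (τ₂ : k)},
      MvPowerSeries.C (P.ξ a) * binomialSeries (fun i => ι i (a : k))) *
    ((1 - MvPowerSeries.C (P.ξ τ₁) * binomialSeries (fun i => ι i (τ₁ : k))) *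
      (1 - MvPowerSeries.C (P.ξ τ₂) * binomialSeries (fun i => ι i (τ₂ : k))))⁻¹

end Complex

/-- `v` is the value at `m` of the meromorphic continuation to `ℂ` of the function `D`, given for
`Re s > 1`; the continuation exists and is analytic at `m`. -/
def IsContinuedValue (D : ℂ → ℂ) (m v : ℂ) : Prop :=
  ∃ g : ℂ → ℂ, MeromorphicOn g Set.univ ∧ (∀ s : ℂ, 1 < s.re → g s = D s) ∧
    AnalyticAt ℂ g m ∧ g m = v

section Padic

variable (p : ℕ) [Fact p.Prime]

/-- The set `M(p)` of the integers `m ≤ 0` with `m ≡ 1` modulo the number `w_p` of roots of unity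
in `ℚ_p`. -/
def interpSet : Set ℤ := {m | m ≤ 0 ∧ m ≡ 1 [ZMOD (Nat.card (CommGroup.torsion ℚ_[p]ˣ) : ℤ)]}

/-- The set `D(p) = 1 + 2 ℤ_p`. -/
def domain : Set ℤ_[p] := {s | ∃ t : ℤ_[p], s = 1 + 2 * t}

/-- The point `1` of `D(p)`. -/
noncomputable def domainOne : domain p := ⟨1, 0, by simp⟩

variable {p}

/-- `F` is continuous on `D(p)` and, at every `m ∈ M(p)`, the meromorphic continuation of `D` has
an algebraic value, whose image under `j` is the value of `F`. -/
def IsInterpolation (j : QBar →+* ℂ_[p]) (D : ℂ → ℂ) (F : domain p → ℂ_[p]) : Prop :=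
  Continuous F ∧ ∀ s : domain p, ∀ m ∈ interpSet p, (s : ℤ_[p]) = (m : ℤ_[p]) →
    ∃ x : QBar, IsContinuedValue D (m : ℂ) (x : ℂ) ∧ F s = j x

/-- The `p`-adic interpolation of `D` (the function `F` as in `IsInterpolation`, if it exists). -/
noncomputable def interpolation (j : QBar →+* ℂ_[p]) (D : ℂ → ℂ) : domain p → ℂ_[p] :=
  Classical.epsilon (IsInterpolation j D)

/-- The `p`-adic twisted zeta function `Z^{(j)}_{T_p, p}(s; 𝔴)`. -/
noncomputable def CharClass.padicZeta {k : Type*} [Field k] [NumberField k] {𝔣 : Ideal (𝓞 k)}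
    (𝔴 : CharClass 𝔣) (j : QBar →+* ℂ_[p]) : domain p → ℂ_[p] :=
  interpolation j (𝔴.zeta (primesAbove k p))

/-- The `p`-adic function `z^{(j)}_{T_p, p}(s; ξ, I, τ₁, τ₂)`. -/
noncomputable def CharPair.padicConeZeta {k : Type*} [Field k] [NumberField k] {𝔣 : Ideal (𝓞 k)}
    (P : CharPair 𝔣) (j : QBar →+* ℂ_[p]) (τ₁ τ₂ : P.mod) : domain p → ℂ_[p] :=
  interpolation j (P.coneZeta p τ₁ τ₂)

theorem exists_teichmuller (x : ℤ_[p]ˣ) :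
    ∃ ζ : ℤ_[p]ˣ, IsOfFinOrder ζ ∧
      ((if p = 2 then 4 else p : ℕ) : ℤ_[p]) ∣ ((ζ⁻¹ * x : ℤ_[p]ˣ) : ℤ_[p]) - 1 := by
  have hp : p.Prime := Fact.out
  suffices h : ∃ ζ : ℤ_[p]ˣ, IsOfFinOrder ζ ∧
      ((if p = 2 then 4 else p : ℕ) : ℤ_[p]) ∣ (x : ℤ_[p]) - (ζ : ℤ_[p]) by
    obtain ⟨ζ, h1, h2⟩ := h
    refine ⟨ζ, h1, ?_⟩
    have h3 : ((ζ⁻¹ * x : ℤ_[p]ˣ) : ℤ_[p]) - 1 = ((ζ⁻¹ : ℤ_[p]ˣ) : ℤ_[p]) * ((x : ℤ_[p]) - ζ) := by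
      rw [mul_sub, Units.inv_mul, Units.val_mul]
    rw [h3]
    exact h2.mul_left _
  by_cases h2 : p = 2
  · subst h2
    have hdvd : ∀ y : ℤ_[2], PadicInt.toZModPow 2 y = 0 → ((4 : ℕ) : ℤ_[2]) ∣ y := by
      intro y hy
      have : y ∈ RingHom.ker (PadicInt.toZModPow (p := 2) 2) := hy
      rw [PadicInt.ker_toZModPow, Ideal.mem_span_singleton] at this
      norm_num at this ⊢
      exact this
    have hu : ∀ y : ZMod (2 ^ 2), IsUnit y → y = 1 ∨ y = -1 := by decide
    rcases hu _ (x.isUnit.map (PadicInt.toZModPow (p := 2) 2)) with h | h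
    · refine ⟨1, IsOfFinOrder.one, ?_⟩
      rw [if_pos rfl]
      exact hdvd _ (by rw [map_sub, h, Units.val_one, map_one, sub_self])
    · refine ⟨-1, isOfFinOrder_iff_pow_eq_one.2 ⟨2, by norm_num, by norm_num⟩, ?_⟩
      rw [if_pos rfl]
      exact hdvd _ (by rw [map_sub, h, Units.val_neg, Units.val_one, map_neg, map_one, sub_self])
  · have hp1 : 0 < p - 1 := Nat.sub_pos_of_lt hp.one_lt
    have hlt : ∀ y : ℤ_[p], ‖y‖ < 1 ↔ PadicInt.toZMod y = 0 := fun y => by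
      rw [← PadicInt.mem_nonunits, ← RingHom.mem_ker, PadicInt.ker_toZMod,
        IsLocalRing.mem_maximalIdeal]
    have hx0 : PadicInt.toZMod (x : ℤ_[p]) ≠ 0 := (x.isUnit.map PadicInt.toZMod).ne_zero
    have hcoe : IsUnit (((p - 1 : ℕ) : ℤ_[p]) * (x : ℤ_[p]) ^ (p - 1 - 1)) := by
      refine IsUnit.mul ?_ (x.isUnit.pow _)
      rw [PadicInt.isUnit_iff]
      refine le_antisymm (PadicInt.norm_le_one _) (not_lt.1 fun h => ?_)
      rw [hlt, map_natCast, Nat.cast_sub hp.one_le] at h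
      simp at h
    obtain ⟨z, hz, hz', -⟩ := hensels_lemma (p := p)
      (F := (Polynomial.X ^ (p - 1) - 1 : Polynomial ℤ_[p])) (a := (x : ℤ_[p])) (by
        have h1 : ‖Polynomial.aeval (x : ℤ_[p])
            (Polynomial.derivative (Polynomial.X ^ (p - 1) - 1 : Polynomial ℤ_[p]))‖ = 1 := by
          rw [← PadicInt.isUnit_iff]
          simpa [Polynomial.derivative_X_pow] using hcoe
        rw [h1, one_pow, hlt]
        simp [ZMod.pow_card_sub_one_eq_one hx0])
    have hzp : z ^ (p - 1) = 1 := by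
      have : z ^ (p - 1) - 1 = 0 := by simpa using hz
      exact sub_eq_zero.1 this
    refine ⟨Units.ofPowEqOne z (p - 1) hzp hp1.ne',
      isOfFinOrder_iff_pow_eq_one.2 ⟨p - 1, hp1, Units.pow_ofPowEqOne hzp hp1.ne'⟩, ?_⟩
    rw [if_neg h2]
    have h3 : ‖z - x‖ < 1 := lt_of_lt_of_le hz' (PadicInt.norm_le_one _)
    rw [norm_sub_rev] at h3
    exact (PadicInt.norm_lt_one_iff_dvd _).1 h3

/-- The Teichmüller character: `ω(x)` is the root of unity such that `ω(x)⁻¹ x` lies in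
`1 + p ℤ_p` (in `1 + 4 ℤ_2` if `p = 2`). -/
noncomputable def teichmuller (x : ℤ_[p]ˣ) : ℤ_[p]ˣ := (exists_teichmuller x).choose

/-- The quotient `⟨x⟩ = ω(x)⁻¹ x`. -/
noncomputable def angle (x : ℤ_[p]ˣ) : ℤ_[p]ˣ := (teichmuller x)⁻¹ * x

/-- The power `y ^ s = ∑ binom(s, n) (y - 1) ^ n` for `y ∈ 1 + p ℤ_p` and `s ∈ ℤ_p`. -/
noncomputable def onePow (y s : ℤ_[p]) : ℤ_[p] := ∑' n : ℕ, Ring.choose s n * (y - 1) ^ n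

/-- The inclusion of `ℤ_p` in `ℂ_p`. -/
noncomputable def toCp : ℤ_[p] →+* ℂ_[p] :=
  (algebraMap ℚ_[p] ℂ_[p]).comp PadicInt.Coe.ringHom

variable (p)

/-- The subring `ℤ_p[μ_f]` of `ℂ_p`. -/
noncomputable def zpMu (f : ℕ) : Subring ℂ_[p] :=
  Subring.closure (Set.range (toCp (p := p)) ∪ {ζ | ζ ^ f = 1})

/-- The integers `c_n = ∑_{ζ ^ p = 1} (ζ - 1) ^ n = p ∑_{0 ≤ r ≤ n / p} (-1) ^ (n - p r) binom(n, p r)`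
(see `cCoeff_eq`). -/
def cCoeff (n : ℕ) : ℤ :=
  p * ∑ r ∈ Finset.range (n / p + 1), (-1) ^ (n - p * r) * (n.choose (p * r) : ℤ)

theorem sum_pow_nthRootsFinset (i : ℕ) :
    ∑ ζ ∈ Polynomial.nthRootsFinset p (1 : ℂ_[p]), ζ ^ i = if p ∣ i then (p : ℂ_[p]) else 0 := by
  have hp : p.Prime := Fact.out
  obtain ⟨η, hη⟩ := HasEnoughRootsOfUnity.exists_primitiveRoot ℂ_[p] p
  have h1 : ∑ ζ ∈ Polynomial.nthRootsFinset p (1 : ℂ_[p]), ζ ^ i =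
      ∑ r ∈ Finset.range p, (η ^ r) ^ i := by
    symm
    refine Finset.sum_bij (fun r _ => η ^ r) ?_ ?_ ?_ ?_
    · intro r _
      rw [Polynomial.mem_nthRootsFinset hp.pos, ← pow_mul, mul_comm, pow_mul, hη.pow_eq_one, one_pow]
    · intro a ha b hb hab
      exact hη.pow_inj (Finset.mem_range.1 ha) (Finset.mem_range.1 hb) hab
    · intro b hb
      rw [Polynomial.mem_nthRootsFinset hp.pos] at hb
      obtain ⟨r, hr, h⟩ := hη.eq_pow_of_pow_eq_one hb
      exact ⟨r, Finset.mem_range.2 hr, h⟩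
    · intro _ _; rfl
  rw [h1]
  simp_rw [← pow_mul, mul_comm _ i, pow_mul]
  split_ifs with h
  · rw [(hη.pow_eq_one_iff_dvd i).2 h]
    simp
  · have hne : η ^ i ≠ 1 := fun h' => h ((hη.pow_eq_one_iff_dvd i).1 h')
    have hg := geom_sum_mul (η ^ i) p
    rw [← pow_mul, mul_comm i p, pow_mul, hη.pow_eq_one, one_pow, sub_self] at hg
    exact (mul_eq_zero.1 hg).resolve_right (sub_ne_zero.2 hne)

theorem cCoeff_eq (n : ℕ) :
    (cCoeff p n : ℂ_[p]) = ∑ ζ ∈ Polynomial.nthRootsFinset p (1 : ℂ_[p]), (ζ - 1) ^ n := by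
  have hp : p.Prime := Fact.out
  have h1 : ∀ ζ : ℂ_[p], (ζ - 1) ^ n =
      ∑ i ∈ Finset.range (n + 1), ζ ^ i * ((-1) ^ (n - i) * (n.choose i : ℂ_[p])) := fun ζ => by
    rw [sub_eq_add_neg, add_pow]
    exact Finset.sum_congr rfl fun i _ => by ring
  simp_rw [h1]
  rw [Finset.sum_comm]
  simp_rw [← Finset.sum_mul, sum_pow_nthRootsFinset, ite_mul, zero_mul]
  rw [← Finset.sum_filter]
  unfold cCoeff
  push_cast
  rw [Finset.mul_sum]
  refine Finset.sum_bij (fun r _ => p * r) ?_ ?_ ?_ ?_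
  · intro r hr
    rw [Finset.mem_filter, Finset.mem_range]
    rw [Finset.mem_range, Nat.lt_succ_iff, Nat.le_div_iff_mul_le hp.pos] at hr
    exact ⟨by rw [mul_comm]; exact Nat.lt_succ_of_le hr, dvd_mul_right _ _⟩
  · intro a _ b _ hab
    exact Nat.eq_of_mul_eq_mul_left hp.pos hab
  · intro b hb
    rw [Finset.mem_filter, Finset.mem_range] at hb
    obtain ⟨hb, r, rfl⟩ := hb
    refine ⟨r, ?_, rfl⟩
    rw [Finset.mem_range, Nat.lt_succ_iff, Nat.le_div_iff_mul_le hp.pos, mul_comm]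
    exact Nat.le_of_lt_succ hb
  · intro _ _; rfl

variable {p}

/-- The coefficient `a_{i,l}` of `X₁ ^ i X₂ ^ l` in `(1 + X₁)⁻¹ (1 + X₂)⁻¹ F^j`, where `F^j` is the
image of `F` under the application of `j` to the coefficients. -/
noncomputable def aCoeff (j : QBar →+* ℂ_[p]) (F : MvPowerSeries (Fin 2) QBar) (i l : ℕ) : ℂ_[p] :=
  MvPowerSeries.coeff (Finsupp.single 0 i + Finsupp.single 1 l)
    (((1 + MvPowerSeries.X 0) * (1 + MvPowerSeries.X 1))⁻¹ * MvPowerSeries.map j F)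

/-- The term `c_{i+1} c_{l+1} a_{i,l} / ((i+1)(l+1))` of the double series. -/
noncomputable def seriesTerm (j : QBar →+* ℂ_[p]) (F : MvPowerSeries (Fin 2) QBar) (n : ℕ × ℕ) :
    ℂ_[p] :=
  (cCoeff p (n.1 + 1) : ℂ_[p]) * (cCoeff p (n.2 + 1) : ℂ_[p]) * aCoeff j F n.1 n.2 /
    (((n.1 : ℂ_[p]) + 1) * ((n.2 : ℂ_[p]) + 1))

end Padic

end PadicTwisted

/-! Reduction to a cone. The cone on ρ and ερ is a fundamental domain for multiplication by powers
of ε on the totally positive elements, and |I:(a)| · NI = N(a) there, so Z(s) = NI^s z(s)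
(`zeta_eq_mul_coneZeta`). It remains to study the cone series, complex and p-adic.

Complex side. The cone is cut into finitely many families x + (i + p m₁)τ₁ + (j + p m₂)τ₂, on each
of which the condition p ∤ |I:(a)| is constant. Each family gives a series ∑ z^m₁ w^m₂ N(m₁,
m₂)^(-s) with z, w ≠ 1 roots of unity. Repeated summation by parts replaces N^(-s) by its forward
differences, and each difference gains one power of decay, so the continuation is entire. At s = -n
the high differences of the polynomial N^n vanish, and the value is the finite sum ∑ z^i/(1-z)^(i+1)
· w^l/(1-w)^(l+1) · Δ₁^i Δ₂^l N^n (0,0) (`exists_entire_twistedShintani`). This expression is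
algebraic and makes sense in ℂ and in ℂ_p alike.

p-adic side. As z and w have order prime to p, 1 - z and 1 - w are units. The differences at 0 of a
continuous function on ℤ_p tend to 0, so the same formula, with infinite sums, defines a bounded
functional L on C(ℤ_p × ℤ_p, ℂ_p): a regularised ∑ z^m₁ w^m₂ φ(m₁, m₂) (`abelFunctional₂`). Since p
splits, an element of I has two coordinates in ℤ_p whose product is its norm. The function
ω(y)⁻¹⟨y⟩^(-s), extended by 0 to non-units, is continuous in (s, y) and equals y^n on units when s =
-n lies in M(p). Applying L to it gives the interpolating function (`PadicCoords.coneFun`); cutting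
L along residues modulo p (`abelFunctional₂_residue`) matches the complex decomposition. As M(p) is
dense in D(p), interpolations are unique, and the first formula follows.

Value at 1. There the kernel is 1/y on units and 0 elsewhere, with Mahler expansion -p/y = ∑
c_{i+1}/(i+1) · binom(y-1, i) (`tsum_dCoeff_mul_choose`). Taking this in both coordinates and
applying L termwise produces the double series, because L sends the coefficients of (1+X)^(u + q₁t₁
+ q₂t₂) to those of (1+X)^u / ((1 - z(1+X)^t₁)(1 - w(1+X)^t₂)) (`functionalSeries_mul_denom`).
Integrality holds because ℤ_p[μ_f] is closed in ℂ_p and contains the weights and the kernel values.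
-/

namespace PadicTwisted

open scoped fwdDiff

/-! ### Summation by parts in one and two variables -/

section AbelSummation

open scoped fwdDiff
open Finset

/-- The coefficient `z ^ k / (1 - z) ^ (k + 1)` of the `k`-th forward difference in the Abel
summation of `∑ z ^ m f(m)`. -/
noncomputable def abelWeight {K : Type*} [Field K] (z : K) (k : ℕ) : K := z ^ k / (1 - z) ^ (k + 1)

/-- The truncated Abel summation `∑_{k < n} z ^ k / (1 - z) ^ (k + 1) Δ ^ k f (0)`. -/
noncomputable def abelSum {K : Type*} [Field K] (z : K) (n : ℕ) (f : ℕ → K) : K :=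
  ∑ k ∈ range n, abelWeight z k * Δ_[1] ^[k] f 0

/-- The iterated truncated Abel summation of a function of two variables. -/
noncomputable def abelSum₂ {K : Type*} [Field K] (z w : K) (n : ℕ) (f : ℕ → ℕ → K) : K :=
  abelSum z n fun a => abelSum w n (f a)

theorem map_fwdDiff_iter {M G H : Type*} [AddCommMonoid M] [AddCommGroup G] [AddCommGroup H]
    (φ : G →+ H) (h : M) (f : M → G) (n : ℕ) (x : M) :
    φ (Δ_[h] ^[n] f x) = Δ_[h] ^[n] (fun y => φ (f y)) x := by
  simp only [fwdDiff_iter_eq_sum_shift, map_sum, map_zsmul]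

theorem fwdDiff_iter_comp_natCast {R G : Type*} [NonAssocSemiring R] [AddCommGroup G]
    (f : R → G) (n m : ℕ) :
    Δ_[1] ^[n] (fun a : ℕ => f a) m = Δ_[1] ^[n] f (m : R) := by
  simp [fwdDiff_iter_eq_sum_shift]

theorem map_abelWeight {K L : Type*} [Field K] [Field L] (φ : K →+* L) (z : K) (k : ℕ) :
    φ (abelWeight z k) = abelWeight (φ z) k := by
  simp [abelWeight]

theorem map_abelSum {K L : Type*} [Field K] [Field L] (φ : K →+* L) (z : K) (n : ℕ) (f : ℕ → K) :
    φ (abelSum z n f) = abelSum (φ z) n fun a => φ (f a) := by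
  simp only [abelSum, map_sum, map_mul, map_abelWeight]
  refine sum_congr rfl fun k _ => ?_
  rw [show φ (Δ_[1] ^[k] f 0) = _ from map_fwdDiff_iter φ.toAddMonoidHom 1 f k 0]
  rfl

/-- The values at nonpositive integers are truncated Abel sums over the algebraic numbers; this
carries them both to ℂ and, through `j`, to ℂ_p. -/
theorem map_abelSum₂ {K L : Type*} [Field K] [Field L] (φ : K →+* L) (z w : K) (n : ℕ)
    (f : ℕ → ℕ → K) :
    φ (abelSum₂ z w n f) = abelSum₂ (φ z) (φ w) n fun a b => φ (f a b) := by
  simp only [abelSum₂, map_abelSum]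

/-- The mixed forward difference `Δ₁ ^ i Δ₂ ^ j f`. -/
def mixedDiff {M G : Type*} [AddCommMonoid M] [One M] [AddCommGroup G] (i j : ℕ) (f : M → M → G)
    (x y : M) : G :=
  Δ_[1] ^[i] (fun a => Δ_[1] ^[j] (f a) y) x

theorem mixedDiff_eq_sum {M G : Type*} [AddCommMonoid M] [One M] [AddCommGroup G] (i j : ℕ)
    (f : M → M → G) (x y : M) :
    mixedDiff i j f x y = ∑ a ∈ range (i + 1), ∑ b ∈ range (j + 1),
      (((-1 : ℤ) ^ (i - a) * i.choose a) * ((-1 : ℤ) ^ (j - b) * j.choose b)) •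
        f (x + a • 1) (y + b • 1) := by
  simp only [mixedDiff, fwdDiff_iter_eq_sum_shift, smul_sum, mul_smul]

theorem mixedDiff_comp_natCast {R G : Type*} [NonAssocSemiring R] [AddCommGroup G]
    (f : R → R → G) (i j m n : ℕ) :
    mixedDiff i j (fun a b : ℕ => f a b) m n = mixedDiff i j f (m : R) (n : R) := by
  simp [mixedDiff_eq_sum]

theorem abelSum₂_eq_sum_mixedDiff {K : Type*} [Field K] (z w : K) (n : ℕ) (f : ℕ → ℕ → K) :
    abelSum₂ z w n f = ∑ i ∈ range n, ∑ j ∈ range n,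
      abelWeight z i * abelWeight w j * mixedDiff i j f 0 0 := by
  simp only [abelSum₂, abelSum, mixedDiff]
  refine sum_congr rfl fun i _ => ?_
  have h : (fun a => ∑ j ∈ range n, abelWeight w j * Δ_[1] ^[j] (f a) 0) =
      ∑ j ∈ range n, abelWeight w j • fun a => Δ_[1] ^[j] (f a) 0 := by
    ext a; simp
  rw [h, fwdDiff_iter_finsetSum, Finset.sum_apply, mul_sum]
  refine sum_congr rfl fun j _ => ?_
  rw [fwdDiff_iter_const_smul, Pi.smul_apply, smul_eq_mul, mul_assoc]

/-- The kernel of the `i`-th term in the `n`-fold Abel summation. -/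
noncomputable def abelKernel (z : ℂ) (n i m : ℕ) : ℂ :=
  if i < n then (if m = 0 then abelWeight z i else 0) else (z / (1 - z)) ^ n * z ^ m

theorem norm_abelKernel_le {z : ℂ} (hz : ‖z‖ ≤ 1) (n i : ℕ) :
    ∃ C, 0 ≤ C ∧ ∀ m, ‖abelKernel z n i m‖ ≤ C := by
  refine ⟨max ‖abelWeight z i‖ ‖(z / (1 - z)) ^ n‖, le_max_of_le_left (norm_nonneg _), fun m => ?_⟩
  unfold abelKernel
  split_ifs
  · exact le_max_left _ _
  · simp
  · refine le_max_of_le_right ?_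
    rw [norm_mul, norm_pow z]
    exact mul_le_of_le_one_right (norm_nonneg _) (pow_le_one₀ (norm_nonneg _) hz)

theorem summable_fwdDiff_iter {f : ℕ → ℂ} (hf : Summable f) (n : ℕ) : Summable (Δ_[1] ^[n] f) := by
  induction n with
  | zero => exact hf
  | succ n ih =>
    rw [Function.iterate_succ_apply']
    exact ((summable_nat_add_iff 1).2 ih).sub ih

theorem summable_bounded_mul {ι : Type*} {u f : ι → ℂ} {C : ℝ} (hu : ∀ m, ‖u m‖ ≤ C)
    (hf : Summable f) : Summable fun m => u m * f m :=
  Summable.of_norm_bounded (hf.norm.mul_left C) fun m => by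
    rw [norm_mul]; exact mul_le_mul_of_nonneg_right (hu m) (norm_nonneg _)

/-- Summation by parts: (1 - z) ∑ z^m f(m) = f(0) + z ∑ z^m Δf(m). -/
theorem tsum_pow_mul_step {z : ℂ} (hz : ‖z‖ ≤ 1) (hz1 : z ≠ 1) {f : ℕ → ℂ} (hf : Summable f) :
    ∑' m, z ^ m * f m = 1 / (1 - z) * f 0 + z / (1 - z) * ∑' m, z ^ m * Δ_[1] f m := by
  have hb : ∀ m : ℕ, ‖z ^ m‖ ≤ 1 := fun m => by
    rw [norm_pow]; exact pow_le_one₀ (norm_nonneg _) hz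
  have h1 := summable_bounded_mul hb hf
  have h2 := summable_bounded_mul hb ((summable_nat_add_iff 1).2 hf)
  have h3 : ∑' m, z ^ m * Δ_[1] f m = ∑' m, z ^ m * f (m + 1) - ∑' m, z ^ m * f m := by
    rw [← h2.tsum_sub h1]
    simp only [fwdDiff, mul_sub]
  have h4 : ∑' m, z ^ m * f m = f 0 + z * ∑' m, z ^ m * f (m + 1) := by
    rw [h1.tsum_eq_zero_add, ← tsum_mul_left]
    simp [pow_succ', mul_assoc]
  have h5 : 1 - z ≠ 0 := sub_ne_zero.2 (Ne.symm hz1)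
  rw [h3]
  field_simp
  linear_combination h4

theorem tsum_pow_mul_eq_abelSum_add {z : ℂ} (hz : ‖z‖ ≤ 1) (hz1 : z ≠ 1) {f : ℕ → ℂ}
    (hf : Summable f) (n : ℕ) :
    ∑' m, z ^ m * f m =
      abelSum z n f + (z / (1 - z)) ^ n * ∑' m, z ^ m * Δ_[1] ^[n] f m := by
  induction n with
  | zero => simp [abelSum]
  | succ n ih =>
    rw [ih, tsum_pow_mul_step hz hz1 (summable_fwdDiff_iter hf n), abelSum, abelSum,
      sum_range_succ, Function.iterate_succ_apply',
      show abelWeight z n = (z / (1 - z)) ^ n * (1 / (1 - z)) by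
        rw [abelWeight, pow_succ (1 - z), div_pow, div_mul_div_comm, mul_one]]
    ring

/-- Boundary terms and remainder are put in one shape, the kernel being supported at `m = 0` for `i
< n`. This uniformity lets the formula be applied to each variable in turn. -/
theorem tsum_pow_mul_eq_sum_abelKernel {z : ℂ} (hz : ‖z‖ ≤ 1) (hz1 : z ≠ 1) {f : ℕ → ℂ}
    (hf : Summable f) (n : ℕ) :
    ∑' m, z ^ m * f m =
      ∑ i ∈ range (n + 1), ∑' m, abelKernel z n i m * Δ_[1] ^[i] f m := by
  rw [tsum_pow_mul_eq_abelSum_add hz hz1 hf n, sum_range_succ, abelSum, ← tsum_mul_left]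
  congr 1
  · refine sum_congr rfl fun i hi => ?_
    rw [tsum_eq_single 0]
    · simp [abelKernel, mem_range.1 hi]
    · intro m hm
      simp [abelKernel, mem_range.1 hi, hm]
  · simp [abelKernel, mul_assoc]

theorem summable_mixedDiff {f : ℕ → ℕ → ℂ} (hf : Summable fun m : ℕ × ℕ => f m.1 m.2) (i j : ℕ) :
    Summable fun m : ℕ × ℕ => mixedDiff i j f m.1 m.2 := by
  simp only [mixedDiff_eq_sum]
  refine summable_sum fun a _ => summable_sum fun b _ => ?_
  simp only [← Int.cast_smul_eq_zsmul ℂ]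
  refine Summable.const_smul _ ?_
  have hinj : Function.Injective fun m : ℕ × ℕ => (m.1 + a • 1, m.2 + b • 1) := by
    rintro ⟨x, y⟩ ⟨x', y'⟩ h
    simpa using h
  exact hf.comp_injective hinj

set_option maxHeartbeats 1000000 in
/-- Abel summation in two variables. -/
theorem tsum_pow_mul_pow_mul_eq_sum {z w : ℂ} (hz : ‖z‖ ≤ 1) (hz1 : z ≠ 1) (hw : ‖w‖ ≤ 1)
    (hw1 : w ≠ 1) {f : ℕ → ℕ → ℂ} (hf : Summable fun m : ℕ × ℕ => f m.1 m.2) (n : ℕ) :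
    ∑' m : ℕ × ℕ, z ^ m.1 * w ^ m.2 * f m.1 m.2 =
      ∑ i ∈ range (n + 1), ∑ j ∈ range (n + 1), ∑' m : ℕ × ℕ,
        abelKernel z n i m.1 * abelKernel w n j m.2 * mixedDiff i j f m.1 m.2 := by
  have hb : ∀ {z : ℂ}, ‖z‖ ≤ 1 → ∀ m : ℕ, ‖z ^ m‖ ≤ 1 := fun hz m => by
    rw [norm_pow]; exact pow_le_one₀ (norm_nonneg _) hz
  have hbb : ∀ {u v : ℕ → ℂ} {C D : ℝ}, (∀ m, ‖u m‖ ≤ C) → (∀ m, ‖v m‖ ≤ D) →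
      ∀ m : ℕ × ℕ, ‖u m.1 * v m.2‖ ≤ C * D := fun hu hv m => by
    rw [norm_mul]
    exact mul_le_mul (hu _) (hv _) (norm_nonneg _) ((norm_nonneg _).trans (hu 0))
  have h1 := summable_bounded_mul (hbb (hb hz) (hb hw)) hf
  have hf' : ∀ j, Summable fun m : ℕ × ℕ => Δ_[1] ^[j] (f m.1) m.2 := fun j => by
    simpa [mixedDiff] using summable_mixedDiff hf 0 j
  rw [h1.tsum_prod]
  have h2 : ∀ a, ∑' b, z ^ a * w ^ b * f a b =
      ∑ j ∈ range (n + 1), ∑' b, z ^ a * abelKernel w n j b * Δ_[1] ^[j] (f a) b := by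
    intro a
    simp only [mul_assoc, tsum_mul_left]
    rw [tsum_pow_mul_eq_sum_abelKernel hw hw1 (hf.prod_factor a) n, mul_sum]
  simp only [h2]
  have h3 : ∀ j, Summable fun m : ℕ × ℕ => z ^ m.1 * abelKernel w n j m.2 *
      Δ_[1] ^[j] (f m.1) m.2 := fun j => by
    obtain ⟨C, -, hC⟩ := norm_abelKernel_le hw n j
    exact summable_bounded_mul (hbb (hb hz) hC) (hf' j)
  rw [Summable.tsum_finsetSum fun j _ => (h3 j).prod]
  rw [sum_comm]
  refine sum_congr rfl fun j _ => ?_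
  rw [← (h3 j).tsum_prod]
  -- The second variable is done; interchanging the summations makes the one-variable formula
  -- available for the first.
  refine ((Equiv.prodComm ℕ ℕ).tsum_eq _).symm.trans ?_
  have h3' : Summable fun m : ℕ × ℕ => z ^ m.2 * abelKernel w n j m.1 *
      Δ_[1] ^[j] (f m.2) m.1 := (Equiv.prodComm ℕ ℕ).summable_iff.2 (h3 j)
  have h4 : ∀ i, Summable fun m : ℕ × ℕ =>
      abelKernel z n i m.1 * abelKernel w n j m.2 * mixedDiff i j f m.1 m.2 := fun i => by
    obtain ⟨C, -, hC⟩ := norm_abelKernel_le hz n i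
    obtain ⟨D, -, hD⟩ := norm_abelKernel_le hw n j
    exact summable_bounded_mul (hbb hC hD) (summable_mixedDiff hf i j)
  refine (Summable.tsum_prod h3').trans ?_
  have h5 : ∀ b, ∑' a, z ^ a * abelKernel w n j b * Δ_[1] ^[j] (f a) b =
      ∑ i ∈ range (n + 1), ∑' a,
        abelKernel z n i a * abelKernel w n j b * mixedDiff i j f a b := by
    intro b
    have hs : Summable fun a => Δ_[1] ^[j] (f a) b :=
      ((Equiv.prodComm ℕ ℕ).summable_iff.2 (hf' j)).prod_factor b
    simp only [mul_right_comm _ (abelKernel w n j b), tsum_mul_right]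
    rw [tsum_pow_mul_eq_sum_abelKernel hz hz1 hs n, sum_mul]
    simp only [mixedDiff]
  refine (tsum_congr h5).trans ?_
  have h4' : ∀ i, Summable fun m : ℕ × ℕ =>
      abelKernel z n i m.2 * abelKernel w n j m.1 * mixedDiff i j f m.2 m.1 :=
    fun i => (Equiv.prodComm ℕ ℕ).summable_iff.2 (h4 i)
  rw [Summable.tsum_finsetSum fun i _ => (h4' i).prod]
  refine sum_congr rfl fun i _ => ?_
  rw [← (h4' i).tsum_prod]
  exact (Equiv.prodComm ℕ ℕ).tsum_eq fun m : ℕ × ℕ =>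
    abelKernel z n i m.1 * abelKernel w n j m.2 * mixedDiff i j f m.1 m.2

end AbelSummation

/-! ### Decay of the forward differences of products of powers of affine forms -/

section Symbols

open scoped fwdDiff
open Finset

/-- A family of functions on the quadrant, stable under the two partial derivatives, whose
member of index `(a, b)` is `O((1 + x + y) ^ (-2 Re s - a - b - n))`, locally uniformly in `s`. -/
structure IsSymbol (α β α' β' : ℝ) (n : ℕ) (G : ℕ → ℕ → ℂ → ℝ → ℝ → ℂ) : Prop where
  deriv_fst : ∀ a b s x y, 0 ≤ x → 0 ≤ y → HasDerivAt (fun t => G a b s t y)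
    (-(s + a) * α * G (a + 1) b s x y - (s + b) * β * G a (b + 1) s x y) x
  deriv_snd : ∀ a b s x y, 0 ≤ x → 0 ≤ y → HasDerivAt (fun t => G a b s x t)
    (-(s + a) * α' * G (a + 1) b s x y - (s + b) * β' * G a (b + 1) s x y) y
  bound : ∀ (a b : ℕ) (R : ℝ), ∃ C, 0 ≤ C ∧ ∀ s : ℂ, ‖s‖ ≤ R → ∀ x y : ℝ, 0 ≤ x → 0 ≤ y →
    ‖G a b s x y‖ ≤ C * (1 + x + y) ^ (-2 * s.re - a - b - n)

variable {α β α' β' : ℝ} {n : ℕ} {G : ℕ → ℕ → ℂ → ℝ → ℝ → ℂ}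

theorem IsSymbol.swap (h : IsSymbol α β α' β' n G) :
    IsSymbol α' β' α β n fun a b s x y => G a b s y x where
  deriv_fst a b s x y hx hy := h.deriv_snd a b s y x hy hx
  deriv_snd a b s x y hx hy := h.deriv_fst a b s y x hy hx
  bound a b R := by
    obtain ⟨C, hC, H⟩ := h.bound a b R
    refine ⟨C, hC, fun s hs x y hx hy => ?_⟩
    have := H s hs y x hy hx
    rwa [add_right_comm] at this

theorem rpow_le_two_rpow_mul {u v : ℝ} (hu : 0 < u) (huv : u ≤ v) (hv : v ≤ 2 * u) (e : ℝ) :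
    v ^ e ≤ 2 ^ |e| * u ^ e := by
  have hv0 : 0 < v := hu.trans_le huv
  have h1 : v = v / u * u := by field_simp
  have h2 : 1 ≤ v / u := by rwa [one_le_div hu]
  have h3 : v / u ≤ 2 := by rwa [div_le_iff₀ hu]
  calc v ^ e = (v / u) ^ e * u ^ e := by
        rw [← Real.mul_rpow (by positivity) hu.le, ← h1]
    _ ≤ 2 ^ |e| * u ^ e := by
        gcongr
        calc (v / u) ^ e ≤ (v / u) ^ |e| := Real.rpow_le_rpow_of_exponent_le h2 (le_abs_self e)
          _ ≤ 2 ^ |e| := Real.rpow_le_rpow (by positivity) h3 (abs_nonneg _)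

/-- By the mean value inequality the difference is bounded by the derivative on [x, x+1]. The
derivative raises `a` or `b` by one, and this is the gain of one in the exponent. -/
theorem IsSymbol.diff_fst (h : IsSymbol α β α' β' n G) :
    IsSymbol α β α' β' (n + 1) fun a b s x y => G a b s (x + 1) y - G a b s x y where
  deriv_fst a b s x y hx hy := by
    have h1 := (h.deriv_fst a b s (x + 1) y (by positivity) hy).comp_add_const x 1
    refine (h1.sub (h.deriv_fst a b s x y hx hy)).congr_deriv ?_
    ring
  deriv_snd a b s x y hx hy := by
    refine ((h.deriv_snd a b s (x + 1) y (by positivity) hy).sub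
      (h.deriv_snd a b s x y hx hy)).congr_deriv ?_
    ring
  bound a b R := by
    obtain ⟨C, hC, H⟩ := h.bound (a + 1) b R
    obtain ⟨D, hD, H'⟩ := h.bound a (b + 1) R
    -- `T` bounds the absolute value of the exponent for all ‖s‖ ≤ R. As 1 + t + y is at most twice
    -- 1 + x + y on the segment, changing the base costs at most 2^T.
    set T : ℝ := 2 * |R| + a + b + n + 1 with hT
    set M : ℝ := (|R| + a) * |α| * C + (|R| + b) * |β| * D with hM
    have hM0 : 0 ≤ M := by positivity
    refine ⟨M * 2 ^ T, by positivity, fun s hs x y hx hy => ?_⟩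
    set e : ℝ := -2 * s.re - a - b - (n + 1 : ℕ) with he
    have hsR : ‖s‖ ≤ |R| := hs.trans (le_abs_self R)
    have heT : |e| ≤ T := by
      have h1 : |s.re| ≤ |R| := (Complex.abs_re_le_norm s).trans hsR
      have h2 := abs_le.1 h1
      rw [he, hT, abs_le]
      push_cast
      constructor <;> nlinarith [h2.1, h2.2, Nat.cast_nonneg (α := ℝ) a,
        Nat.cast_nonneg (α := ℝ) b, Nat.cast_nonneg (α := ℝ) n]
    have key : ∀ t ∈ Set.Icc x (x + 1),
        ‖-(s + a) * α * G (a + 1) b s t y - (s + b) * β * G a (b + 1) s t y‖ ≤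
          M * 2 ^ T * (1 + x + y) ^ e := by
      intro t ht
      have ht0 : 0 ≤ t := hx.trans ht.1
      have hu : 0 < 1 + x + y := by positivity
      have h1 := H s hs t y ht0 hy
      have h2 := H' s hs t y ht0 hy
      have e1 : -2 * s.re - (a + 1 : ℕ) - b - n = e := by rw [he]; push_cast; ring
      have e2 : -2 * s.re - a - (b + 1 : ℕ) - n = e := by rw [he]; push_cast; ring
      rw [e1] at h1
      rw [e2] at h2
      have h3 : (1 + t + y) ^ e ≤ 2 ^ T * (1 + x + y) ^ e := by
        refine (rpow_le_two_rpow_mul hu (by linarith [ht.1]) (by linarith [ht.2]) e).trans ?_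
        gcongr
        norm_num
      have h4 : ‖-(s + a) * α‖ ≤ (|R| + a) * |α| := by
        rw [norm_mul, norm_neg, Complex.norm_real, Real.norm_eq_abs]
        gcongr
        refine (norm_add_le _ _).trans ?_
        simpa using hsR
      have h5 : ‖(s + b) * β‖ ≤ (|R| + b) * |β| := by
        rw [norm_mul, Complex.norm_real, Real.norm_eq_abs]
        gcongr
        refine (norm_add_le _ _).trans ?_
        simpa using hsR
      calc _ ≤ ‖-(s + a) * α‖ * ‖G (a + 1) b s t y‖ + ‖(s + b) * β‖ * ‖G a (b + 1) s t y‖ := by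
            refine (norm_sub_le _ _).trans ?_
            rw [norm_mul, norm_mul ((s + b) * β)]
        _ ≤ ((|R| + a) * |α|) * (C * (1 + t + y) ^ e) + ((|R| + b) * |β|) * (D * (1 + t + y) ^ e) := by
            gcongr
        _ = M * (1 + t + y) ^ e := by rw [hM]; ring
        _ ≤ M * (2 ^ T * (1 + x + y) ^ e) := by gcongr
        _ = _ := by ring
    have := norm_image_sub_le_of_norm_deriv_le_segment' (a := x) (b := x + 1)
      (f := fun t => G a b s t y)
      (fun t ht => (h.deriv_fst a b s t y (hx.trans ht.1) hy).hasDerivWithinAt)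
      (fun t ht => key t (Set.Ico_subset_Icc_self ht)) (x + 1) ⟨by linarith, le_rfl⟩
    simpa using this

theorem IsSymbol.diff_snd (h : IsSymbol α β α' β' n G) :
    IsSymbol α β α' β' (n + 1) fun a b s x y => G a b s x (y + 1) - G a b s x y :=
  h.swap.diff_fst.swap

theorem mixedDiff_succ_left {M E : Type*} [AddCommMonoid M] [One M] [AddCommGroup E] (i j : ℕ)
    (f : M → M → E) (x y : M) :
    mixedDiff (i + 1) j f x y = mixedDiff i j f (x + 1) y - mixedDiff i j f x y := by
  unfold mixedDiff
  rw [Function.iterate_succ_apply']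
  rfl

theorem mixedDiff_zero_succ {M E : Type*} [AddCommMonoid M] [One M] [AddCommGroup E] (j : ℕ)
    (f : M → M → E) (x y : M) :
    mixedDiff 0 (j + 1) f x y = mixedDiff 0 j f x (y + 1) - mixedDiff 0 j f x y := by
  unfold mixedDiff
  simp only [Function.iterate_succ_apply' _ j]
  rfl

theorem IsSymbol.mixedDiff (h : IsSymbol α β α' β' n G) (i j : ℕ) :
    IsSymbol α β α' β' (n + i + j) fun a b s => mixedDiff i j (G a b s) := by
  induction i with
  | zero =>
    induction j with
    | zero => exact h
    | succ j ih =>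
      have := ih.diff_snd
      simp only [← mixedDiff_zero_succ] at this
      exact this
  | succ i ih =>
    have := ih.diff_fst
    simp only [← mixedDiff_succ_left] at this
    rwa [show n + i + j + 1 = n + (i + 1) + j by ring] at this

/-- The product of powers `A ^ (-s - a) * B ^ (-s - b)` of two affine forms. -/
noncomputable def affineSymbol (A B : ℝ → ℝ → ℝ) (a b : ℕ) (s : ℂ) (x y : ℝ) : ℂ :=
  Complex.exp (-(s + a) * Real.log (A x y) - (s + b) * Real.log (B x y))

/-- The form lies between the least and the greatest of its coefficients times 1 + x + y. The
logarithmic version serves exponents of either sign. -/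
theorem exists_abs_log_affine_sub_le {a₀ a₁ a₂ : ℝ} (h₀ : 0 < a₀) (h₁ : 0 < a₁) (h₂ : 0 < a₂) :
    ∃ Λ, 0 ≤ Λ ∧ ∀ x y : ℝ, 0 ≤ x → 0 ≤ y →
      |Real.log (a₀ + a₁ * x + a₂ * y) - Real.log (1 + x + y)| ≤ Λ := by
  set c := min a₀ (min a₁ a₂)
  set C := max a₀ (max a₁ a₂)
  have hc : 0 < c := lt_min h₀ (lt_min h₁ h₂)
  have hC : 0 < C := h₀.trans_le (le_max_left _ _)
  refine ⟨max |Real.log c| |Real.log C|, by positivity, fun x y hx hy => ?_⟩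
  have hh : 0 < 1 + x + y := by positivity
  have hA : 0 < a₀ + a₁ * x + a₂ * y := by positivity
  have l0 : c ≤ a₀ := min_le_left _ _
  have l1 : c ≤ a₁ := (min_le_right _ _).trans (min_le_left _ _)
  have l2 : c ≤ a₂ := (min_le_right _ _).trans (min_le_right _ _)
  have u0 : a₀ ≤ C := le_max_left _ _
  have u1 : a₁ ≤ C := (le_max_left _ _).trans (le_max_right _ _)
  have u2 : a₂ ≤ C := (le_max_right _ _).trans (le_max_right _ _)
  have e1 : Real.log c + Real.log (1 + x + y) ≤ Real.log (a₀ + a₁ * x + a₂ * y) := by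
    rw [← Real.log_mul hc.ne' hh.ne']
    apply Real.log_le_log (by positivity)
    nlinarith
  have e2 : Real.log (a₀ + a₁ * x + a₂ * y) ≤ Real.log C + Real.log (1 + x + y) := by
    rw [← Real.log_mul hC.ne' hh.ne']
    apply Real.log_le_log hA
    nlinarith
  rw [abs_le]
  constructor
  · have := neg_abs_le (Real.log c)
    have := le_max_left |Real.log c| |Real.log C|
    linarith
  · have := le_abs_self (Real.log C)
    have := le_max_right |Real.log c| |Real.log C|
    linarith

/-- Differentiating A^(-s-a) multiplies it by -(s+a)A'/A, hence raises the index `a` by one, and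
likewise for B. The bound holds because log A and log B are both log(1 + x + y) + O(1). -/
theorem isSymbol_affineSymbol {a₀ a₁ a₂ b₀ b₁ b₂ : ℝ} (ha₀ : 0 < a₀) (ha₁ : 0 < a₁) (ha₂ : 0 < a₂)
    (hb₀ : 0 < b₀) (hb₁ : 0 < b₁) (hb₂ : 0 < b₂) :
    IsSymbol a₁ b₁ a₂ b₂ 0 (affineSymbol (fun x y => a₀ + a₁ * x + a₂ * y)
      fun x y => b₀ + b₁ * x + b₂ * y) := by
  have hexp : ∀ {A : ℝ}, 0 < A → ∀ s : ℂ, ∀ a : ℕ, Complex.exp (-(s + (a + 1 : ℕ)) * Real.log A) =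
      Complex.exp (-(s + a) * Real.log A) / A := by
    intro A hA s a
    have : Complex.exp (-(Real.log A : ℂ)) = 1 / A := by
      rw [Complex.exp_neg, ← Complex.ofReal_exp, Real.exp_log hA, one_div]
    rw [div_eq_mul_one_div, ← this, ← Complex.exp_add]
    congr 1
    push_cast
    ring
  have hder : ∀ (A B : ℝ → ℝ) (A' B' x : ℝ) (a b : ℕ) (s : ℂ), 0 < A x → 0 < B x →
      HasDerivAt A A' x → HasDerivAt B B' x →
      HasDerivAt (fun t => Complex.exp (-(s + a) * Real.log (A t) - (s + b) * Real.log (B t)))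
        (-(s + a) * A' * Complex.exp (-(s + (a + 1 : ℕ)) * Real.log (A x) - (s + b) * Real.log (B x))
          - (s + b) * B' *
            Complex.exp (-(s + a) * Real.log (A x) - (s + (b + 1 : ℕ)) * Real.log (B x))) x := by
    intro A B A' B' x a b s hA hB dA dB
    have d1 := ((dA.log hA.ne').ofReal_comp.const_mul (-(s + a))).sub
      ((dB.log hB.ne').ofReal_comp.const_mul (s + b))
    refine d1.cexp.congr_deriv ?_
    simp only [Pi.sub_apply]
    rw [Complex.exp_sub, Complex.exp_sub, sub_eq_add_neg (-(s + a : ℂ) * Real.log (A x)),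
      Complex.exp_add, hexp hA, ← neg_mul, hexp hB, neg_mul (s + b), Complex.exp_neg]
    push_cast
    field_simp
  constructor
  · intro a b s x y hx hy
    refine hder (fun t => a₀ + a₁ * t + a₂ * y) (fun t => b₀ + b₁ * t + b₂ * y) a₁ b₁ x a b s
      (by positivity) (by positivity) ?_ ?_
    · simpa using (((hasDerivAt_id x).const_mul a₁).const_add a₀).add_const (a₂ * y)
    · simpa using (((hasDerivAt_id x).const_mul b₁).const_add b₀).add_const (b₂ * y)
  · intro a b s x y hx hy
    refine hder (fun t => a₀ + a₁ * x + a₂ * t) (fun t => b₀ + b₁ * x + b₂ * t) a₂ b₂ y a b s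
      (by positivity) (by positivity) ?_ ?_
    · simpa using ((hasDerivAt_id y).const_mul a₂).const_add (a₀ + a₁ * x)
    · simpa using ((hasDerivAt_id y).const_mul b₂).const_add (b₀ + b₁ * x)
  · intro a b R
    obtain ⟨Λ, hΛ, H⟩ := exists_abs_log_affine_sub_le ha₀ ha₁ ha₂
    obtain ⟨Λ', hΛ', H'⟩ := exists_abs_log_affine_sub_le hb₀ hb₁ hb₂
    refine ⟨Real.exp ((|R| + a) * Λ + (|R| + b) * Λ'), (Real.exp_pos _).le,
      fun s hs x y hx hy => ?_⟩
    have hsR : |s.re| ≤ |R| := (Complex.abs_re_le_norm s).trans (hs.trans (le_abs_self R))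
    have hh : 0 < 1 + x + y := by positivity
    rw [affineSymbol, Complex.norm_exp, Real.rpow_def_of_pos hh, ← Real.exp_add, Real.exp_le_exp]
    simp only [Complex.sub_re, Complex.re_mul_ofReal, Complex.neg_re, Complex.add_re,
      Complex.natCast_re]
    have k1 := H x y hx hy
    have k2 := H' x y hx hy
    have k : ∀ (a : ℕ) (u Λ : ℝ), |u| ≤ Λ → -(s.re + a) * u ≤ (|R| + a) * Λ := by
      intro a u Λ hu
      calc -(s.re + a) * u ≤ |-(s.re + a) * u| := le_abs_self _
        _ = |s.re + a| * |u| := by rw [abs_mul, abs_neg]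
        _ ≤ (|R| + a) * Λ := by
          gcongr
          exact (abs_add_le _ _).trans (by simpa using hsR)
    have m1 := k a _ _ k1
    have m2 := k b _ _ k2
    push_cast
    nlinarith [m1, m2]

end Symbols

/-! ### Entire continuation of twisted Shintani series of rank two -/

section Continuation

open scoped fwdDiff
open Finset

/-- A polynomial of degree at most 2n is killed by more than 2n differences. It is stated over any
commutative ring because it is used over ℂ and over ℤ_p. -/
theorem fwdDiff_iter_affine_pow_mul_pow {R : Type*} [CommRing R] (c d c' d' : R) {n N : ℕ}
    (h : 2 * n < N) (x : ℕ) :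
    Δ_[1] ^[N] (fun a : ℕ => (c + d * a) ^ n * (c' + d' * a) ^ n) x = 0 := by
  let Q : Polynomial R := (Polynomial.C c + Polynomial.C d * Polynomial.X) ^ n *
    (Polynomial.C c' + Polynomial.C d' * Polynomial.X) ^ n
  have hlin : ∀ c d : R, (Polynomial.C c + Polynomial.C d * Polynomial.X).natDegree ≤ 1 := by
    intro c d
    compute_degree
  have hQ : Q.natDegree < N := by
    refine lt_of_le_of_lt ?_ h
    refine Polynomial.natDegree_mul_le.trans ?_
    have h1 := Polynomial.natDegree_pow_le_of_le n (hlin c d)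
    have h2 := Polynomial.natDegree_pow_le_of_le n (hlin c' d')
    omega
  have h1 : (fun a : ℕ => (c + d * a) ^ n * (c' + d' * a) ^ n) = fun a : ℕ => Q.eval (a : R) := by
    funext a
    simp [Q]
  rw [h1, fwdDiff_iter_comp_natCast (f := fun r => Q.eval r),
    show (fun r => Q.eval r) = Q.eval from rfl, Polynomial.fwdDiff_iter_eq_zero_of_degree_lt hQ]
  rfl

/-- The differences in the second variable form a fixed linear combination of shifts, so they
commute with those in the first. -/
theorem mixedDiff_eq_zero_of_fst {M G : Type*} [AddCommMonoid M] [One M] [AddCommGroup G] {i : ℕ}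
    {f : M → M → G} (h : ∀ x y, Δ_[1] ^[i] (fun a => f a y) x = 0) (j : ℕ) (x y : M) :
    mixedDiff i j f x y = 0 := by
  have h1 : (fun a => Δ_[1] ^[j] (f a) y) = ∑ b ∈ range (j + 1),
      ((-1 : ℤ) ^ (j - b) * j.choose b) • fun a => f a (y + b • 1) := by
    funext a
    simp only [fwdDiff_iter_eq_sum_shift, Finset.sum_apply, Pi.smul_apply]
  rw [mixedDiff, h1, fwdDiff_iter_finsetSum, Finset.sum_apply]
  refine sum_eq_zero fun b _ => ?_
  rw [fwdDiff_iter_const_smul, Pi.smul_apply, h, smul_zero]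

theorem mixedDiff_eq_zero_of_snd {M G : Type*} [AddCommMonoid M] [One M] [AddCommGroup G] {j : ℕ}
    {f : M → M → G} (h : ∀ x y, Δ_[1] ^[j] (f x) y = 0) (i : ℕ) (x y : M) :
    mixedDiff i j f x y = 0 := by
  rw [mixedDiff]
  simp only [h]
  rw [fwdDiff_iter_eq_sum_shift]
  simp

/-- Functions on a decreasing sequence of half planes that agree on the first one glue to an entire
function. -/
theorem exists_entire_of_halfPlanes {D : ℂ → ℂ} {g : ℕ → ℂ → ℂ}
    (hg : ∀ N : ℕ, DifferentiableOn ℂ (g N) {s | 1 - (N : ℝ) / 2 < s.re})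
    (hD : ∀ N s, 1 < s.re → g N s = D s) :
    ∃ G : ℂ → ℂ, Differentiable ℂ G ∧ ∀ (N : ℕ) (s : ℂ), 1 - (N : ℝ) / 2 < s.re → G s = g N s := by
  have hopen : ∀ c : ℝ, IsOpen {s : ℂ | c < s.re} := fun c =>
    isOpen_lt continuous_const Complex.continuous_re
  have hagree : ∀ N M : ℕ, N ≤ M → ∀ s : ℂ, 1 - (N : ℝ) / 2 < s.re → g N s = g M s := by
    intro N M hNM s hs
    have hsub : {s : ℂ | 1 - (N : ℝ) / 2 < s.re} ⊆ {s : ℂ | 1 - (M : ℝ) / 2 < s.re} := by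
      intro t ht
      have : (N : ℝ) ≤ M := by exact_mod_cast hNM
      simp only [Set.mem_ofPred_eq] at ht ⊢
      linarith
    have h2 : (2 : ℂ) ∈ {s : ℂ | 1 - (N : ℝ) / 2 < s.re} := by
      have : (0 : ℝ) ≤ N := by positivity
      simp only [Set.mem_ofPred_eq, Complex.re_ofNat]
      linarith
    refine ((hg N).analyticOnNhd (hopen _)).eqOn_of_preconnected_of_eventuallyEq
      (((hg M).mono hsub).analyticOnNhd (hopen _))
      (convex_halfSpace_re_gt _).isPreconnected h2 ?_ hs
    -- The point 2 lies in every half plane and has a neighbourhood where both functions are the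
    -- given `D`.
    filter_upwards [(hopen 1).mem_nhds (show (1 : ℝ) < (2 : ℂ).re by simp)] with t ht
    rw [hD N t ht, hD M t ht]
  -- This index gives 1 - N/2 ≤ -|Re s| - 1/2 < Re s; any index depending on `s` with this property
  -- would do.
  have key : ∀ s : ℂ, 1 - ((⌈2 * |s.re|⌉₊ + 3 : ℕ) : ℝ) / 2 < s.re := by
    intro s
    have h1 := Nat.le_ceil (2 * |s.re|)
    have h2 := neg_abs_le s.re
    push_cast
    linarith
  refine ⟨fun s => g (⌈2 * |s.re|⌉₊ + 3) s, ?_, ?_⟩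
  · intro s
    have hN := key s
    set N := ⌈2 * |s.re|⌉₊ + 3
    have h1 : DifferentiableAt ℂ (g N) s := (hg N).differentiableAt ((hopen _).mem_nhds hN)
    refine h1.congr_of_eventuallyEq ?_
    filter_upwards [(hopen _).mem_nhds hN] with t ht
    have ht' := key t
    rcases le_total (⌈2 * |t.re|⌉₊ + 3) N with h | h
    · exact hagree _ _ h t ht'
    · exact (hagree _ _ h t ht).symm
  · intro N s hs
    rcases le_total (⌈2 * |s.re|⌉₊ + 3) N with h | h
    · exact hagree _ _ h s (key s)
    · exact (hagree _ _ h s hs).symm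

theorem summable_rpow_mul_rpow {e : ℝ} (he : 1 < e) :
    Summable fun m : ℕ × ℕ => (1 + (m.1 : ℝ)) ^ (-e) * (1 + (m.2 : ℝ)) ^ (-e) := by
  have h : Summable fun n : ℕ => (1 + (n : ℝ)) ^ (-e) := by
    have := (summable_nat_add_iff 1).2 (Real.summable_nat_rpow.2 (show -e < -1 by linarith))
    simpa [add_comm] using this
  exact h.mul_of_nonneg h (fun n => by positivity) (fun n => by positivity)

/-- Reduces the double sum of the majorant to a product of two simple sums. -/
theorem rpow_add_add_le {e : ℝ} (he : 0 ≤ e) {x y : ℝ} (hx : 0 ≤ x) (hy : 0 ≤ y) :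
    (1 + x + y) ^ (-(2 * e)) ≤ (1 + x) ^ (-e) * (1 + y) ^ (-e) := by
  have h : (0 : ℝ) < 1 + x + y := by positivity
  rw [show -(2 * e) = -e + -e by ring, Real.rpow_add h]
  exact mul_le_mul (Real.rpow_le_rpow_of_nonpos (by positivity) (by linarith) (by linarith))
    (Real.rpow_le_rpow_of_nonpos (by positivity) (by linarith) (by linarith)) (by positivity)
    (by positivity)

variable {a₀ a₁ a₂ b₀ b₁ b₂ : ℝ}

theorem affineSymbol_zero_zero {A B : ℝ → ℝ → ℝ} {x y : ℝ} (hA : 0 < A x y) (hB : 0 < B x y) (s : ℂ) :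
    affineSymbol A B 0 0 s x y = ((A x y * B x y : ℝ) : ℂ) ^ (-s) := by
  have h : ((A x y * B x y : ℝ) : ℂ) ≠ 0 := by exact_mod_cast (mul_pos hA hB).ne'
  rw [Complex.cpow_def_of_ne_zero h, ← Complex.ofReal_log (mul_pos hA hB).le,
    Real.log_mul hA.ne' hB.ne', affineSymbol]
  congr 1
  push_cast
  ring

theorem differentiable_affineSymbol (A B : ℝ → ℝ → ℝ) (x y : ℝ) :
    Differentiable ℂ fun s => affineSymbol A B 0 0 s x y := by
  unfold affineSymbol
  fun_prop

theorem differentiable_mixedDiff_affineSymbol (A B : ℝ → ℝ → ℝ) (i j : ℕ) (x y : ℝ) :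
    Differentiable ℂ fun s => mixedDiff i j (affineSymbol A B 0 0 s) x y := by
  simp only [mixedDiff_eq_sum]
  refine Differentiable.fun_sum fun a _ => Differentiable.fun_sum fun b _ => ?_
  simp only [← Int.cast_smul_eq_zsmul ℂ, smul_eq_mul]
  exact (differentiable_affineSymbol A B _ _).const_mul _

/-- The majorant for the terms of the twice `N`-fold Abel summation. -/
theorem norm_abelKernel_mul_mixedDiff_le {z w : ℂ} (hz : ‖z‖ ≤ 1) (hw : ‖w‖ ≤ 1)
    {α β α' β' : ℝ} {G : ℕ → ℕ → ℂ → ℝ → ℝ → ℂ} (hG : IsSymbol α β α' β' 0 G) (N : ℕ) {i j : ℕ}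
    (hi : i ≤ N) (hj : j ≤ N) {c R : ℝ} (hc : 1 - (N : ℝ) / 2 < c) :
    ∃ C, ∀ s : ℂ, ‖s‖ ≤ R → c ≤ s.re → ∀ m : ℕ × ℕ,
      ‖abelKernel z N i m.1 * abelKernel w N j m.2 * mixedDiff i j (G 0 0 s) m.1 m.2‖ ≤
        C * ((1 + (m.1 : ℝ)) ^ (-(c + N / 2)) * (1 + (m.2 : ℝ)) ^ (-(c + N / 2))) := by
  obtain ⟨C₁, hC₁, H₁⟩ := norm_abelKernel_le hz N i
  obtain ⟨C₂, hC₂, H₂⟩ := norm_abelKernel_le hw N j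
  obtain ⟨C₃, hC₃, H₃⟩ := (hG.mixedDiff i j).bound 0 0 R
  refine ⟨C₁ * C₂ * C₃, fun s hs hcs m => ?_⟩
  by_cases h0 : abelKernel z N i m.1 * abelKernel w N j m.2 = 0
  · rw [h0, zero_mul, norm_zero]
    positivity
  have hm : 0 ≤ (m.1 : ℝ) := by positivity
  have hm' : 0 ≤ (m.2 : ℝ) := by positivity
  -- If i, j < N, the kernels vanish away from the origin, where the base is 1 and no decay is
  -- needed. Otherwise i = N or j = N, and the differences have gained at least N powers.
  have h1 : (1 + (m.1 : ℝ) + m.2) ^ (-2 * s.re - (0 : ℕ) - (0 : ℕ) - (0 + i + j : ℕ)) ≤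
      (1 + (m.1 : ℝ) + m.2) ^ (-(2 * (c + N / 2))) := by
    by_cases hij : i < N ∧ j < N
    · have e1 : m.1 = 0 := by
        by_contra h
        exact h0 (by simp [abelKernel, hij.1, h])
      have e2 : m.2 = 0 := by
        by_contra h
        exact h0 (by simp [abelKernel, hij.2, h])
      simp [e1, e2]
    · refine Real.rpow_le_rpow_of_exponent_le (by linarith) ?_
      have hNij : (N : ℝ) ≤ (0 + i + j : ℕ) := by
        have : N ≤ 0 + i + j := by
          by_contra h
          exact hij ⟨by omega, by omega⟩
        exact_mod_cast this
      push_cast at hNij ⊢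
      linarith
  rw [norm_mul, norm_mul]
  calc _ ≤ C₁ * C₂ * (C₃ * (1 + (m.1 : ℝ) + m.2) ^
          (-2 * s.re - (0 : ℕ) - (0 : ℕ) - (0 + i + j : ℕ))) := by
        gcongr
        · exact H₁ _
        · exact H₂ _
        · exact H₃ s hs _ _ hm hm'
    _ ≤ C₁ * C₂ * (C₃ * ((1 + (m.1 : ℝ)) ^ (-(c + N / 2)) * (1 + (m.2 : ℝ)) ^ (-(c + N / 2)))) := by
        gcongr
        exact h1.trans (rpow_add_add_le (by linarith) hm hm')
    _ = _ := by ring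

theorem summable_affineSymbol (ha₀ : 0 < a₀) (ha₁ : 0 < a₁) (ha₂ : 0 < a₂)
    (hb₀ : 0 < b₀) (hb₁ : 0 < b₁) (hb₂ : 0 < b₂) {s : ℂ} (hs : 1 < s.re) :
    Summable fun m : ℕ × ℕ => affineSymbol (fun x y => a₀ + a₁ * x + a₂ * y)
      (fun x y => b₀ + b₁ * x + b₂ * y) 0 0 s m.1 m.2 := by
  obtain ⟨C, hC, H⟩ := (isSymbol_affineSymbol ha₀ ha₁ ha₂ hb₀ hb₁ hb₂).bound 0 0 ‖s‖
  refine Summable.of_norm_bounded ((summable_rpow_mul_rpow hs).mul_left C) fun m => ?_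
  refine (H s le_rfl m.1 m.2 (by positivity) (by positivity)).trans ?_
  gcongr
  simpa using rpow_add_add_le (e := s.re) (by linarith) (Nat.cast_nonneg m.1) (Nat.cast_nonneg m.2)

/-- The analytic continuation of a twisted Shintani zeta function of rank two, and its values at
the nonpositive integers. -/
theorem exists_entire_twistedShintani {z w : ℂ} (hz : ‖z‖ ≤ 1) (hz1 : z ≠ 1) (hw : ‖w‖ ≤ 1)
    (hw1 : w ≠ 1) (ha₀ : 0 < a₀) (ha₁ : 0 < a₁) (ha₂ : 0 < a₂)
    (hb₀ : 0 < b₀) (hb₁ : 0 < b₁) (hb₂ : 0 < b₂) :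
    ∃ g : ℂ → ℂ, Differentiable ℂ g ∧
      (∀ s : ℂ, 1 < s.re → HasSum (fun m : ℕ × ℕ => z ^ m.1 * w ^ m.2 *
        (((a₀ + a₁ * m.1 + a₂ * m.2) * (b₀ + b₁ * m.1 + b₂ * m.2) : ℝ) : ℂ) ^ (-s)) (g s)) ∧
      ∀ n N : ℕ, 2 * n + 2 < N → g (-(n : ℂ)) = abelSum₂ z w N fun a b =>
        (((a₀ + a₁ * a + a₂ * b) * (b₀ + b₁ * a + b₂ * b) : ℝ) : ℂ) ^ n := by
  set A : ℝ → ℝ → ℝ := fun x y => a₀ + a₁ * x + a₂ * y with hA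
  set B : ℝ → ℝ → ℝ := fun x y => b₀ + b₁ * x + b₂ * y with hB
  have hsym := isSymbol_affineSymbol ha₀ ha₁ ha₂ hb₀ hb₁ hb₂
  set T : ℕ → ℕ → ℕ → ℂ → ℕ × ℕ → ℂ := fun N i j s m =>
    abelKernel z N i m.1 * abelKernel w N j m.2 * mixedDiff i j (affineSymbol A B 0 0 s) m.1 m.2
    with hT
  have hcpow : ∀ (s : ℂ) (m : ℕ × ℕ), affineSymbol A B 0 0 s m.1 m.2 =
      (((a₀ + a₁ * m.1 + a₂ * m.2) * (b₀ + b₁ * m.1 + b₂ * m.2) : ℝ) : ℂ) ^ (-s) := fun s m => by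
    rw [affineSymbol_zero_zero (by simp only [hA]; positivity) (by simp only [hB]; positivity)]
  -- Each `g N` is the N-fold Abel summation of the same series; it converges for Re s > 1 - N/2.
  set g : ℕ → ℂ → ℂ := fun N s => ∑ i ∈ range (N + 1), ∑ j ∈ range (N + 1), ∑' m, T N i j s m with hg
  have hD : ∀ N s, 1 < s.re → g N s = ∑' m : ℕ × ℕ, z ^ m.1 * w ^ m.2 *
      affineSymbol A B 0 0 s m.1 m.2 := by
    intro N s hs
    have := tsum_pow_mul_pow_mul_eq_sum hz hz1 hw hw1
      (f := fun a b : ℕ => affineSymbol A B 0 0 s a b)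
      (summable_affineSymbol ha₀ ha₁ ha₂ hb₀ hb₁ hb₂ hs) N
    rw [this]
    simp only [hg, hT, mixedDiff_comp_natCast (f := affineSymbol A B 0 0 s)]
  obtain ⟨G, hG, hGg⟩ := exists_entire_of_halfPlanes (g := g) (fun N => by
    refine DifferentiableOn.fun_sum fun i hi => DifferentiableOn.fun_sum fun j hj => ?_
    intro s hs
    obtain ⟨c, hc1, hc2⟩ := exists_between (show 1 - (N : ℝ) / 2 < s.re from hs)
    obtain ⟨C, hC⟩ := norm_abelKernel_mul_mixedDiff_le hz hw hsym N
      (Nat.lt_succ_iff.1 (mem_range.1 hi)) (Nat.lt_succ_iff.1 (mem_range.1 hj)) (R := ‖s‖ + 1) hc1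
    have hU : IsOpen ({t : ℂ | ‖t‖ < ‖s‖ + 1} ∩ {t : ℂ | c < t.re}) :=
      (isOpen_lt continuous_norm continuous_const).inter
        (isOpen_lt continuous_const Complex.continuous_re)
    refine DifferentiableAt.differentiableWithinAt ?_
    refine (Complex.differentiableOn_tsum_of_summable_norm
      ((summable_rpow_mul_rpow (e := c + N / 2) (by linarith)).mul_left C) (fun m => ?_) hU
      fun m t ht => hC t (le_of_lt ht.1) (le_of_lt ht.2) m).differentiableAt
      (hU.mem_nhds ⟨by simp, hc2⟩)
    exact ((differentiable_mixedDiff_affineSymbol A B i j m.1 m.2).const_mul _).differentiableOn) hD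
  refine ⟨G, hG, fun s hs => ?_, fun n N hN => ?_⟩
  · have h0 : G s = ∑' m : ℕ × ℕ, z ^ m.1 * w ^ m.2 * affineSymbol A B 0 0 s m.1 m.2 := by
      rw [hGg 0 s (by simpa using hs), hD 0 s hs]
    rw [h0]
    simp only [← hcpow]
    refine (summable_bounded_mul (C := 1) (fun m => ?_)
      (summable_affineSymbol ha₀ ha₁ ha₂ hb₀ hb₁ hb₂ hs)).hasSum
    rw [norm_mul, norm_pow, norm_pow]
    exact mul_le_one₀ (pow_le_one₀ (norm_nonneg _) hz) (by positivity)
      (pow_le_one₀ (norm_nonneg _) hw)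
  -- The hypothesis on N says that -n lies in the half plane Re s > 1 - N/2. It also exceeds 2n, so
  -- the remainders vanish and only the boundary terms, at the origin, survive.
  · have hN' : (2 * n + 2 : ℝ) < N := by exact_mod_cast hN
    rw [hGg N _ (by simp only [Complex.neg_re, Complex.natCast_re]; linarith)]
    have hval : ∀ a b : ℕ, affineSymbol A B 0 0 (-(n : ℂ)) a b =
        ((a₀ + a₁ * a + a₂ * b : ℝ) : ℂ) ^ n * ((b₀ + b₁ * a + b₂ * b : ℝ) : ℂ) ^ n := by
      intro a b
      rw [hcpow _ (a, b), neg_neg, Complex.cpow_natCast, ← mul_pow]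
      push_cast
      rfl
    have hmix : ∀ i j (m : ℕ × ℕ), mixedDiff i j (affineSymbol A B 0 0 (-(n : ℂ))) m.1 m.2 =
        mixedDiff i j (fun a b : ℕ =>
          ((a₀ + a₁ * a + a₂ * b : ℝ) : ℂ) ^ n * ((b₀ + b₁ * a + b₂ * b : ℝ) : ℂ) ^ n) m.1 m.2 := by
      intro i j m
      rw [← mixedDiff_comp_natCast]
      simp only [hval]
    have hz0 : ∀ i j (x y : ℕ), i = N ∨ j = N → mixedDiff i j (fun a b : ℕ =>
        ((a₀ + a₁ * a + a₂ * b : ℝ) : ℂ) ^ n * ((b₀ + b₁ * a + b₂ * b : ℝ) : ℂ) ^ n) x y = 0 := by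
      rintro i j x y (rfl | rfl)
      · refine mixedDiff_eq_zero_of_fst (fun x y => ?_) j x y
        have := fwdDiff_iter_affine_pow_mul_pow (a₀ + a₂ * y : ℂ) a₁ (b₀ + b₂ * y) b₁
          (show 2 * n < i by omega) x
        convert this using 4 <;> · push_cast; ring
      · refine mixedDiff_eq_zero_of_snd (fun x y => ?_) i x y
        have := fwdDiff_iter_affine_pow_mul_pow (a₀ + a₁ * x : ℂ) a₂ (b₀ + b₁ * x) b₂
          (show 2 * n < j by omega) y
        convert this using 4 <;> · push_cast; ring
    simp only [hg, hT, hmix]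
    rw [sum_range_succ, sum_eq_zero (s := range (N + 1))
      (fun j _ => by simp only [hz0 N j _ _ (Or.inl rfl), mul_zero, tsum_zero]), add_zero, abelSum₂_eq_sum_mixedDiff]
    refine sum_congr rfl fun i hi => ?_
    rw [sum_range_succ, show (∑' m : ℕ × ℕ, abelKernel z N i m.1 * abelKernel w N N m.2 *
      mixedDiff i N (fun a b : ℕ => ((a₀ + a₁ * a + a₂ * b : ℝ) : ℂ) ^ n *
        ((b₀ + b₁ * a + b₂ * b : ℝ) : ℂ) ^ n) m.1 m.2) = 0 by
        simp only [hz0 i N _ _ (Or.inr rfl), mul_zero, tsum_zero], add_zero]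
    refine sum_congr rfl fun j hj => ?_
    rw [tsum_eq_single (0, 0)]
    · simp [abelKernel, mem_range.1 hi, mem_range.1 hj, mul_pow]
    · rintro ⟨x, y⟩ hxy
      have : x ≠ 0 ∨ y ≠ 0 := by
        by_contra h
        push Not at h
        exact hxy (by rw [h.1, h.2])
      rcases this with h | h <;> simp [abelKernel, mem_range.1 hi, mem_range.1 hj, h]

end Continuation

/-! ### Fractional ideals prime to p, indices and norms -/

section IdealArithmetic

variable {k : Type*} [Field k] [NumberField k]

theorem le_count_coeIdeal_iff (v : HeightOneSpectrum (𝓞 k)) {J : Ideal (𝓞 k)} (hJ : J ≠ 0) (n : ℕ) :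
    (n : ℤ) ≤ FractionalIdeal.count k v (J : FractionalIdeal (𝓞 k)⁰ k) ↔ v.asIdeal ^ n ∣ J := by
  classical
  rw [FractionalIdeal.count_coe k v hJ, Nat.cast_le,
    ← Associates.prime_pow_dvd_iff_le (Associates.mk_ne_zero.2 hJ) v.associates_irreducible,
    ← Associates.mk_pow, Associates.mk_le_mk_iff_dvd]

theorem count_coeIdeal_eq_zero_iff (v : HeightOneSpectrum (𝓞 k)) {J : Ideal (𝓞 k)} (hJ : J ≠ 0) :
    FractionalIdeal.count k v (J : FractionalIdeal (𝓞 k)⁰ k) = 0 ↔ ¬ J ≤ v.asIdeal := by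
  have h1 := le_count_coeIdeal_iff v hJ 1
  have h2 := FractionalIdeal.count_coe_nonneg k v J
  rw [pow_one, Ideal.dvd_iff_le] at h1
  rw [← h1]
  push_cast
  omega

variable (p : ℕ) [hp : Fact p.Prime]

theorem forall_count_eq_zero_iff_sup_span_eq_top {J : Ideal (𝓞 k)} (hJ : J ≠ 0) :
    (∀ v ∈ primesAbove k p, FractionalIdeal.count k v (J : FractionalIdeal (𝓞 k)⁰ k) = 0) ↔
      J ⊔ Ideal.span {(p : 𝓞 k)} = ⊤ := by
  have hp0 : (p : 𝓞 k) ≠ 0 := Nat.cast_ne_zero.2 hp.out.ne_zero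
  constructor
  · intro h
    by_contra hne
    obtain ⟨M, hM, hle⟩ := Ideal.exists_le_maximal _ hne
    have hpM : (p : 𝓞 k) ∈ M := hle (Ideal.mem_sup_right (Ideal.mem_span_singleton_self _))
    let v : HeightOneSpectrum (𝓞 k) := ⟨M, hM.isPrime, fun h0 => hp0 (by simpa [h0] using hpM)⟩
    exact (count_coeIdeal_eq_zero_iff v hJ).1 (h v hpM) (le_sup_left.trans hle)
  · intro h v hv
    rw [count_coeIdeal_eq_zero_iff v hJ]
    intro hle
    exact v.isPrime.ne_top (top_le_iff.1 (h ▸ sup_le hle ((Ideal.span_singleton_le_iff_mem _).2 hv)))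

/-- A maximal ideal containing J and p has norm a nontrivial power of p dividing that of J.
Conversely, if p divides the order of the quotient, Cauchy's theorem gives an element of order p,
while p acts invertibly modulo J when J + (p) is the unit ideal. -/
theorem not_dvd_absNorm_iff_sup_span_eq_top {J : Ideal (𝓞 k)} (hJ : J ≠ 0) :
    ¬ p ∣ Ideal.absNorm J ↔ J ⊔ Ideal.span {(p : 𝓞 k)} = ⊤ := by
  constructor
  · intro h
    by_contra hne
    obtain ⟨M, hM, hle⟩ := Ideal.exists_le_maximal _ hne
    have hpM : (p : 𝓞 k) ∈ M := hle (Ideal.mem_sup_right (Ideal.mem_span_singleton_self _))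
    refine h (dvd_trans ?_ (Ideal.absNorm_dvd_absNorm_of_le (le_sup_left.trans hle)))
    have h1 := Ideal.absNorm_dvd_absNorm_of_le ((Ideal.span_singleton_le_iff_mem _).2 hpM)
    rw [Ideal.absNorm_span_natCast] at h1
    obtain ⟨i, -, hi⟩ := (Nat.dvd_prime_pow hp.out).1 h1
    rw [hi]
    refine dvd_pow_self p fun h0 => hM.ne_top ?_
    rw [h0, pow_zero] at hi
    exact Ideal.absNorm_eq_one_iff.1 hi
  · intro h hdvd
    have hfin : Finite (𝓞 k ⧸ J) := Ideal.finiteQuotientOfFreeOfNeBot J hJ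
    rw [Ideal.absNorm_apply, Submodule.cardQuot_apply] at hdvd
    obtain ⟨x, hx⟩ := exists_prime_addOrderOf_dvd_card' p hdvd
    obtain ⟨y, rfl⟩ := Ideal.Quotient.mk_surjective x
    have h1 : (p : 𝓞 k) * y ∈ J := by
      have := addOrderOf_nsmul_eq_zero (Ideal.Quotient.mk J y)
      rw [hx, ← map_nsmul, Ideal.Quotient.eq_zero_iff_mem, nsmul_eq_mul] at this
      exact this
    have h2 : (1 : 𝓞 k) ∈ J ⊔ Ideal.span {(p : 𝓞 k)} := by rw [h]; trivial
    obtain ⟨a, ha, b, hb, hab⟩ := Submodule.mem_sup.1 h2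
    obtain ⟨c, rfl⟩ := Ideal.mem_span_singleton'.1 hb
    have h3 : y ∈ J := by
      have : y = y * a + c * (p * y) := by linear_combination -y * hab
      rw [this]
      exact J.add_mem (J.mul_mem_left _ ha) (J.mul_mem_left _ h1)
    have h4 : Ideal.Quotient.mk J y = 0 := Ideal.Quotient.eq_zero_iff_mem.2 h3
    rw [h4, addOrderOf_zero] at hx
    exact hp.out.one_lt.ne hx

theorem coeIdeal_ne_zero_of_ne_zero {J : Ideal (𝓞 k)} (hJ : J ≠ 0) :
    (J : FractionalIdeal (𝓞 k)⁰ k) ≠ 0 := by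
  simpa using hJ

/-- A fractional ideal prime to `p` is a quotient of integral ideals prime to `p`. -/
theorem exists_mul_coeIdeal_eq {I : FractionalIdeal (𝓞 k)⁰ k} (hI0 : I ≠ 0)
    (hI : ∀ v ∈ primesAbove k p, FractionalIdeal.count k v I = 0) :
    ∃ 𝔟 𝔠 : Ideal (𝓞 k), 𝔟 ≠ 0 ∧ 𝔠 ≠ 0 ∧ I * (𝔟 : FractionalIdeal (𝓞 k)⁰ k) = 𝔠 ∧
      𝔟 ⊔ Ideal.span {(p : 𝓞 k)} = ⊤ ∧ 𝔠 ⊔ Ideal.span {(p : 𝓞 k)} = ⊤ := by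
  obtain ⟨a, J, ha, hIJ⟩ := FractionalIdeal.exists_eq_spanSingleton_mul I
  have ha' : algebraMap (𝓞 k) k a ≠ 0 := by simpa using ha
  have hspan : FractionalIdeal.spanSingleton (𝓞 k)⁰ (algebraMap (𝓞 k) k a) =
      ((Ideal.span {a} : Ideal (𝓞 k)) : FractionalIdeal (𝓞 k)⁰ k) :=
    (FractionalIdeal.coeIdeal_span_singleton a).symm
  have hspan0 : FractionalIdeal.spanSingleton (𝓞 k)⁰ (algebraMap (𝓞 k) k a) ≠ 0 :=
    FractionalIdeal.spanSingleton_ne_zero_iff.2 ha'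
  have hJI : FractionalIdeal.spanSingleton (𝓞 k)⁰ (algebraMap (𝓞 k) k a) * I = J := by
    rw [hIJ, ← mul_assoc, FractionalIdeal.spanSingleton_mul_spanSingleton, mul_inv_cancel₀ ha',
      FractionalIdeal.spanSingleton_one, one_mul]
  have hJ0 : J ≠ 0 := by
    rintro rfl
    rw [show ((0 : Ideal (𝓞 k)) : FractionalIdeal (𝓞 k)⁰ k) = 0 by simp] at hJI
    exact mul_ne_zero hspan0 hI0 hJI
  have ha0 : (Ideal.span {a} : Ideal (𝓞 k)) ≠ 0 := by
    simpa [Ideal.zero_eq_bot, Ideal.span_singleton_eq_bot] using ha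
  -- I = J/(a), and M is the greatest common divisor of J and (a). At a prime above p the ideals J
  -- and (a) have the same valuation, so dividing both by M removes all of it.
  set M : Ideal (𝓞 k) := J ⊔ Ideal.span {a} with hM
  have hM0 : M ≠ 0 := fun h => hJ0 (by
    rw [Ideal.zero_eq_bot] at h ⊢
    exact (sup_eq_bot_iff.1 h).1)
  obtain ⟨𝔟, h𝔟⟩ := Ideal.dvd_iff_le.2 (le_sup_right : Ideal.span {a} ≤ M)
  obtain ⟨𝔠, h𝔠⟩ := Ideal.dvd_iff_le.2 (le_sup_left : J ≤ M)
  have hMf : (M : FractionalIdeal (𝓞 k)⁰ k) ≠ 0 := coeIdeal_ne_zero_of_ne_zero hM0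
  have h𝔟0 : 𝔟 ≠ 0 := by rintro rfl; exact ha0 (by rw [h𝔟, mul_zero])
  have h𝔠0 : 𝔠 ≠ 0 := by rintro rfl; exact hJ0 (by rw [h𝔠, mul_zero])
  have hcount : ∀ v ∈ primesAbove k p,
      FractionalIdeal.count k v (𝔟 : FractionalIdeal (𝓞 k)⁰ k) = 0 ∧
      FractionalIdeal.count k v (𝔠 : FractionalIdeal (𝓞 k)⁰ k) = 0 := by
    intro v hv
    have e1 := FractionalIdeal.count_mul k v hspan0 hI0
    rw [hJI, hI v hv, add_zero, hspan] at e1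
    have e2 := FractionalIdeal.count_mul k v hMf (coeIdeal_ne_zero_of_ne_zero h𝔟0)
    have e3 := FractionalIdeal.count_mul k v hMf (coeIdeal_ne_zero_of_ne_zero h𝔠0)
    rw [← FractionalIdeal.coeIdeal_mul, ← h𝔟] at e2
    rw [← FractionalIdeal.coeIdeal_mul, ← h𝔠] at e3
    obtain ⟨n, hn⟩ := Int.eq_ofNat_of_zero_le (FractionalIdeal.count_coe_nonneg k v J)
    have d1 := (le_count_coeIdeal_iff v hJ0 n).1 hn.ge
    have d2 := (le_count_coeIdeal_iff v ha0 n).1 (by rw [← e1]; exact hn.ge)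
    have d3 : v.asIdeal ^ n ∣ M :=
      Ideal.dvd_iff_le.2 (sup_le (Ideal.dvd_iff_le.1 d1) (Ideal.dvd_iff_le.1 d2))
    have d4 := (le_count_coeIdeal_iff v hM0 n).2 d3
    have n1 := FractionalIdeal.count_coe_nonneg k v 𝔟
    have n2 := FractionalIdeal.count_coe_nonneg k v 𝔠
    omega
  refine ⟨𝔟, 𝔠, h𝔟0, h𝔠0, ?_,
    (forall_count_eq_zero_iff_sup_span_eq_top p h𝔟0).1 fun v hv => (hcount v hv).1,
    (forall_count_eq_zero_iff_sup_span_eq_top p h𝔠0).1 fun v hv => (hcount v hv).2⟩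
  have : (M : FractionalIdeal (𝓞 k)⁰ k) * (I * 𝔟) = M * 𝔠 := by
    rw [mul_left_comm, ← FractionalIdeal.coeIdeal_mul, ← h𝔟, ← FractionalIdeal.coeIdeal_mul, ← h𝔠,
      ← hspan, mul_comm, hJI]
  exact mul_left_cancel₀ hMf this

theorem idealIndex_algebraMap {J : Ideal (𝓞 k)} {b : 𝓞 k} (hb : b ∈ J) :
    idealIndex (J : FractionalIdeal (𝓞 k)⁰ k) (algebraMap (𝓞 k) k b) * Ideal.absNorm J =
      Ideal.absNorm (Ideal.span {b}) := by
  have h1 : (Submodule.span (𝓞 k) {algebraMap (𝓞 k) k b}).toAddSubgroup =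
      (Submodule.toAddSubgroup (Ideal.span {b})).map (algebraMap (𝓞 k) k).toAddMonoidHom := by
    ext y
    simp only [Submodule.mem_toAddSubgroup, Submodule.mem_span_singleton, AddSubgroup.mem_map,
      Submodule.mem_toAddSubgroup]
    constructor
    · rintro ⟨r, rfl⟩
      exact ⟨r * b, ⟨r, rfl⟩, by simp [Algebra.smul_def]⟩
    · rintro ⟨_, ⟨r, rfl⟩, rfl⟩
      exact ⟨r, by simp [Algebra.smul_def]⟩
  have h2 : ((J : FractionalIdeal (𝓞 k)⁰ k) : Submodule (𝓞 k) k).toAddSubgroup =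
      (Submodule.toAddSubgroup J).map (algebraMap (𝓞 k) k).toAddMonoidHom := by
    ext y
    simp only [Submodule.mem_toAddSubgroup, AddSubgroup.mem_map]
    exact FractionalIdeal.mem_coeIdeal _
  have hle : Submodule.toAddSubgroup (Ideal.span {b}) ≤ Submodule.toAddSubgroup J :=
    (Ideal.span_singleton_le_iff_mem J).2 hb
  have h3 := AddSubgroup.relIndex_mul_index hle
  rw [idealIndex, h1, h2, AddSubgroup.relIndex_map_map_of_injective _ _
    (RingOfIntegers.coe_injective), Ideal.absNorm_apply, Ideal.absNorm_apply,
    Submodule.cardQuot_apply, Submodule.cardQuot_apply]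
  exact h3

/-- For an integral ideal this is multiplicativity of the index in (b) ⊆ J ⊆ 𝓞; the general case
follows by clearing a denominator. -/
theorem idealIndex_mul_absNorm {I : FractionalIdeal (𝓞 k)⁰ k} {a : k}
    (ha : a ∈ (I : Submodule (𝓞 k) k)) :
    (idealIndex I a : ℚ) * FractionalIdeal.absNorm I = |Algebra.norm ℚ a| := by
  obtain ⟨d, J, hd, hIJ⟩ := FractionalIdeal.exists_eq_spanSingleton_mul I
  have hd' : algebraMap (𝓞 k) k d ≠ 0 := by simpa using hd
  have hJI : (J : FractionalIdeal (𝓞 k)⁰ k) =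
      FractionalIdeal.spanSingleton (𝓞 k)⁰ (algebraMap (𝓞 k) k d) * I := by
    rw [hIJ, ← mul_assoc, FractionalIdeal.spanSingleton_mul_spanSingleton, mul_inv_cancel₀ hd',
      FractionalIdeal.spanSingleton_one, one_mul]
  have h1 : ∀ x : k, algebraMap (𝓞 k) k d * x ∈
      ((J : FractionalIdeal (𝓞 k)⁰ k) : Submodule (𝓞 k) k) ↔ x ∈ (I : Submodule (𝓞 k) k) := by
    intro x
    rw [FractionalIdeal.mem_coe, FractionalIdeal.mem_coe, hJI, FractionalIdeal.mem_singleton_mul]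
    constructor
    · rintro ⟨y, hy, h⟩
      rwa [mul_left_cancel₀ hd' h]
    · intro hx
      exact ⟨x, hx, rfl⟩
  obtain ⟨b, hb, hbd⟩ := (FractionalIdeal.mem_coeIdeal (𝓞 k)⁰).1 ((h1 a).2 ha)
  have h2 := idealIndex_algebraMap hb
  rw [hbd, idealIndex_mul hd' h1] at h2
  have h3 : (idealIndex I a : ℚ) * (Ideal.absNorm J : ℚ) = (Ideal.absNorm (Ideal.span {b}) : ℚ) := by
    exact_mod_cast h2
  rw [← FractionalIdeal.coeIdeal_absNorm (K := k), ← FractionalIdeal.coeIdeal_absNorm (K := k), hJI,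
    map_mul, FractionalIdeal.coeIdeal_span_singleton, FractionalIdeal.absNorm_span_singleton,
    FractionalIdeal.absNorm_span_singleton, hbd, map_mul, abs_mul] at h3
  have h4 : |Algebra.norm ℚ (algebraMap (𝓞 k) k d)| ≠ 0 :=
    abs_ne_zero.2 (Algebra.norm_ne_zero_iff.2 hd')
  exact mul_left_cancel₀ h4 (by linear_combination h3)

/-- The integral ideal aI⁻¹ has norm |I:(a)|. This identifies the condition on the terms of the
class zeta function with the one on the terms of the cone series. -/
theorem forall_count_eq_zero_iff_not_dvd_idealIndex {I : FractionalIdeal (𝓞 k)⁰ k} (hI0 : I ≠ 0)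
    {a : k} (ha0 : a ≠ 0) (ha : a ∈ (I : Submodule (𝓞 k) k)) :
    (∀ v ∈ primesAbove k p,
      FractionalIdeal.count k v (FractionalIdeal.spanSingleton (𝓞 k)⁰ a * I⁻¹) = 0) ↔
      ¬ p ∣ idealIndex I a := by
  have hle : FractionalIdeal.spanSingleton (𝓞 k)⁰ a * I⁻¹ ≤ 1 := by
    rw [← mul_inv_cancel₀ hI0]
    gcongr
    exact FractionalIdeal.spanSingleton_le_iff_mem.2 ha
  obtain ⟨J, hJ⟩ := FractionalIdeal.le_one_iff_exists_coeIdeal.1 hle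
  have hs : FractionalIdeal.spanSingleton (𝓞 k)⁰ a ≠ 0 :=
    FractionalIdeal.spanSingleton_ne_zero_iff.2 ha0
  have hJ0 : J ≠ 0 := by
    rintro rfl
    rw [show ((0 : Ideal (𝓞 k)) : FractionalIdeal (𝓞 k)⁰ k) = 0 by simp] at hJ
    exact mul_ne_zero hs (inv_ne_zero hI0) hJ.symm
  have hN0 : FractionalIdeal.absNorm I ≠ 0 := by
    rw [Ne, FractionalIdeal.absNorm_eq_zero_iff]; exact hI0
  have hidx : idealIndex I a = Ideal.absNorm J := by
    have h1 := idealIndex_mul_absNorm ha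
    have h2 : (Ideal.absNorm J : ℚ) * FractionalIdeal.absNorm I = |Algebra.norm ℚ a| := by
      rw [← FractionalIdeal.coeIdeal_absNorm (K := k), hJ, ← map_mul, mul_assoc,
        inv_mul_cancel₀ hI0, mul_one, FractionalIdeal.absNorm_span_singleton]
    have h3 := mul_right_cancel₀ hN0 (h1.trans h2.symm)
    exact_mod_cast h3
  rw [hidx, not_dvd_absNorm_iff_sup_span_eq_top p hJ0, ← hJ,
    forall_count_eq_zero_iff_sup_span_eq_top p hJ0]

/-- The norm of a fractional ideal prime to `p` is a `p`-adic unit. -/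
theorem exists_unit_eq_absNorm {I : FractionalIdeal (𝓞 k)⁰ k} (hI0 : I ≠ 0)
    (hI : ∀ v ∈ primesAbove k p, FractionalIdeal.count k v I = 0) :
    ∃ N : ℤ_[p]ˣ, ((N : ℤ_[p]) : ℚ_[p]) = ((FractionalIdeal.absNorm I : ℚ) : ℚ_[p]) := by
  obtain ⟨𝔟, 𝔠, h𝔟0, h𝔠0, h, h𝔟, h𝔠⟩ := exists_mul_coeIdeal_eq p hI0 hI
  have hu : ∀ J : Ideal (𝓞 k), J ≠ 0 → J ⊔ Ideal.span {(p : 𝓞 k)} = ⊤ →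
      IsUnit ((Ideal.absNorm J : ℕ) : ℤ_[p]) := by
    intro J hJ0 hJ
    rw [PadicInt.isUnit_iff]
    have h1 := (not_dvd_absNorm_iff_sup_span_eq_top p hJ0).2 hJ
    refine le_antisymm (PadicInt.norm_le_one _) (not_lt.1 fun hlt => h1 ?_)
    have h2 : ‖((Ideal.absNorm J : ℤ) : ℤ_[p])‖ < 1 := by simpa using hlt
    rw [PadicInt.norm_intCast_lt_one_iff] at h2
    exact_mod_cast h2
  obtain ⟨u, hu1⟩ := hu 𝔟 h𝔟0 h𝔟
  obtain ⟨w, hw1⟩ := hu 𝔠 h𝔠0 h𝔠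
  refine ⟨w * u⁻¹, ?_⟩
  have h2 := congrArg FractionalIdeal.absNorm h
  rw [map_mul, FractionalIdeal.coeIdeal_absNorm, FractionalIdeal.coeIdeal_absNorm] at h2
  have h3 : ((FractionalIdeal.absNorm I : ℚ) : ℚ_[p]) * ((u : ℤ_[p]) : ℚ_[p]) =
      ((w : ℤ_[p]) : ℚ_[p]) := by
    rw [hu1, hw1]
    simpa using congrArg (fun q : ℚ => (q : ℚ_[p])) h2
  have h4 : (((u⁻¹ : ℤ_[p]ˣ) : ℤ_[p]) : ℚ_[p]) * ((u : ℤ_[p]) : ℚ_[p]) = 1 := by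
    rw [← PadicInt.coe_mul, Units.inv_mul, PadicInt.coe_one]
  rw [Units.val_mul, PadicInt.coe_mul]
  linear_combination (-(((u⁻¹ : ℤ_[p]ˣ) : ℤ_[p]) : ℚ_[p])) * h3 +
    ((FractionalIdeal.absNorm I : ℚ) : ℚ_[p]) * h4

/-- Elements of a parallelogram in a fractional ideal are finite in number. -/
theorem finite_parallelogram (I : FractionalIdeal (𝓞 k)⁰ k) (τ₁ τ₂ : k) :
    {a : (I : Submodule (𝓞 k) k) | (a : k) ∈ parallelogram τ₁ τ₂}.Finite := by
  obtain ⟨d, hd, hI⟩ := I.isFractional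
  have hd' : algebraMap (𝓞 k) k d ≠ 0 := by simpa using nonZeroDivisors.ne_zero hd
  -- After multiplication by a denominator of I the elements are algebraic integers with all
  -- conjugates bounded by `B`.
  set B : ℝ := ∑ φ : k →+* ℂ, ‖φ (algebraMap (𝓞 k) k d)‖ * (‖φ τ₁‖ + ‖φ τ₂‖) with hB
  refine Set.Finite.of_finite_image (f := fun a => algebraMap (𝓞 k) k d * (a : k)) ?_ ?_
  · refine (NumberField.Embeddings.finite_of_norm_le k ℂ B).subset ?_
    rintro _ ⟨a, ⟨l, m, hl0, hl1, hm0, hm1, ha⟩, rfl⟩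
    refine ⟨?_, fun φ => ?_⟩
    · obtain ⟨b, hb⟩ := hI a a.2
      rw [Algebra.smul_def] at hb
      change IsIntegral ℤ (algebraMap (𝓞 k) k d * (a : k))
      rw [← hb]
      exact b.isIntegral_coe
    · have h1 : ‖φ (a : k)‖ ≤ ‖φ τ₁‖ + ‖φ τ₂‖ := by
        rw [ha, Rat.smul_def, Rat.smul_def, map_add, map_mul, map_mul, map_ratCast, map_ratCast]
        refine (norm_add_le _ _).trans ?_
        rw [norm_mul, norm_mul]
        have e1 : ‖(l : ℂ)‖ ≤ 1 := by
          rw [Complex.norm_ratCast, abs_of_pos (by exact_mod_cast hl0)]; exact_mod_cast hl1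
        have e2 : ‖(m : ℂ)‖ ≤ 1 := by
          rw [Complex.norm_ratCast, abs_of_nonneg (by exact_mod_cast hm0)]; exact_mod_cast hm1.le
        exact add_le_add (mul_le_of_le_one_left (norm_nonneg _) e1)
          (mul_le_of_le_one_left (norm_nonneg _) e2)
      change ‖φ (algebraMap (𝓞 k) k d * (a : k))‖ ≤ B
      rw [map_mul, norm_mul]
      refine (mul_le_mul_of_nonneg_left h1 (norm_nonneg _)).trans ?_
      exact Finset.single_le_sum (f := fun φ : k →+* ℂ =>
        ‖φ (algebraMap (𝓞 k) k d)‖ * (‖φ τ₁‖ + ‖φ τ₂‖)) (fun _ _ => by positivity)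
        (Finset.mem_univ φ)
  · intro a _ b _ hab
    exact Subtype.ext (mul_left_cancel₀ hd' hab)

end IdealArithmetic

/-! ### Embeddings and rational bases of a quadratic field -/

section Embeddings

variable {k : Type*} [Field k] [NumberField k]

theorem card_complexEmbeddings (hk : Module.finrank ℚ k = 2) : Fintype.card (k →+* ℂ) = 2 := by
  rw [NumberField.Embeddings.card, hk]

theorem univ_eq_pair_of_ne (hk : Module.finrank ℚ k = 2) {ψ₀ ψ₁ : k →+* ℂ} (h : ψ₀ ≠ ψ₁) :
    letI := Classical.decEq (k →+* ℂ)
    (Finset.univ : Finset (k →+* ℂ)) = {ψ₀, ψ₁} := by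
  classical
  symm
  rw [← Finset.card_eq_iff_eq_univ, Finset.card_pair h, card_complexEmbeddings hk]

theorem prod_complexEmbeddings (a : k) : ∏ φ : k →+* ℂ, φ a = (Algebra.norm ℚ a : ℂ) := by
  have h := Algebra.norm_eq_prod_embeddings ℚ ℂ a
  rw [eq_ratCast] at h
  rw [h]
  exact Fintype.prod_equiv (RingHom.equivRatAlgHom k ℂ) _ _ fun φ => rfl

/-- Two distinct embeddings in a subfield of ℂ stay distinct in ℂ, hence are all the conjugates. It
is used with L = ℝ and with L the algebraic numbers. -/
theorem norm_eq_mul_of_ne (hk : Module.finrank ℚ k = 2) {L : Type*} [Field L] (e : L →+* ℂ)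
    {σ₀ σ₁ : k →+* L} (h : σ₀ ≠ σ₁) (a : k) : ((Algebra.norm ℚ a : ℚ) : L) = σ₀ a * σ₁ a := by
  classical
  have h1 : e.comp σ₀ ≠ e.comp σ₁ := fun h' =>
    h (RingHom.ext fun x => e.injective (RingHom.congr_fun h' x))
  have h2 := prod_complexEmbeddings a
  have h3 := univ_eq_pair_of_ne hk h1
  rw [show (Finset.univ : Finset (k →+* ℂ)) = {e.comp σ₀, e.comp σ₁} by convert h3,
    Finset.prod_pair h1] at h2
  apply e.injective
  rw [map_ratCast, ← h2, map_mul]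
  rfl

theorem exists_realEmbeddings_ne [NumberField.IsTotallyReal k] (hk : Module.finrank ℚ k = 2) :
    ∃ φ₀ φ₁ : k →+* ℝ, φ₀ ≠ φ₁ := by
  have h1 : 1 < Fintype.card (k →+* ℂ) := by rw [card_complexEmbeddings hk]; norm_num
  obtain ⟨ψ₀, ψ₁, h⟩ := Fintype.one_lt_card_iff.1 h1
  have hreal : ∀ ψ : k →+* ℂ, ComplexEmbedding.IsReal ψ := fun ψ => by
    have := IsTotallyReal.isReal (InfinitePlace.mk ψ)
    rwa [InfinitePlace.isReal_mk_iff] at this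
  refine ⟨(hreal ψ₀).embedding, (hreal ψ₁).embedding, fun h' => h (RingHom.ext fun x => ?_)⟩
  rw [← ComplexEmbedding.IsReal.coe_embedding_apply (hreal ψ₀),
    ← ComplexEmbedding.IsReal.coe_embedding_apply (hreal ψ₁), h']

theorem norm_pos_of_totallyPositive [NumberField.IsTotallyReal k] (hk : Module.finrank ℚ k = 2) {a : k}
    (ha : TotallyPositive a) : 0 < Algebra.norm ℚ a := by
  obtain ⟨φ₀, φ₁, h⟩ := exists_realEmbeddings_ne hk
  have h1 := norm_eq_mul_of_ne hk Complex.ofRealHom h a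
  have h2 := mul_pos (ha.2 φ₀) (ha.2 φ₁)
  rw [← h1] at h2
  exact_mod_cast h2

theorem exists_algebraicEmbeddings (hk : Module.finrank ℚ k = 2) :
    ∃ ι : Fin 2 → (k →+* QBar), Function.Injective ι := by
  have h1 : 1 < Fintype.card (k →+* ℂ) := by rw [card_complexEmbeddings hk]; norm_num
  obtain ⟨ψ₀, ψ₁, h⟩ := Fintype.one_lt_card_iff.1 h1
  have hmem : ∀ (ψ : k →+* ℂ) (x : k), ψ x ∈ (algebraicClosure ℚ ℂ).toSubring := fun ψ x => by
    change ψ x ∈ algebraicClosure ℚ ℂ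
    rw [mem_algebraicClosure_iff]
    exact IsAlgebraic.algHom ψ.toRatAlgHom (Algebra.IsAlgebraic.isAlgebraic (R := ℚ) x)
  let lift : (k →+* ℂ) → (k →+* QBar) := fun ψ => ψ.codRestrict (algebraicClosure ℚ ℂ).toSubring (hmem ψ)
  have hlift : ∀ ψ x, ((lift ψ x : QBar) : ℂ) = ψ x := fun ψ x => rfl
  refine ⟨![lift ψ₀, lift ψ₁], ?_⟩
  have hne : lift ψ₀ ≠ lift ψ₁ := fun h' => h (RingHom.ext fun x => by
    rw [← hlift, ← hlift, h'])
  intro a b hab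
  fin_cases a <;> fin_cases b
  · rfl
  · exact absurd hab hne
  · exact absurd hab.symm hne
  · rfl

theorem linearIndependent_pair (hk : Module.finrank ℚ k = 2) {x y : k} (hx : x ≠ 0)
    (hxy : ∀ q : ℚ, q • x ≠ y) :
    (∀ a : k, ∃ l m : ℚ, a = l • x + m • y) ∧
      ∀ l m l' m' : ℚ, l • x + m • y = l' • x + m' • y → l = l' ∧ m = m' := by
  have hli : LinearIndependent ℚ ![x, y] := (LinearIndependent.pair_iff' hx).2 hxy
  constructor
  · intro a
    have h1 := hli.span_eq_top_of_card_eq_finrank (by simp [hk])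
    have h2 : a ∈ Submodule.span ℚ (Set.range ![x, y]) := by rw [h1]; trivial
    rw [Matrix.range_cons, Matrix.range_cons, Matrix.range_empty, Set.union_empty,
      Set.singleton_union, Submodule.mem_span_pair] at h2
    obtain ⟨l, m, h⟩ := h2
    exact ⟨l, m, h.symm⟩
  · intro l m l' m' h
    have h1 := (LinearIndependent.pair_iff.1 hli) (l - l') (m - m') (by
      rw [sub_smul, sub_smul]
      linear_combination h)
    exact ⟨sub_eq_zero.1 h1.1, sub_eq_zero.1 h1.2⟩

end Embeddings

/-! ### Split primes: the embeddings of k in ℂ_p have values in ℚ_p -/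

section Splitting

set_option linter.unusedSectionVars false

variable {k : Type*} [Field k] [NumberField k] {p : ℕ} [hp : Fact p.Prime]

theorem dvd_of_intCast_mem {𝔭 : Ideal (𝓞 k)} (h𝔭 : 𝔭.IsPrime) (hp𝔭 : (p : 𝓞 k) ∈ 𝔭) {n : ℤ}
    (hn : (n : 𝓞 k) ∈ 𝔭) : (p : ℤ) ∣ n := by
  by_contra h
  obtain ⟨u, v, huv⟩ := (Prime.coprime_iff_not_dvd (Nat.prime_iff_prime_int.1 hp.out)).2 h
  refine h𝔭.ne_top ((Ideal.eq_top_iff_one _).2 ?_)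
  have : (1 : 𝓞 k) = u * (p : 𝓞 k) + v * (n : 𝓞 k) := by
    have := congrArg (fun m : ℤ => (m : 𝓞 k)) huv
    push_cast at this
    exact this.symm
  rw [this]
  exact 𝔭.add_mem (𝔭.mul_mem_left _ hp𝔭) (𝔭.mul_mem_left _ hn)

theorem intCast_mem_of_dvd {𝔭 : Ideal (𝓞 k)} (hp𝔭 : (p : 𝓞 k) ∈ 𝔭) {n : ℤ} (h : (p : ℤ) ∣ n) :
    (n : 𝓞 k) ∈ 𝔭 := by
  obtain ⟨m, rfl⟩ := h
  push_cast
  exact 𝔭.mul_mem_right _ hp𝔭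

/-- Cayley–Hamilton for multiplication by α on the free ℤ-module 𝓞 of rank two. -/
theorem exists_quadratic (hk : Module.finrank ℚ k = 2) (α : 𝓞 k) :
    ∃ b c : ℤ, α ^ 2 + b * α + c = 0 := by
  set Q := (Algebra.lmul ℤ (𝓞 k) α).charpoly with hQ
  have hdeg : Q.natDegree = 2 := by
    rw [hQ, LinearMap.charpoly_natDegree, RingOfIntegers.rank, hk]
  have hmon : Q.Monic := LinearMap.charpoly_monic _
  have h0 : Polynomial.aeval α Q = 0 := by
    have h1 := LinearMap.aeval_self_charpoly (Algebra.lmul ℤ (𝓞 k) α)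
    rw [← hQ, Polynomial.aeval_algHom_apply] at h1
    have h2 := LinearMap.congr_fun h1 (1 : 𝓞 k)
    simpa using h2
  refine ⟨Q.coeff 1, Q.coeff 0, ?_⟩
  rw [Polynomial.aeval_eq_sum_range, hdeg, Finset.sum_range_succ, Finset.sum_range_succ,
    Finset.sum_range_one, show Q.coeff 2 = 1 by rw [← hdeg]; exact hmon] at h0
  simp only [zsmul_eq_mul, pow_zero, pow_one, Int.cast_one] at h0
  linear_combination h0

/-- Once one root of the monic quadratic lies in F, the other does too, being -b - z; so every root
in L comes from F. -/
theorem mem_range_of_quadratic {F L : Type*} [Field F] [Field L] (e : F →+* L) {x : L} {z b c : F}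
    (hx : x ^ 2 + e b * x + e c = 0) (hz : z ^ 2 + b * z + c = 0) : ∃ y, x = e y := by
  have hz' : e z ^ 2 + e b * e z + e c = 0 := by
    rw [← map_pow, ← map_mul, ← map_add, ← map_add, hz, map_zero]
  have hfac : (x - e z) * (x + e b + e z) = 0 := by linear_combination hx - hz'
  rcases mul_eq_zero.1 hfac with h | h
  · exact ⟨z, sub_eq_zero.1 h⟩
  · refine ⟨-b - z, ?_⟩
    rw [map_sub, map_neg]
    linear_combination h

/-- A rational prime `p` that splits in `k` has a quadratic generator of `k` whose polynomial has
two distinct roots modulo `p`. -/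
theorem exists_generator_of_split (hk : Module.finrank ℚ k = 2)
    (hsplit : ∃ 𝔭₁ 𝔭₂ : Ideal (𝓞 k), 𝔭₁.IsPrime ∧ 𝔭₂.IsPrime ∧ 𝔭₁ ≠ 𝔭₂ ∧
      Ideal.span {(p : 𝓞 k)} = 𝔭₁ * 𝔭₂) :
    ∃ (α : 𝓞 k) (b c : ℤ), α ^ 2 + b * α + c = 0 ∧ ¬ (p : ℤ) ∣ b ∧ (p : ℤ) ∣ c ∧
      ∀ q : ℚ, q • (1 : k) ≠ algebraMap (𝓞 k) k α := by
  obtain ⟨𝔭₁, 𝔭₂, h1, h2, hne, hspan⟩ := hsplit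
  have hp0 : (p : 𝓞 k) ≠ 0 := Nat.cast_ne_zero.2 hp.out.ne_zero
  have hp12 : (p : 𝓞 k) ∈ 𝔭₁ * 𝔭₂ := by
    rw [← hspan]
    exact Ideal.mem_span_singleton_self _
  have hle1 : 𝔭₁ * 𝔭₂ ≤ 𝔭₁ := Ideal.mul_le_left
  have hle2 : 𝔭₁ * 𝔭₂ ≤ 𝔭₂ := Ideal.mul_le_right
  have hp1 : (p : 𝓞 k) ∈ 𝔭₁ := hle1 hp12
  have hp2 : (p : 𝓞 k) ∈ 𝔭₂ := hle2 hp12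
  have h1bot : 𝔭₁ ≠ ⊥ := fun h => hp0 (by simpa [h] using hp1)
  have hnle : ¬ 𝔭₁ ≤ 𝔭₂ := fun hle =>
    hne ((h1.isMaximal h1bot).eq_of_le h2.ne_top hle)
  -- An element of 𝔭₁ outside 𝔭₂. Membership in 𝔭₁ gives p ∣ c; then p ∣ b would put α² in 𝔭₂.
  -- Modulo p the polynomial has the distinct roots 0 and -b.
  obtain ⟨α, hα1, hα2⟩ := SetLike.not_le_iff_exists.1 hnle
  obtain ⟨b, c, hbc⟩ := exists_quadratic hk α
  have hc : (p : ℤ) ∣ c := by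
    refine dvd_of_intCast_mem h1 hp1 ?_
    rw [show (c : 𝓞 k) = α * (-α - b) by linear_combination hbc]
    exact 𝔭₁.mul_mem_right _ hα1
  have hb : ¬ (p : ℤ) ∣ b := by
    intro hb
    have e1 : α * α ∈ 𝔭₂ := by
      rw [show α * α = -((b : 𝓞 k) * α) - c by linear_combination hbc]
      exact 𝔭₂.sub_mem (𝔭₂.neg_mem (𝔭₂.mul_mem_right _ (intCast_mem_of_dvd hp2 hb)))
        (intCast_mem_of_dvd hp2 hc)
    exact hα2 ((h2.mem_or_mem e1).elim id id)
  refine ⟨α, b, c, hbc, hb, hc, ?_⟩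
  -- A rational α would be an integer; lying in 𝔭₁ it would be divisible by p, hence lie in 𝔭₂.
  intro q hq
  have hint : IsIntegral ℤ q := by
    have := RingOfIntegers.isIntegral_coe α
    rw [← hq, Rat.smul_def, mul_one] at this
    have h' : IsIntegral ℤ (algebraMap ℚ k q) := by simpa using this
    exact (isIntegral_algebraMap_iff (algebraMap ℚ k).injective).1 h'
  obtain ⟨n, rfl⟩ := IsIntegrallyClosed.isIntegral_iff.1 hint
  have hαn : α = (n : 𝓞 k) := by
    apply RingOfIntegers.coe_injective
    rw [← hq]
    simp [Rat.smul_def]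
  rw [hαn] at hα1 hα2
  exact hα2 (intCast_mem_of_dvd hp2 (dvd_of_intCast_mem h1 hp1 hα1))

/-- If `p` splits in the quadratic field `k`, every embedding of `k` in `ℂ_p` has values in
`ℚ_p`. -/
theorem mem_range_algebraMap_of_split (hk : Module.finrank ℚ k = 2)
    (hsplit : ∃ 𝔭₁ 𝔭₂ : Ideal (𝓞 k), 𝔭₁.IsPrime ∧ 𝔭₂.IsPrime ∧ 𝔭₁ ≠ 𝔭₂ ∧
      Ideal.span {(p : 𝓞 k)} = 𝔭₁ * 𝔭₂) (σ : k →+* ℂ_[p]) (x : k) :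
    ∃ y : ℚ_[p], σ x = algebraMap ℚ_[p] ℂ_[p] y := by
  obtain ⟨α, b, c, hbc, hb, hc, hirr⟩ := exists_generator_of_split hk hsplit
  -- Hensel's lemma at 0, where the polynomial takes the value c, divisible by p, and its derivative
  -- the value b, a unit.
  obtain ⟨z, hz, -⟩ := hensels_lemma (p := p)
    (F := (Polynomial.X ^ 2 + Polynomial.C (b : ℤ_[p]) * Polynomial.X + Polynomial.C (c : ℤ_[p])))
    (a := 0) (by
      have e1 : ‖(b : ℤ_[p])‖ = 1 := by
        refine le_antisymm (PadicInt.norm_le_one _) (not_lt.1 fun h => hb ?_)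
        rwa [PadicInt.norm_intCast_lt_one_iff] at h
      have e2 : ‖(c : ℤ_[p])‖ < 1 := PadicInt.norm_intCast_lt_one_iff.2 hc
      simpa [e1] using e2)
  have hz' : z ^ 2 + b * z + c = 0 := by simpa using hz
  have hzQ : (z : ℚ_[p]) ^ 2 + (b : ℚ_[p]) * z + (c : ℚ_[p]) = 0 := by
    have := congrArg (fun y : ℤ_[p] => (y : ℚ_[p])) hz'
    simpa only [PadicInt.coe_add, PadicInt.coe_pow, PadicInt.coe_mul, PadicInt.coe_intCast,
      PadicInt.coe_zero] using this
  have hα : ∃ y : ℚ_[p], σ (algebraMap (𝓞 k) k α) = algebraMap ℚ_[p] ℂ_[p] y := by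
    refine mem_range_of_quadratic (algebraMap ℚ_[p] ℂ_[p]) ?_ hzQ
    have := congrArg (fun y : 𝓞 k => σ (algebraMap (𝓞 k) k y)) hbc
    simpa only [map_add, map_pow, map_mul, map_intCast, map_zero] using this
  obtain ⟨l, m, rfl⟩ := (linearIndependent_pair hk one_ne_zero hirr).1 x
  obtain ⟨y, hy⟩ := hα
  refine ⟨l + m * y, ?_⟩
  rw [Rat.smul_def, Rat.smul_def, mul_one, map_add, map_mul, map_ratCast, map_ratCast, hy, map_add,
    map_mul, map_ratCast, map_ratCast]

theorem toCp_apply (y : ℤ_[p]) : toCp y = algebraMap ℚ_[p] ℂ_[p] (y : ℚ_[p]) := rfl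

/-- If `p` splits, every embedding of `k` in `ℂ_p` maps a fractional ideal prime to `p` in
`ℤ_p`. -/
theorem exists_toCp_eq (hk : Module.finrank ℚ k = 2)
    (hsplit : ∃ 𝔭₁ 𝔭₂ : Ideal (𝓞 k), 𝔭₁.IsPrime ∧ 𝔭₂.IsPrime ∧ 𝔭₁ ≠ 𝔭₂ ∧
      Ideal.span {(p : 𝓞 k)} = 𝔭₁ * 𝔭₂) {I : FractionalIdeal (𝓞 k)⁰ k} (hI0 : I ≠ 0)
    (hI : ∀ v ∈ primesAbove k p, FractionalIdeal.count k v I = 0) (σ : k →+* ℂ_[p]) {a : k}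
    (ha : a ∈ (I : Submodule (𝓞 k) k)) : ∃ y : ℤ_[p], σ a = toCp y := by
  -- Algebraic integers go to elements of ℚ_p integral over ℤ_p, and ℤ_p is integrally closed.
  have hint : ∀ b : 𝓞 k, ∃ y : ℤ_[p], σ (algebraMap (𝓞 k) k b) = toCp y := by
    intro b
    obtain ⟨y, hy⟩ := mem_range_algebraMap_of_split hk hsplit σ (algebraMap (𝓞 k) k b)
    have h1 : IsIntegral ℤ y := by
      obtain ⟨Q, hQ, hQb⟩ := RingOfIntegers.isIntegral_coe b
      refine ⟨Q, hQ, (algebraMap ℚ_[p] ℂ_[p]).injective ?_⟩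
      have h2 := congrArg σ hQb
      rw [Polynomial.hom_eval₂] at h2 ⊢
      rw [map_zero] at h2 ⊢
      rw [← hy, ← h2]
      congr 1
      exact RingHom.ext_int _ _
    have h3 : IsIntegral ℤ_[p] y := h1.tower_top
    obtain ⟨w, rfl⟩ := IsIntegrallyClosed.isIntegral_iff.1 h3
    exact ⟨w, hy⟩
  obtain ⟨𝔟, 𝔠, -, -, h, h𝔟, -⟩ := exists_mul_coeIdeal_eq p hI0 hI
  have h2 : (1 : 𝓞 k) ∈ 𝔟 ⊔ Ideal.span {(p : 𝓞 k)} := by rw [h𝔟]; trivial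
  -- A denominator b of `a` with b ≡ 1 modulo p: its image is a unit of ℤ_p, so it can be divided
  -- out.
  obtain ⟨b, hb, b', hb', hbb⟩ := Submodule.mem_sup.1 h2
  obtain ⟨d, rfl⟩ := Ideal.mem_span_singleton'.1 hb'
  have h3 : a * algebraMap (𝓞 k) k b ∈ I * (𝔟 : FractionalIdeal (𝓞 k)⁰ k) :=
    FractionalIdeal.mul_mem_mul ha ((FractionalIdeal.mem_coeIdeal _).2 ⟨b, hb, rfl⟩)
  rw [h] at h3
  obtain ⟨e, -, he⟩ := (FractionalIdeal.mem_coeIdeal _).1 h3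
  obtain ⟨y, hy⟩ := hint e
  obtain ⟨u, hu⟩ := hint b
  obtain ⟨w, hw⟩ := hint d
  have huw : u = 1 - (p : ℤ_[p]) * w := by
    have h4 : toCp u = toCp (1 - (p : ℤ_[p]) * w) := by
      rw [map_sub, map_mul, map_natCast, map_one, ← hu, ← hw]
      have := congrArg (fun y : 𝓞 k => σ (algebraMap (𝓞 k) k y)) hbb
      simp only [map_add, map_mul, map_natCast, map_one] at this
      linear_combination this
    exact Subtype.ext ((algebraMap ℚ_[p] ℂ_[p]).injective h4)
  have huu : IsUnit u := by
    refine PadicInt.isUnit_iff.2 (le_antisymm (PadicInt.norm_le_one _) (not_lt.1 fun hlt => ?_))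
    have h5 : (p : ℤ_[p]) ∣ u := (PadicInt.norm_lt_one_iff_dvd u).1 hlt
    have h6 : (p : ℤ_[p]) ∣ 1 := by
      have := dvd_add h5 (Dvd.intro w rfl)
      rwa [huw, sub_add_cancel] at this
    exact PadicInt.prime_p.not_isUnit (isUnit_of_dvd_one h6)
  obtain ⟨v, rfl⟩ := huu
  refine ⟨((v⁻¹ : ℤ_[p]ˣ) : ℤ_[p]) * y, ?_⟩
  have h6 : toCp ((v⁻¹ : ℤ_[p]ˣ) : ℤ_[p]) * toCp (v : ℤ_[p]) = 1 := by
    rw [← map_mul, Units.inv_mul, map_one]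
  rw [map_mul, ← hy, he, map_mul, hu]
  linear_combination (-(σ a)) * h6

end Splitting

/-! ### The cone on ρ, ερ as a fundamental domain for the units -/

section FundamentalDomain

variable {k : Type*} [Field k] [NumberField k]

theorem exists_unit_not_isOfFinOrder [NumberField.IsTotallyReal k] (hk : Module.finrank ℚ k = 2) :
    ∃ u : (𝓞 k)ˣ, ¬ IsOfFinOrder u := by
  have hrank : Units.rank k = 1 := by
    have h1 := InfinitePlace.card_eq_nrRealPlaces_add_nrComplexPlaces k
    have h2 := InfinitePlace.card_add_two_mul_card_eq_rank k
    have h3 := IsTotallyReal.nrComplexPlaces_eq_zero k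
    rw [Units.rank]
    omega
  let i : Fin (Units.rank k) := ⟨0, by omega⟩
  refine ⟨Units.fundSystem k i, fun h => ?_⟩
  have h1 := Units.logEmbedding_fundSystem k i
  rw [(Units.dirichletUnitTheorem.logEmbedding_eq_zero_iff).2 ((CommGroup.mem_torsion _).2 h)] at h1
  exact (Units.basisUnitLattice k).ne_zero i (Subtype.ext h1.symm)

/-- Raising a unit of infinite order to the order of (𝓞/𝔣)ˣ makes it 1 modulo 𝔣, and squaring makes
it totally positive. -/
theorem exists_mem_unitsPlus_not_isOfFinOrder [NumberField.IsTotallyReal k]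
    (hk : Module.finrank ℚ k = 2) {𝔣 : Ideal (𝓞 k)} (h𝔣 : 𝔣 ≠ ⊥) :
    ∃ u ∈ unitsPlus 𝔣, ¬ IsOfFinOrder u := by
  obtain ⟨u, hu⟩ := exists_unit_not_isOfFinOrder hk
  have hfin : Finite (𝓞 k ⧸ 𝔣) := Ideal.finiteQuotientOfFreeOfNeBot 𝔣 h𝔣
  set M := Nat.card (𝓞 k ⧸ 𝔣)ˣ with hM
  have hM0 : M ≠ 0 := Nat.card_pos.ne'
  have hpow : ¬ IsOfFinOrder (u ^ (2 * M)) := fun h => hu (h.of_pow (by positivity))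
  refine ⟨u ^ (2 * M), ⟨?_, ?_⟩, hpow⟩
  · rw [← Ideal.Quotient.eq_zero_iff_mem, map_sub, map_one, Units.val_pow_eq_pow_val, map_pow,
      mul_comm 2 M, pow_mul]
    have h1 : (Units.map (Ideal.Quotient.mk 𝔣).toMonoidHom u) ^ M = 1 := pow_card_eq_one'
    have h2 := congrArg Units.val h1
    rw [Units.val_pow_eq_pow_val, Units.coe_map, Units.val_one] at h2
    change (Ideal.Quotient.mk 𝔣 (u : 𝓞 k)) ^ M = 1 at h2
    rw [h2, one_pow, sub_self]
  · have h0 : algebraMap (𝓞 k) k u ≠ 0 := by simp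
    refine ⟨by simp, fun φ => ?_⟩
    rw [Units.val_pow_eq_pow_val, map_pow, map_pow, mul_comm 2 M, pow_mul]
    exact (sq_nonneg _).lt_of_ne' (pow_ne_zero _ (pow_ne_zero _ ((map_ne_zero φ).2 h0)))

theorem mul_eq_one_of_mem_unitsPlus [NumberField.IsTotallyReal k] (hk : Module.finrank ℚ k = 2)
    {𝔣 : Ideal (𝓞 k)} {u : (𝓞 k)ˣ} (hu : u ∈ unitsPlus 𝔣) {φ₀ φ₁ : k →+* ℝ} (h : φ₀ ≠ φ₁) :
    φ₀ (algebraMap (𝓞 k) k u) * φ₁ (algebraMap (𝓞 k) k u) = 1 := by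
  rw [← norm_eq_mul_of_ne hk Complex.ofRealHom h]
  have h1 : 0 < Algebra.norm ℚ (algebraMap (𝓞 k) k u) := norm_pos_of_totallyPositive hk hu.2
  have h3 : |Algebra.norm ℚ (algebraMap (𝓞 k) k u)| = 1 := by
    simp
  rw [abs_of_pos h1] at h3
  rw [h3, Rat.cast_one]

/-- A generator `ε` of `E_{𝔣+}` has an embedding in which it is larger than `1`. -/
theorem exists_one_lt_embedding [NumberField.IsTotallyReal k] (hk : Module.finrank ℚ k = 2)
    {𝔣 : Ideal (𝓞 k)} (h𝔣 : 𝔣 ≠ ⊥) {ε : (𝓞 k)ˣ} (hε : Subgroup.zpowers ε = unitsPlus 𝔣) :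
    ∃ φ₀ φ₁ : k →+* ℝ, φ₀ ≠ φ₁ ∧ 1 < φ₀ (algebraMap (𝓞 k) k ε) ∧
      φ₀ (algebraMap (𝓞 k) k ε) * φ₁ (algebraMap (𝓞 k) k ε) = 1 := by
  have hmem : ε ∈ unitsPlus 𝔣 := hε ▸ Subgroup.mem_zpowers ε
  have hne : ε ≠ 1 := by
    rintro rfl
    obtain ⟨u, hu, hu'⟩ := exists_mem_unitsPlus_not_isOfFinOrder hk h𝔣
    rw [← hε, Subgroup.zpowers_one_eq_bot, Subgroup.mem_bot] at hu
    exact hu' (hu ▸ IsOfFinOrder.one)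
  obtain ⟨φ₀, φ₁, h⟩ := exists_realEmbeddings_ne hk
  have h1 := mul_eq_one_of_mem_unitsPlus hk hmem h
  have p0 := hmem.2.2 φ₀
  have p1 := hmem.2.2 φ₁
  rcases lt_trichotomy (φ₀ (algebraMap (𝓞 k) k ε)) 1 with hlt | heq | hgt
  · refine ⟨φ₁, φ₀, h.symm, ?_, by rw [mul_comm]; exact h1⟩
    nlinarith
  · exfalso
    apply hne
    apply Units.ext
    apply RingOfIntegers.coe_injective
    apply φ₀.injective
    rw [heq]
    simp
  · exact ⟨φ₀, φ₁, h, hgt, h1⟩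

variable {φ₀ φ₁ : k →+* ℝ} {e ρ : k}

theorem smul_ne_of_one_lt (h0 : 1 < φ₀ e) (h1 : φ₀ e * φ₁ e = 1) (hρ : ρ ≠ 0) (q : ℚ) :
    q • ρ ≠ e * ρ := by
  intro h
  have h2 : e = q := by
    rw [Rat.smul_def] at h
    exact (mul_right_cancel₀ hρ h).symm
  rw [h2, map_ratCast, map_ratCast] at h1
  rw [h2, map_ratCast] at h0
  nlinarith

theorem totallyPositive_of_mem_cone [NumberField.IsTotallyReal k] (hk : Module.finrank ℚ k = 2)
    {τ₁ τ₂ : k} (h₁ : TotallyPositive τ₁) (h₂ : TotallyPositive τ₂)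
    {a : k} (ha : a ∈ cone τ₁ τ₂) : TotallyPositive a := by
  obtain ⟨l, m, hl, hm, rfl⟩ := ha
  rw [Rat.smul_def, Rat.smul_def]
  have hl' : (0 : ℝ) < l := by exact_mod_cast hl
  have hm' : (0 : ℝ) ≤ m := by exact_mod_cast hm
  have hpos : ∀ φ : k →+* ℝ, 0 < φ (l * τ₁ + m * τ₂) := fun φ => by
    rw [map_add, map_mul, map_mul, map_ratCast, map_ratCast]
    have := h₁.2 φ
    have := h₂.2 φ
    positivity
  obtain ⟨φ, -, -⟩ := exists_realEmbeddings_ne hk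
  exact ⟨fun h => by have := hpos φ; rw [h, map_zero] at this; exact lt_irrefl _ this, hpos⟩

/-- For φ₁(x) > 0 the condition reads 1 ≤ r < φ₀(e)², with r = φ₀(x)φ₁(ρ) / (φ₁(x)φ₀(ρ)). The two
bounding rays have r = 1 and r = φ₀(e)/φ₁(e) = φ₀(e)². The first inequality is the sign of the
coefficient of eρ, the second that of ρ. -/
theorem mem_cone_iff (hk : Module.finrank ℚ k = 2) (h0 : 1 < φ₀ e) (h1 : φ₀ e * φ₁ e = 1)
    (hρ : TotallyPositive ρ) (x : k) :
    x ∈ cone ρ (e * ρ) ↔ φ₁ x * φ₀ ρ ≤ φ₀ x * φ₁ ρ ∧ φ₀ x * φ₁ ρ < φ₀ e ^ 2 * (φ₁ x * φ₀ ρ) := by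
  have hli := linearIndependent_pair hk hρ.1 (smul_ne_of_one_lt h0 h1 hρ.1)
  obtain ⟨l, m, rfl⟩ := hli.1 x
  have hiff : l • ρ + m • (e * ρ) ∈ cone ρ (e * ρ) ↔ 0 < l ∧ 0 ≤ m := by
    constructor
    · rintro ⟨l', m', hl, hm, h⟩
      obtain ⟨rfl, rfl⟩ := hli.2 _ _ _ _ h
      exact ⟨hl, hm⟩
    · rintro ⟨hl, hm⟩
      exact ⟨l, m, hl, hm, rfl⟩
  rw [hiff]
  simp only [Rat.smul_def, map_add, map_mul, map_ratCast]
  have pu := hρ.2 φ₀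
  have pv := hρ.2 φ₁
  have hE : φ₁ e = (φ₀ e)⁻¹ := eq_inv_of_mul_eq_one_right h1
  set E := φ₀ e
  set u := φ₀ ρ
  set v := φ₁ ρ
  have huv : 0 < u * v := mul_pos pu pv
  have hE0 : 0 < E := by linarith
  have e1 : (l * u + m * (E * u)) * v - (l * v + m * (φ₁ e * v)) * u = m * (u * v * (E - E⁻¹)) := by
    rw [hE]; ring
  have e2 : E ^ 2 * ((l * v + m * (φ₁ e * v)) * u) - (l * u + m * (E * u)) * v =
      l * (u * v * (E ^ 2 - 1)) := by
    rw [hE]; field_simp; ring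
  have hEinv : 0 < E - E⁻¹ := by
    have := inv_lt_one_of_one_lt₀ h0
    linarith
  have hE2 : 0 < E ^ 2 - 1 := by nlinarith
  rw [← sub_nonneg (b := (l * v + m * (φ₁ e * v)) * u), e1,
    ← sub_pos (b := (l * u + m * (E * u)) * v), e2,
    mul_nonneg_iff_of_pos_right (mul_pos huv hEinv), mul_pos_iff_of_pos_right (mul_pos huv hE2)]
  rw [and_comm]
  norm_cast

/-- Every totally positive element has exactly one multiple by a power of `e` in the cone. -/
theorem exists_zpow_mul_mem_cone (hk : Module.finrank ℚ k = 2) (h0 : 1 < φ₀ e)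
    (h1 : φ₀ e * φ₁ e = 1) (hρ : TotallyPositive ρ) {x : k} (hx : TotallyPositive x) :
    ∃ n : ℤ, e ^ n * x ∈ cone ρ (e * ρ) := by
  have pu := hρ.2 φ₀
  have pv := hρ.2 φ₁
  have px := hx.2 φ₀
  have py := hx.2 φ₁
  have hE : φ₁ e = (φ₀ e)⁻¹ := eq_inv_of_mul_eq_one_right h1
  have hE0 : 0 < φ₀ e := by linarith
  -- Multiplication by e^(-n) divides the ratio r by φ₀(e)^(2n), so n is chosen to bring r into [1,
  -- φ₀(e)²).
  obtain ⟨n, hn1, hn2⟩ := exists_mem_Ico_zpow (x := φ₀ x * φ₁ ρ / (φ₁ x * φ₀ ρ))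
    (y := φ₀ e ^ 2) (by positivity) (by nlinarith)
  refine ⟨-n, (mem_cone_iff hk h0 h1 hρ _).2 ?_⟩
  rw [zpow_neg]
  simp only [map_mul, map_inv₀, map_zpow₀, hE, inv_zpow, inv_inv]
  have hz : 0 < φ₀ e ^ n := zpow_pos hE0 n
  have hsq : (φ₀ e ^ 2) ^ n = φ₀ e ^ n * φ₀ e ^ n := by
    rw [← zpow_natCast, ← zpow_mul, ← zpow_add₀ hE0.ne']
    congr 1
    push_cast
    ring
  rw [zpow_add₀ (by positivity), zpow_one] at hn2
  rw [hsq, le_div_iff₀ (by positivity)] at hn1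
  rw [hsq, div_lt_iff₀ (by positivity)] at hn2
  constructor
  · rw [inv_mul_eq_div, div_mul_eq_mul_div, le_div_iff₀ hz]
    linarith
  · rw [inv_mul_eq_div, div_mul_eq_mul_div, div_lt_iff₀ hz]
    linarith

/-- Multiplication by e^n multiplies the ratio by φ₀(e)^(2n), which for n > 0 leaves the half-open
interval [1, φ₀(e)²). The case n < 0 is the same statement read from e^n x. -/
theorem eq_zero_of_zpow_mul_mem_cone [NumberField.IsTotallyReal k] (hk : Module.finrank ℚ k = 2) (h0 : 1 < φ₀ e)
    (h1 : φ₀ e * φ₁ e = 1) (he : TotallyPositive e) (hρ : TotallyPositive ρ) {x : k}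
    (hxc : x ∈ cone ρ (e * ρ)) {n : ℤ} (hn : e ^ n * x ∈ cone ρ (e * ρ)) : n = 0 := by
  have hpos : ∀ x, x ∈ cone ρ (e * ρ) → TotallyPositive x := fun x =>
    totallyPositive_of_mem_cone hk hρ (he.mul hρ)
  have key : ∀ (n : ℤ) (x : k), x ∈ cone ρ (e * ρ) →
      e ^ n * x ∈ cone ρ (e * ρ) → n ≤ 0 := by
    intro n x hxc hn
    have hx := hpos x hxc
    have pu := hρ.2 φ₀
    have pv := hρ.2 φ₁
    have px := hx.2 φ₀
    have py := hx.2 φ₁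
    have hE : φ₁ e = (φ₀ e)⁻¹ := eq_inv_of_mul_eq_one_right h1
    have hE0 : 0 < φ₀ e := by linarith
    obtain ⟨a1, -⟩ := (mem_cone_iff hk h0 h1 hρ _).1 hxc
    obtain ⟨-, b2⟩ := (mem_cone_iff hk h0 h1 hρ _).1 hn
    simp only [map_mul, map_zpow₀, hE, inv_zpow] at b2
    by_contra hlt
    push Not at hlt
    have hz : φ₀ e ≤ φ₀ e ^ n := by
      calc φ₀ e = φ₀ e ^ (1 : ℤ) := (zpow_one _).symm
        _ ≤ φ₀ e ^ n := zpow_le_zpow_right₀ h0.le (by omega)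
    have hz0 : 0 < φ₀ e ^ n := zpow_pos hE0 n
    rw [show φ₀ e ^ 2 * ((φ₀ e ^ n)⁻¹ * φ₁ x * φ₀ ρ) = φ₀ e ^ 2 * (φ₁ x * φ₀ ρ) / φ₀ e ^ n by
      field_simp, lt_div_iff₀ hz0] at b2
    have c1 : φ₀ e ^ 2 ≤ φ₀ e ^ n * φ₀ e ^ n := by nlinarith
    have c2 : 0 < φ₁ x * φ₀ ρ := by positivity
    nlinarith
  refine le_antisymm (key n x hxc hn) ?_
  have hback : e ^ (-n) * (e ^ n * x) = x := by
    rw [← mul_assoc, ← zpow_add₀ he.1, neg_add_cancel, zpow_zero, one_mul]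
  have := key (-n) (e ^ n * x) hn (by rwa [hback])
  omega

end FundamentalDomain

/-! ### The class zeta function as NI^s times the cone series -/

section ZetaEq

variable {k : Type*} [Field k] [NumberField k]

theorem absNorm_pos {I : FractionalIdeal (𝓞 k)⁰ k} (hI : I ≠ 0) :
    (0 : ℚ) < FractionalIdeal.absNorm I :=
  (FractionalIdeal.absNorm_nonneg I).lt_of_ne' fun h =>
    hI (FractionalIdeal.absNorm_eq_zero_iff.1 h)

theorem mk_mem_of_unitsPlus {𝔣 : Ideal (𝓞 k)} {ε : (𝓞 k)ˣ}
    (hε : Subgroup.zpowers ε = unitsPlus 𝔣) : ε ∈ unitsPlus 𝔣 := hε ▸ Subgroup.mem_zpowers ε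

theorem algebraMap_zpow_unit (ε : (𝓞 k)ˣ) (n : ℤ) :
    algebraMap (𝓞 k) k ((ε ^ n : (𝓞 k)ˣ) : 𝓞 k) = algebraMap (𝓞 k) k (ε : 𝓞 k) ^ n := by
  have h := map_zpow (Units.map (algebraMap (𝓞 k) k).toMonoidHom) ε n
  have h2 := congrArg Units.val h
  rw [Units.val_zpow_eq_zpow_val] at h2
  exact h2

/-- The elements of the cone on `ρ, ερ` represent the totally positive elements modulo `ε`. -/
theorem bijective_cone_quotient [NumberField.IsTotallyReal k] (hk : Module.finrank ℚ k = 2)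
    {𝔣 : Ideal (𝓞 k)} (h𝔣 : 𝔣 ≠ ⊥) (P : CharPair 𝔣) (p : ℕ) [Fact p.Prime] {ε : (𝓞 k)ˣ}
    (hε : Subgroup.zpowers ε = unitsPlus 𝔣) (ρ : P.mod) (hρ : TotallyPositive (ρ : k)) :
    ∃ F : {a : P.mod // (a : k) ∈ cone (ρ : k) (((ε : 𝓞 k) • ρ : P.mod) : k) ∧
        ¬ p ∣ idealIndex P.I (a : k)} → P.S (primesAbove k p),
      (∀ a, ((F a : P.mod)) = a.1) ∧
      Function.Bijective fun a => Quotient.mk (P.orbitSetoid (primesAbove k p)) (F a) := by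
  obtain ⟨φ₀, φ₁, -, h0, h1⟩ := exists_one_lt_embedding hk h𝔣 hε
  have he : TotallyPositive (algebraMap (𝓞 k) k ε) := (mk_mem_of_unitsPlus hε).2
  have hcoe : (((ε : 𝓞 k) • ρ : P.mod) : k) = algebraMap (𝓞 k) k ε * ρ := by
    rw [Submodule.coe_smul, Algebra.smul_def]
  rw [hcoe]
  have hsmul : ∀ (n : ℤ) (x : P.mod), ((((ε ^ n : (𝓞 k)ˣ) : 𝓞 k) • x : P.mod) : k) =
      algebraMap (𝓞 k) k ε ^ n * x := fun n x => by
    rw [Submodule.coe_smul, Algebra.smul_def, algebraMap_zpow_unit]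
  refine ⟨fun a => ⟨a.1, totallyPositive_of_mem_cone hk hρ (he.mul hρ) a.2.1, ?_⟩,
    fun a => rfl, ?_, ?_⟩
  · exact (forall_count_eq_zero_iff_not_dvd_idealIndex p P.ne_zero
      (totallyPositive_of_mem_cone hk hρ (he.mul hρ) a.2.1).1 a.1.2).2 a.2.2
  · intro a b hab
    obtain ⟨u, hu, h⟩ := Quotient.exact hab
    rw [← hε] at hu
    obtain ⟨n, rfl⟩ := Subgroup.mem_zpowers_iff.1 hu
    have h' : (b.1 : k) = algebraMap (𝓞 k) k ε ^ n * a.1 := by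
      rw [← hsmul]
      exact congrArg Subtype.val h
    have hn : n = 0 := eq_zero_of_zpow_mul_mem_cone hk h0 h1 he hρ a.2.1 (by rw [← h']; exact b.2.1)
    rw [hn, zpow_zero, one_mul] at h'
    exact Subtype.ext (Subtype.ext h'.symm)
  · intro q
    induction q using Quotient.inductionOn with
    | _ a =>
      obtain ⟨n, hn⟩ := exists_zpow_mul_mem_cone hk h0 h1 hρ a.2.1
      have hdvd := (forall_count_eq_zero_iff_not_dvd_idealIndex p P.ne_zero a.2.1.1 a.1.2).1 a.2.2
      refine ⟨⟨((ε ^ n : (𝓞 k)ˣ) : 𝓞 k) • a.1, by rw [hsmul]; exact hn, ?_⟩, ?_⟩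
      · rw [Submodule.coe_smul, idealIndex_smul]
        exact hdvd
      · refine Quotient.sound ⟨(ε ^ n)⁻¹, ?_, ?_⟩
        · rw [← hε]
          exact inv_mem (zpow_mem (Subgroup.mem_zpowers ε) n)
        · change a.1 = (((ε ^ n)⁻¹ : (𝓞 k)ˣ) : 𝓞 k) • (((ε ^ n : (𝓞 k)ˣ) : 𝓞 k) • a.1)
          rw [smul_smul, Units.inv_mul, one_smul]

/-- Termwise identity from |I:(a)| · NI = N(a), valid for totally positive a, after reindexing the
orbits by the cone. No convergence is needed, so `s` is arbitrary. -/
theorem zeta_eq_mul_coneZeta [NumberField.IsTotallyReal k] (hk : Module.finrank ℚ k = 2)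
    {𝔣 : Ideal (𝓞 k)} (h𝔣 : 𝔣 ≠ ⊥) (P : CharPair 𝔣) (p : ℕ) [Fact p.Prime] {ε : (𝓞 k)ˣ}
    (hε : Subgroup.zpowers ε = unitsPlus 𝔣) (ρ : P.mod) (hρ : TotallyPositive (ρ : k)) (s : ℂ) :
    P.zeta (primesAbove k p) s =
      ((FractionalIdeal.absNorm P.I : ℚ) : ℂ) ^ s * P.coneZeta p ρ ((ε : 𝓞 k) • ρ) s := by
  obtain ⟨F, hF, hbij⟩ := bijective_cone_quotient hk h𝔣 P p hε ρ hρ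
  have he : TotallyPositive (algebraMap (𝓞 k) k ε) := (mk_mem_of_unitsPlus hε).2
  unfold CharPair.zeta CharPair.coneZeta
  rw [← tsum_mul_left, ← (Equiv.ofBijective _ hbij).tsum_eq]
  congr 1
  funext a
  change (P.ξ (F a : P.mod) : ℂ) / (idealIndex P.I ((F a : P.mod) : k) : ℂ) ^ s = _
  have hpos := (F a).2.1
  rw [hF] at hpos ⊢
  have hN := absNorm_pos P.ne_zero
  have hn : 0 < Algebra.norm ℚ (a.1 : k) := norm_pos_of_totallyPositive hk hpos
  have hidx := idealIndex_mul_absNorm (a := (a.1 : k)) a.1.2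
  rw [abs_of_pos hn] at hidx
  have hNC : ((FractionalIdeal.absNorm P.I : ℚ) : ℂ) ≠ 0 := by exact_mod_cast hN.ne'
  rw [prod_complexEmbeddings, ← hidx]
  have hmul : ((((idealIndex P.I (a.1 : k) : ℚ) * FractionalIdeal.absNorm P.I : ℚ) : ℂ)) ^ s =
      (idealIndex P.I (a.1 : k) : ℂ) ^ s * ((FractionalIdeal.absNorm P.I : ℚ) : ℂ) ^ s := by
    have := Complex.mul_cpow_ofReal_nonneg (a := (idealIndex P.I (a.1 : k) : ℝ))
      (b := ((FractionalIdeal.absNorm P.I : ℚ) : ℝ)) (by positivity) (by exact_mod_cast hN.le) s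
    push_cast at this ⊢
    exact this
  rw [hmul]
  have h3 : ((FractionalIdeal.absNorm P.I : ℚ) : ℂ) ^ s ≠ 0 := by
    rw [Ne, Complex.cpow_eq_zero_iff]
    tauto
  rw [mul_div_assoc', mul_comm _ (((FractionalIdeal.absNorm P.I : ℚ) : ℂ) ^ s),
    mul_div_mul_left _ _ h3]

end ZetaEq

/-! ### Decomposition of the cone along the lattice p(ℕτ₁ + ℕτ₂) -/

section Cone

set_option linter.unusedSectionVars false

variable {k : Type*} [Field k] [NumberField k]

/-- The point `x + (i + p m₁) τ₁ + (j + p m₂) τ₂` of the cone. -/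
def conePoint {M : Type*} [AddCommMonoid M] (p : ℕ) (τ₁ τ₂ : M) (t : M × Fin p × Fin p)
    (m : ℕ × ℕ) : M :=
  t.1 + (t.2.1 + p * m.1 : ℕ) • τ₁ + (t.2.2 + p * m.2 : ℕ) • τ₂

theorem conePoint_eq {M : Type*} [AddCommMonoid M] (p : ℕ) (τ₁ τ₂ : M) (t : M × Fin p × Fin p)
    (m : ℕ × ℕ) : conePoint p τ₁ τ₂ t m =
      conePoint p τ₁ τ₂ t 0 + p • (m.1 • τ₁ + m.2 • τ₂) := by
  simp only [conePoint, Prod.fst_zero, Prod.snd_zero, mul_zero, add_zero, add_smul, mul_smul,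
    smul_add]
  abel

theorem coe_nsmul_mem {M : Submodule (𝓞 k) k} (c : ℕ) (x : M) : ((c • x : M) : k) = c * x := by
  rw [← nsmul_eq_mul]
  exact map_nsmul M.subtype c x

theorem add_mul_inj {p i i' m m' : ℕ} (hi : i < p) (hi' : i' < p) (h : i + p * m = i' + p * m') :
    i = i' ∧ m = m' := by
  have h1 := congrArg (· % p) h
  simp only [Nat.add_mul_mod_self_left, Nat.mod_eq_of_lt hi, Nat.mod_eq_of_lt hi'] at h1
  subst h1
  have h2 : p * m = p * m' := by omega
  exact ⟨rfl, Nat.eq_of_mul_eq_mul_left (by omega) h2⟩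

theorem conePoint_injective {M : Submodule (𝓞 k) k} (p : ℕ) {τ₁ τ₂ : M}
    (hli : ∀ l m l' m' : ℚ, l • (τ₁ : k) + m • (τ₂ : k) = l' • (τ₁ : k) + m' • (τ₂ : k) →
      l = l' ∧ m = m') :
    Function.Injective fun q : ({x : M // (x : k) ∈ parallelogram (τ₁ : k) (τ₂ : k)} ×
      Fin p × Fin p) × ℕ × ℕ => conePoint p τ₁ τ₂ (q.1.1.1, q.1.2) q.2 := by
  rintro ⟨⟨⟨x, l, m, hl, hl', hm, hm', hx⟩, i, j⟩, m₁, m₂⟩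
    ⟨⟨⟨x', l₂, m₂', h2l, h2l', h2m, h2m', hx'⟩, i', j'⟩, m₁', m₂''⟩ h
  have h' := congrArg (Subtype.val : M → k) h
  simp only [conePoint, Submodule.coe_add, hx, hx'] at h'
  have e1 : ∀ (a b : ℚ) (c d : ℕ), a • (τ₁ : k) + b • (τ₂ : k) + c • (τ₁ : k) + d • (τ₂ : k) =
      (a + c) • (τ₁ : k) + (b + d) • (τ₂ : k) := fun a b c d => by
    simp only [Rat.smul_def, nsmul_eq_mul]; push_cast; ring
  have h'' : (l + ((i + p * m₁ : ℕ) : ℚ)) • (τ₁ : k) + (m + ((j + p * m₂ : ℕ) : ℚ)) • (τ₂ : k) =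
      (l₂ + ((i' + p * m₁' : ℕ) : ℚ)) • (τ₁ : k) +
        (m₂' + ((j' + p * m₂'' : ℕ) : ℚ)) • (τ₂ : k) := by
    rw [← e1, ← e1]; exact h'
  obtain ⟨ha, hb⟩ := hli _ _ _ _ h''
  -- Both fractional parts lie in (0, 1], so the integer parts differ by less than 1.
  have key1 : (i + p * m₁ : ℕ) = i' + p * m₁' := by
    have a1 : ((i + p * m₁ : ℕ) : ℚ) < ((i' + p * m₁' : ℕ) : ℚ) + 1 := by linarith
    have a2 : ((i' + p * m₁' : ℕ) : ℚ) < ((i + p * m₁ : ℕ) : ℚ) + 1 := by linarith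
    have a1' : (i + p * m₁ : ℕ) < (i' + p * m₁' : ℕ) + 1 := by exact_mod_cast a1
    have a2' : (i' + p * m₁' : ℕ) < (i + p * m₁ : ℕ) + 1 := by exact_mod_cast a2
    omega
  have key2 : (j + p * m₂ : ℕ) = j' + p * m₂'' := by
    have a1 : ((j + p * m₂ : ℕ) : ℚ) < ((j' + p * m₂'' : ℕ) : ℚ) + 1 := by linarith
    have a2 : ((j' + p * m₂'' : ℕ) : ℚ) < ((j + p * m₂ : ℕ) : ℚ) + 1 := by linarith
    have a1' : (j + p * m₂ : ℕ) < (j' + p * m₂'' : ℕ) + 1 := by exact_mod_cast a1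
    have a2' : (j' + p * m₂'' : ℕ) < (j + p * m₂ : ℕ) + 1 := by exact_mod_cast a2
    omega
  rw [key1] at ha
  rw [key2] at hb
  obtain ⟨r1, rfl⟩ := add_mul_inj i.2 i'.2 key1
  obtain ⟨r2, rfl⟩ := add_mul_inj j.2 j'.2 key2
  have hxx : x = x' := Subtype.ext (by
    rw [hx, hx', add_right_cancel ha, add_right_cancel hb])
  subst hxx
  obtain rfl := Fin.ext r1
  obtain rfl := Fin.ext r2
  rfl

theorem conePoint_mem_cone {M : Submodule (𝓞 k) k} (p : ℕ) {τ₁ τ₂ : M}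
    {t : M × Fin p × Fin p} (ht : (t.1 : k) ∈ parallelogram (τ₁ : k) (τ₂ : k)) (m : ℕ × ℕ) :
    ((conePoint p τ₁ τ₂ t m : M) : k) ∈ cone (τ₁ : k) (τ₂ : k) := by
  obtain ⟨l, n, hl, -, hn, -, hx⟩ := ht
  refine ⟨l + ((t.2.1 + p * m.1 : ℕ) : ℚ), n + ((t.2.2 + p * m.2 : ℕ) : ℚ), by positivity,
    by positivity, ?_⟩
  simp only [conePoint, Submodule.coe_add, coe_nsmul_mem, hx]
  simp only [Rat.smul_def]
  push_cast
  ring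

theorem exists_conePoint_eq {M : Submodule (𝓞 k) k} {p : ℕ} (hp : 0 < p) {τ₁ τ₂ : M}
    {a : M} (ha : (a : k) ∈ cone (τ₁ : k) (τ₂ : k)) :
    ∃ q : ({x : M // (x : k) ∈ parallelogram (τ₁ : k) (τ₂ : k)} × Fin p × Fin p) × ℕ × ℕ,
      conePoint p τ₁ τ₂ (q.1.1.1, q.1.2) q.2 = a := by
  obtain ⟨l, m, hl, hm, h⟩ := ha
  -- The first coordinate of the parallelogram is open at 0 and closed at 1, hence the integer part
  -- ⌈l⌉ - 1; the second has the opposite convention, hence ⌊m⌋.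
  obtain ⟨n₁, hn₁⟩ : ∃ n : ℕ, (n : ℤ) = ⌈l⌉ - 1 := by
    have := Int.ceil_pos.2 hl
    exact ⟨(⌈l⌉ - 1).toNat, Int.toNat_of_nonneg (by omega)⟩
  obtain ⟨n₂, hn₂⟩ : ∃ n : ℕ, (n : ℤ) = ⌊m⌋ :=
    ⟨⌊m⌋.toNat, Int.toNat_of_nonneg (Int.floor_nonneg.2 hm)⟩
  have b1 : (n₁ : ℚ) = ⌈l⌉ - 1 := by exact_mod_cast congrArg (Int.cast : ℤ → ℚ) hn₁
  have b2 : (n₂ : ℚ) = ⌊m⌋ := by exact_mod_cast congrArg (Int.cast : ℤ → ℚ) hn₂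
  have c1 := Int.le_ceil l
  have c2 := Int.ceil_lt_add_one l
  have c3 := Int.floor_le m
  have c4 := Int.lt_floor_add_one m
  refine ⟨((⟨a - n₁ • τ₁ - n₂ • τ₂, l - n₁, m - n₂, by linarith, by linarith, by linarith,
    by linarith, ?_⟩, ⟨n₁ % p, Nat.mod_lt _ hp⟩, ⟨n₂ % p, Nat.mod_lt _ hp⟩), n₁ / p, n₂ / p), ?_⟩
  · simp only [Submodule.coe_sub, coe_nsmul_mem, h]
    simp only [Rat.smul_def]
    push_cast
    ring
  · simp only [conePoint, Nat.mod_add_div]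
    abel

theorem hasSum_prod_of_finite {α β : Type*} [Fintype α] [DecidableEq α] {F : α × β → ℂ} {g : α → ℂ}
    (h : ∀ x, HasSum (fun y => F (x, y)) (g x)) : HasSum F (∑ x, g x) := by
  have h1 : ∀ x, HasSum (fun q : α × β => if q.1 = x then F q else 0) (g x) := by
    intro x
    refine (Function.Injective.hasSum_iff (Prod.mk_right_injective x) ?_).1 ?_
    · rintro ⟨a, b⟩ hq
      refine if_neg fun hax => hq ⟨b, ?_⟩
      change a = x at hax
      rw [hax]
    · refine (h x).congr_fun ?_
      intro y
      simp
  have h2 := hasSum_sum (s := Finset.univ) fun x _ => h1 x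
  refine h2.congr_fun ?_
  intro q
  simp

end Cone

/-! ### Continuation of the cone series and its values -/

section Continuation

set_option linter.unusedSectionVars false

variable {k : Type*} [Field k] [NumberField k]

/-- The elements of `I` in the parallelogram on `τ₁, τ₂`. -/
abbrev ParPoint {M : Submodule (𝓞 k) k} (τ₁ τ₂ : M) : Type _ :=
  {x : M // (x : k) ∈ parallelogram (τ₁ : k) (τ₂ : k)}

open Classical in
/-- The value at `-n` of the continuation of `coneZeta`, for large `N`. -/
noncomputable def CharPair.coneValue {𝔣 : Ideal (𝓞 k)} (P : CharPair 𝔣) (p : ℕ) (τ₁ τ₂ : P.mod)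
    [Fintype (ParPoint τ₁ τ₂)] (n N : ℕ) : QBar :=
  ∑ t : ParPoint τ₁ τ₂ × Fin p × Fin p,
    if p ∣ idealIndex P.I ((conePoint p τ₁ τ₂ (t.1.1, t.2) 0 : P.mod) : k) then 0 else
      P.ξ (conePoint p τ₁ τ₂ (t.1.1, t.2) 0) *
        abelSum₂ (P.ξ τ₁ ^ p) (P.ξ τ₂ ^ p) N fun a b =>
          ((Algebra.norm ℚ ((conePoint p τ₁ τ₂ (t.1.1, t.2) (a, b) : P.mod) : k) : ℚ) : QBar) ^ n

theorem CharPair.norm_ξ {𝔣 : Ideal (𝓞 k)} (P : CharPair 𝔣) (x : P.mod) : ‖(P.ξ x : ℂ)‖ = 1 := by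
  obtain ⟨n, hn, h⟩ := isOfFinOrder_iff_pow_eq_one.1 (P.isOfFinOrder x)
  refine Complex.norm_eq_one_of_pow_eq_one (n := n) ?_ hn.ne'
  exact_mod_cast congrArg (Subtype.val : QBar → ℂ) h

theorem CharPair.ξ_conePoint {𝔣 : Ideal (𝓞 k)} (P : CharPair 𝔣) (p : ℕ) (τ₁ τ₂ : P.mod)
    (t : P.mod × Fin p × Fin p) (m : ℕ × ℕ) : P.ξ (conePoint p τ₁ τ₂ t m) =
      P.ξ (conePoint p τ₁ τ₂ t 0) * ((P.ξ τ₁ ^ p) ^ m.1 * (P.ξ τ₂ ^ p) ^ m.2) := by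
  rw [conePoint_eq, AddChar.map_add_eq_mul, AddChar.map_nsmul_eq_pow, AddChar.map_add_eq_mul,
    AddChar.map_nsmul_eq_pow, AddChar.map_nsmul_eq_pow, mul_pow, ← pow_mul, ← pow_mul, ← pow_mul,
    ← pow_mul, mul_comm m.1, mul_comm m.2]

/-- On each family `conePoint` the condition of being prime to p is constant by `hper`. What is left
is a twisted Shintani series with the roots of unity ξ(τ₁)^p and ξ(τ₂)^p, which must therefore
differ from 1. -/
theorem CharPair.exists_entire_coneZeta [NumberField.IsTotallyReal k]
    (hk : Module.finrank ℚ k = 2) {𝔣 : Ideal (𝓞 k)} (P : CharPair 𝔣) (p : ℕ) [Fact p.Prime]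
    {τ₁ τ₂ : P.mod} (h₁ : TotallyPositive (τ₁ : k)) (h₂ : TotallyPositive (τ₂ : k))
    (hli : ∀ l m l' m' : ℚ, l • (τ₁ : k) + m • (τ₂ : k) = l' • (τ₁ : k) + m' • (τ₂ : k) →
      l = l' ∧ m = m') (hz₁ : P.ξ τ₁ ^ p ≠ 1) (hz₂ : P.ξ τ₂ ^ p ≠ 1)
    (hper : ∀ a b : P.mod, p ∣ idealIndex P.I ((a + p • b : P.mod) : k) ↔
      p ∣ idealIndex P.I (a : k)) [Fintype (ParPoint τ₁ τ₂)] :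
    ∃ G : ℂ → ℂ, Differentiable ℂ G ∧ (∀ s, 1 < s.re → G s = P.coneZeta p τ₁ τ₂ s) ∧
      ∀ n N : ℕ, 2 * n + 2 < N → G (-(n : ℂ)) = (P.coneValue p τ₁ τ₂ n N : ℂ) := by
  classical
  have hp : 0 < p := (Fact.out : p.Prime).pos
  obtain ⟨φ₀, φ₁, hφ⟩ := exists_realEmbeddings_ne (k := k) hk
  have hx : ∀ t : ParPoint τ₁ τ₂ × Fin p × Fin p,
      TotallyPositive ((conePoint p τ₁ τ₂ (t.1.1, t.2) 0 : P.mod) : k) := fun t =>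
    totallyPositive_of_mem_cone hk h₁ h₂ (conePoint_mem_cone p t.1.2 0)
  have hp' : (0 : ℝ) < p := by exact_mod_cast hp
  have hlin : ∀ (φ : k →+* ℝ) (t : ParPoint τ₁ τ₂ × Fin p × Fin p) (m : ℕ × ℕ),
      φ ((conePoint p τ₁ τ₂ (t.1.1, t.2) m : P.mod) : k) =
        φ ((conePoint p τ₁ τ₂ (t.1.1, t.2) 0 : P.mod) : k) + p * φ τ₁ * m.1 + p * φ τ₂ * m.2 := by
    intro φ t m
    rw [conePoint_eq]
    simp only [Submodule.coe_add, coe_nsmul_mem, map_add, map_mul, map_natCast]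
    ring
  have hnorm : ∀ (t : ParPoint τ₁ τ₂ × Fin p × Fin p) (m : ℕ × ℕ),
      ((Algebra.norm ℚ ((conePoint p τ₁ τ₂ (t.1.1, t.2) m : P.mod) : k) : ℚ) : ℂ) =
        (((φ₀ ((conePoint p τ₁ τ₂ (t.1.1, t.2) 0 : P.mod) : k) + p * φ₀ τ₁ * m.1 +
            p * φ₀ τ₂ * m.2) *
          (φ₁ ((conePoint p τ₁ τ₂ (t.1.1, t.2) 0 : P.mod) : k) + p * φ₁ τ₁ * m.1 +
            p * φ₁ τ₂ * m.2) : ℝ) : ℂ) := by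
    intro t m
    rw [← hlin, ← hlin, ← norm_eq_mul_of_ne hk Complex.ofRealHom hφ]
    push_cast
    rfl
  have hne : ∀ x : P.mod, P.ξ x ^ p ≠ 1 → (P.ξ x : ℂ) ^ p ≠ 1 := fun x hx h =>
    hx (Subtype.ext (by push_cast; exact h))
  have hle : ∀ x : P.mod, ‖(P.ξ x : ℂ) ^ p‖ ≤ 1 := fun x => by rw [norm_pow, P.norm_ξ, one_pow]
  choose g hg1 hg2 hg3 using fun t : ParPoint τ₁ τ₂ × Fin p × Fin p =>
    exists_entire_twistedShintani (hle τ₁) (hne τ₁ hz₁) (hle τ₂) (hne τ₂ hz₂)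
      ((hx t).2 φ₀) (mul_pos hp' (h₁.2 φ₀)) (mul_pos hp' (h₂.2 φ₀))
      ((hx t).2 φ₁) (mul_pos hp' (h₁.2 φ₁)) (mul_pos hp' (h₂.2 φ₁))
  refine ⟨fun s => ∑ t : ParPoint τ₁ τ₂ × Fin p × Fin p,
    if p ∣ idealIndex P.I ((conePoint p τ₁ τ₂ (t.1.1, t.2) 0 : P.mod) : k) then 0 else
      (P.ξ (conePoint p τ₁ τ₂ (t.1.1, t.2) 0) : ℂ) * g t s, ?_, ?_, ?_⟩
  · refine Differentiable.fun_sum fun t _ => ?_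
    split_ifs
    · exact differentiable_const _
    · exact (hg1 t).const_mul _
  · intro s hs
    let S : Set P.mod :=
      {a : P.mod | (a : k) ∈ cone (τ₁ : k) (τ₂ : k) ∧ ¬ p ∣ idealIndex P.I (a : k)}
    let f : P.mod → ℂ := S.indicator
      fun a => (P.ξ a : ℂ) / (∏ φ : k →+* ℂ, φ (a : k)) ^ s
    have hf : P.coneZeta p τ₁ τ₂ s = ∑' a, f a := by
      unfold CharPair.coneZeta
      exact tsum_subtype _ fun a : P.mod => (P.ξ a : ℂ) / (∏ φ : k →+* ℂ, φ (a : k)) ^ s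
    rw [hf]
    symm
    refine HasSum.tsum_eq ?_
    -- The indicator makes the series a sum over all of I, which is then pulled back along the
    -- parametrisation of the cone.
    rw [← (conePoint_injective p hli).hasSum_iff]
    · refine hasSum_prod_of_finite fun t => ?_
      have hmem : ∀ m, ((conePoint p τ₁ τ₂ (t.1.1, t.2) m : P.mod) : k) ∈ cone (τ₁ : k) (τ₂ : k) :=
        fun m => conePoint_mem_cone p t.1.2 m
      have hdvd : ∀ m, p ∣ idealIndex P.I ((conePoint p τ₁ τ₂ (t.1.1, t.2) m : P.mod) : k) ↔
          p ∣ idealIndex P.I ((conePoint p τ₁ τ₂ (t.1.1, t.2) 0 : P.mod) : k) := fun m => by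
        rw [conePoint_eq, hper]
      split_ifs with h
      · refine hasSum_zero.congr_fun fun m => ?_
        have hS : conePoint p τ₁ τ₂ (t.1.1, t.2) m ∉ S := fun h' => h'.2 ((hdvd m).2 h)
        change f (conePoint p τ₁ τ₂ (t.1.1, t.2) m) = 0
        exact Set.indicator_of_notMem hS _
      · refine ((hg2 t s hs).mul_left _).congr_fun fun m => ?_
        have hS : conePoint p τ₁ τ₂ (t.1.1, t.2) m ∈ S := ⟨hmem m, fun h' => h ((hdvd m).1 h')⟩
        change f (conePoint p τ₁ τ₂ (t.1.1, t.2) m) = _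
        refine (Set.indicator_of_mem hS _).trans ?_
        rw [prod_complexEmbeddings, hnorm, P.ξ_conePoint, Complex.cpow_neg]
        push_cast
        ring
    · intro a ha
      refine Set.indicator_of_notMem (fun h' => ha ?_) _
      exact exists_conePoint_eq hp h'.1
  · intro n N hN
    unfold CharPair.coneValue
    have hcoe : ∀ x : QBar, (x : ℂ) = algebraMap QBar ℂ x := fun x => rfl
    rw [hcoe, map_sum]
    refine Finset.sum_congr rfl fun t _ => ?_
    split_ifs
    · rw [map_zero]
    · rw [map_mul, map_abelSum₂, hg3 t n N hN, map_pow, map_pow]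
      simp only [map_pow, map_ratCast, hnorm]
      rfl

end Continuation

/-! ### Uniqueness of continued values -/

section ContinuedValue

theorem isContinuedValue_of_entire {D G : ℂ → ℂ} (hG : Differentiable ℂ G)
    (h : ∀ s : ℂ, 1 < s.re → G s = D s) (m : ℂ) : IsContinuedValue D m (G m) :=
  ⟨G, fun s _ => (hG.analyticAt s).meromorphicAt, h, hG.analyticAt m, rfl⟩

/-- The difference of two continuations vanishes near 2, so it has infinite order there and, the
plane being connected, everywhere. Analyticity at `m` turns vanishing on a punctured neighbourhood
into equality of the values. -/
theorem IsContinuedValue.unique {D : ℂ → ℂ} {m v w : ℂ} (hv : IsContinuedValue D m v)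
    (hw : IsContinuedValue D m w) : v = w := by
  obtain ⟨g, hg, hgD, hgm, rfl⟩ := hv
  obtain ⟨h, hh, hhD, hhm, rfl⟩ := hw
  have hmer : MeromorphicOn (g - h) Set.univ := hg.sub hh
  have htop : meromorphicOrderAt (g - h) 2 = ⊤ := by
    rw [meromorphicOrderAt_eq_top_iff]
    have hopen : IsOpen {s : ℂ | 1 < s.re} := isOpen_lt continuous_const Complex.continuous_re
    filter_upwards [nhdsWithin_le_nhds (hopen.mem_nhds (show (2 : ℂ) ∈ {s : ℂ | 1 < s.re} by
      simp))] with s hs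
    rw [Pi.sub_apply, hgD s hs, hhD s hs, sub_self]
  have hm : meromorphicOrderAt (g - h) m = ⊤ := by
    by_contra hne
    exact hmer.meromorphicOrderAt_ne_top_of_isPreconnected isPreconnected_univ (Set.mem_univ m)
      (Set.mem_univ 2) hne htop
  rw [meromorphicOrderAt_eq_top_iff] at hm
  have hc : Filter.Tendsto (g - h) (nhdsWithin m {m}ᶜ) (nhds ((g - h) m)) :=
    ((hgm.sub hhm).continuousAt).tendsto.mono_left nhdsWithin_le_nhds
  have h0 : Filter.Tendsto (g - h) (nhdsWithin m {m}ᶜ) (nhds 0) :=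
    tendsto_const_nhds.congr' (hm.mono fun _ h => h.symm)
  exact sub_eq_zero.1 (tendsto_nhds_unique hc h0)

end ContinuedValue

/-! ### Roots of unity in ℚ_p, density of M(p), uniqueness of interpolation -/

section Torsion

variable {p : ℕ} [Fact p.Prime]

/-- The modulus `4` for `p = 2`, and `p` otherwise. -/
def teichModulus (p : ℕ) : ℕ := if p = 2 then 4 else p

theorem prime_dvd_teichModulus : (p : ℤ_[p]) ∣ (teichModulus p : ℤ_[p]) := by
  unfold teichModulus
  split_ifs with h
  · subst h
    exact ⟨2, by norm_num⟩
  · exact dvd_rfl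

/-- A root of unity that is `1` modulo `p` (modulo `4` if `p = 2`) is `1`. -/
theorem eq_one_of_isOfFinOrder {u : ℤ_[p]ˣ} (hu : IsOfFinOrder u)
    (h : (teichModulus p : ℤ_[p]) ∣ (u : ℤ_[p]) - 1) : u = 1 := by
  have hp : p.Prime := Fact.out
  have hprime : Prime (p : ℤ_[p]) := PadicInt.prime_p
  have prime_order : ∀ v : ℤ_[p]ˣ, (teichModulus p : ℤ_[p]) ∣ (v : ℤ_[p]) - 1 →
      ∀ l : ℕ, l.Prime → v ^ l = 1 → v = 1 := by
    intro v hv l hl hvl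
    have hvl' : (v : ℤ_[p]) ^ l - 1 ^ l = 0 := by
      rw [one_pow, ← Units.val_pow_eq_pow_val, hvl, Units.val_one, sub_self]
    have hpv : (p : ℤ_[p]) ∣ (v : ℤ_[p]) - 1 := prime_dvd_teichModulus.trans hv
    have hndvd : ¬ (p : ℤ_[p]) ∣ (v : ℤ_[p]) := fun h => hprime.not_isUnit (isUnit_of_dvd_unit h v.isUnit)
    have hconc : emultiplicity (p : ℤ_[p]) ((v : ℤ_[p]) - 1) = ⊤ → v = 1 := by
      intro htop
      by_contra hne
      have hne' : (v : ℤ_[p]) - 1 ≠ 0 := fun h0 => hne (Units.ext (sub_eq_zero.1 h0))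
      exact (finiteMultiplicity_iff_emultiplicity_ne_top.1
        (FiniteMultiplicity.of_prime_left hprime hne')) htop
    -- Lifting the exponent: v^l - 1 = 0 has infinite valuation, which equals that of v - 1 if l ≠ p
    -- and exceeds it by 1 if l = p is odd. So v = 1 in both cases. For l = p = 2 the only other
    -- root is -1, excluded by the modulus 4.
    by_cases hlp : l = p
    · subst hlp
      by_cases h2 : l = 2
      · subst h2
        rw [teichModulus, if_pos rfl] at hv
        have hfac : ((v : ℤ_[2]) - 1) * ((v : ℤ_[2]) + 1) = 0 := by
          rw [← hvl']; ring
        rcases mul_eq_zero.1 hfac with h0 | h0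
        · exact Units.ext (sub_eq_zero.1 h0)
        · exfalso
          have h3 : (v : ℤ_[2]) - 1 = -2 := by linear_combination h0
          rw [h3, dvd_neg] at hv
          obtain ⟨c, hc⟩ := hv
          apply hprime.not_isUnit
          refine IsUnit.of_mul_eq_one c ?_
          have h22 : (2 : ℤ_[2]) ≠ 0 := two_ne_zero
          apply mul_left_cancel₀ h22
          push_cast at hc ⊢
          linear_combination -hc
      · apply hconc
        have h1 := emultiplicity_pow_prime_sub_pow_prime hprime (hl.odd_of_ne_two h2) hpv hndvd
        rw [hvl', emultiplicity_zero] at h1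
        by_contra hne
        obtain ⟨n, hn⟩ := ENat.ne_top_iff_exists.1 hne
        rw [← hn] at h1
        exact absurd h1.symm (by exact_mod_cast ENat.natCast_ne_top (n + 1))
    · apply hconc
      have hln : ¬ (p : ℤ_[p]) ∣ (l : ℤ_[p]) := by
        intro hd
        have := (PadicInt.norm_int_lt_one_iff_dvd (p := p) (l : ℤ)).1
          (by exact_mod_cast (PadicInt.norm_lt_one_iff_dvd _).2 hd)
        have h3 : p ∣ l := by exact_mod_cast this
        exact hlp ((Nat.prime_dvd_prime_iff_eq hp hl).1 h3).symm
      rw [← emultiplicity_pow_sub_pow_of_prime hprime hpv hndvd hln, hvl', emultiplicity_zero]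
  by_contra hne
  have hord : orderOf u ≠ 1 := fun h1 => hne (orderOf_eq_one_iff.1 h1)
  obtain ⟨l, hl, hdvd⟩ := Nat.exists_prime_and_dvd hord
  -- The power u^c is killed by the prime l, hence is 1, although c is smaller than the order lc of
  -- u.
  obtain ⟨c, hc⟩ := hdvd
  have hpos : 0 < orderOf u := hu.orderOf_pos
  have hc0 : 0 < c := Nat.pos_of_ne_zero fun h0 => by rw [h0, mul_zero] at hc; omega
  have h1 : u ^ c = 1 := by
    refine prime_order _ ?_ l hl ?_
    · rw [Units.val_pow_eq_pow_val]
      exact h.trans (sub_one_dvd_pow_sub_one _ c)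
    · rw [← pow_mul, mul_comm, ← hc, pow_orderOf_eq_one]
  have h2 := Nat.le_of_dvd hc0 (orderOf_dvd_of_pow_eq_one h1)
  have h3 := hl.two_le
  nlinarith

theorem isOfFinOrder_val {u : ℚ_[p]ˣ} (hu : IsOfFinOrder u) : ‖(u : ℚ_[p])‖ = 1 := by
  obtain ⟨n, hn, h⟩ := isOfFinOrder_iff_pow_eq_one.1 hu
  have h2 : ‖(u : ℚ_[p])‖ ^ n = 1 := by
    rw [← norm_pow, ← Units.val_pow_eq_pow_val, h, Units.val_one, norm_one]
  exact (pow_eq_one_iff_of_nonneg (norm_nonneg _) hn.ne').1 h2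

theorem card_torsion_eq : Nat.card (CommGroup.torsion ℚ_[p]ˣ) = Nat.card (CommGroup.torsion ℤ_[p]ˣ) := by
  symm
  let c : ℤ_[p]ˣ →* ℚ_[p]ˣ := Units.map PadicInt.Coe.ringHom.toMonoidHom
  have hc : Function.Injective c := Units.map_injective Subtype.coe_injective
  refine Nat.card_congr (Equiv.ofBijective (fun u : CommGroup.torsion ℤ_[p]ˣ =>
    (⟨c u, c.isOfFinOrder u.2⟩ : CommGroup.torsion ℚ_[p]ˣ)) ⟨fun u v h => ?_, fun v => ?_⟩)
  · exact Subtype.ext (hc (congrArg Subtype.val h))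
  · have hv : IsOfFinOrder (v : ℚ_[p]ˣ) := v.2
    have h1 := isOfFinOrder_val hv
    have hcv : c (PadicInt.mkUnits h1) = v := Units.ext rfl
    refine ⟨⟨PadicInt.mkUnits h1, ?_⟩, Subtype.ext hcv⟩
    have : IsOfFinOrder (c (PadicInt.mkUnits h1)) := by rw [hcv]; exact hv
    exact (hc.isOfFinOrder_iff).1 this

/-- Reduction modulo 4 (p = 2) or modulo p is injective on roots of unity, by
`eq_one_of_isOfFinOrder`. -/
theorem card_torsion_dvd : (Nat.card (CommGroup.torsion ℚ_[p]ˣ)) ∣ if p = 2 then 2 else p - 1 := by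
  have hp : p.Prime := Fact.out
  rw [card_torsion_eq]
  split_ifs with h
  · subst h
    have hinj : Function.Injective ((Units.map (PadicInt.toZModPow (p := 2) 2).toMonoidHom).comp
        (CommGroup.torsion ℤ_[2]ˣ).subtype) := by
      rw [injective_iff_map_eq_one]
      intro u hu
      refine Subtype.ext (eq_one_of_isOfFinOrder u.2 ?_)
      have h1 := congrArg Units.val hu
      have h2 : ((u : ℤ_[2]ˣ) : ℤ_[2]) - 1 ∈ RingHom.ker (PadicInt.toZModPow (p := 2) 2) := by
        rw [RingHom.mem_ker, map_sub, map_one]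
        exact sub_eq_zero.2 h1
      rw [PadicInt.ker_toZModPow, Ideal.mem_span_singleton] at h2
      rw [teichModulus, if_pos rfl]
      norm_num at h2 ⊢
      exact h2
    have h1 := Subgroup.card_dvd_of_injective _ hinj
    have h3 : Nat.card (ZMod (2 ^ 2))ˣ = 2 := by
      rw [Nat.card_eq_fintype_card, ZMod.card_units_eq_totient]
      decide
    rwa [h3] at h1
  · have hinj : Function.Injective ((Units.map (PadicInt.toZMod (p := p)).toMonoidHom).comp
        (CommGroup.torsion ℤ_[p]ˣ).subtype) := by
      rw [injective_iff_map_eq_one]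
      intro u hu
      refine Subtype.ext (eq_one_of_isOfFinOrder u.2 ?_)
      have h1 := congrArg Units.val hu
      have h2 : ((u : ℤ_[p]ˣ) : ℤ_[p]) - 1 ∈ RingHom.ker (PadicInt.toZMod (p := p)) := by
        rw [RingHom.mem_ker, map_sub, map_one]
        exact sub_eq_zero.2 h1
      rw [PadicInt.ker_toZMod, PadicInt.maximalIdeal_eq_span_p, Ideal.mem_span_singleton] at h2
      rwa [teichModulus, if_neg h]
    have h1 := Subgroup.card_dvd_of_injective _ hinj
    rwa [Nat.card_eq_fintype_card (α := (ZMod p)ˣ), ZMod.card_units] at h1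

/-- With `two_dvd_card_torsion` this shows that w_p and 2 generate the same ideal of ℤ_p, so that
D(p) is the closure of M(p). -/
theorem card_torsion_dvd_two :
    ((Nat.card (CommGroup.torsion ℚ_[p]ˣ) : ℕ) : ℤ_[p]) ∣ 2 := by
  have hp : p.Prime := Fact.out
  have h := card_torsion_dvd (p := p)
  split_ifs at h with h2
  · exact_mod_cast Nat.cast_dvd_cast (α := ℤ_[p]) h
  · have h1 : IsUnit ((p - 1 : ℕ) : ℤ_[p]) := by
      rw [PadicInt.isUnit_iff]
      refine le_antisymm (PadicInt.norm_le_one _) (not_lt.1 fun hlt => ?_)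
      have h3 : p ∣ p - 1 := by
        have := (PadicInt.norm_int_lt_one_iff_dvd (p := p) ((p - 1 : ℕ) : ℤ)).1
          (by exact_mod_cast hlt)
        exact_mod_cast this
      have := Nat.le_of_dvd (Nat.sub_pos_of_lt hp.one_lt) h3
      have := hp.one_lt
      omega
    exact (isUnit_of_dvd_unit (Nat.cast_dvd_cast (α := ℤ_[p]) h) h1).dvd

theorem card_torsion_pos : 0 < Nat.card (CommGroup.torsion ℚ_[p]ˣ) := by
  have hp : p.Prime := Fact.out
  have h := card_torsion_dvd (p := p)
  refine Nat.pos_of_ne_zero fun h0 => ?_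
  rw [h0, zero_dvd_iff] at h
  have := hp.one_lt
  split_ifs at h
  omega

theorem two_dvd_card_torsion : 2 ∣ Nat.card (CommGroup.torsion ℚ_[p]ˣ) := by
  have h1 : IsOfFinOrder (-1 : ℚ_[p]ˣ) :=
    isOfFinOrder_iff_pow_eq_one.2 ⟨2, by norm_num, by norm_num⟩
  have h2 : orderOf (⟨-1, h1⟩ : CommGroup.torsion ℚ_[p]ˣ) = 2 := by
    refine orderOf_eq_prime (Subtype.ext (by simp)) fun h => ?_
    have h3 := congrArg (fun u : CommGroup.torsion ℚ_[p]ˣ => ((u : ℚ_[p]ˣ) : ℚ_[p])) h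
    norm_num at h3
  rw [← h2]
  exact orderOf_dvd_natCard _

/-- A root of unity in `ℤ_p` is killed by the exponents `m - 1`, `m ∈ M(p)`. -/
theorem zpow_eq_one_of_mem_interpSet {ζ : ℤ_[p]ˣ} (hζ : IsOfFinOrder ζ) {m : ℤ}
    (hm : m ∈ interpSet p) : ζ ^ m = ζ := by
  have h1 : (⟨ζ, hζ⟩ : CommGroup.torsion ℤ_[p]ˣ) ^ Nat.card (CommGroup.torsion ℤ_[p]ˣ) = 1 :=
    pow_card_eq_one'
  have h2 : ζ ^ Nat.card (CommGroup.torsion ℤ_[p]ˣ) = 1 := congrArg Subtype.val h1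
  obtain ⟨c, hc⟩ := hm.2.symm.dvd
  rw [card_torsion_eq] at hc
  have h3 : m = 1 + (Nat.card (CommGroup.torsion ℤ_[p]ˣ) : ℤ) * c := by linarith
  rw [h3, zpow_add, zpow_one, zpow_mul, zpow_natCast, h2, one_zpow, mul_one]

/-- The points `1 - w_p (t + 1)` of `D(p)`. -/
noncomputable def domainPoint (t : ℤ_[p]) : domain p :=
  ⟨1 - (Nat.card (CommGroup.torsion ℚ_[p]ˣ) : ℕ) * (t + 1), by
    obtain ⟨c, hc⟩ := two_dvd_card_torsion (p := p)
    exact ⟨-(c * (t + 1)), by rw [hc]; push_cast; ring⟩⟩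

/-- The naturals are dense in ℤ_p, and t ↦ 1 - w_p(t + 1) maps ℤ_p continuously onto D(p). The shift
t + 1 makes the images of naturals nonpositive integers. -/
theorem denseRange_domainPoint : DenseRange fun n : ℕ => domainPoint (n : ℤ_[p]) := by
  refine DenseRange.comp (g := domainPoint) (Function.Surjective.denseRange ?_)
    PadicInt.denseRange_natCast ?_
  · rintro ⟨_, t, rfl⟩
    obtain ⟨c, hc⟩ := card_torsion_dvd_two (p := p)
    refine ⟨-(c * t) - 1, Subtype.ext ?_⟩
    change 1 - _ * (-(c * t) - 1 + 1) = 1 + 2 * t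
    rw [hc]
    ring
  · refine Continuous.subtype_mk ?_ _
    fun_prop

theorem domainPoint_natCast (n : ℕ) : ∃ m ∈ interpSet p,
    (domainPoint (n : ℤ_[p]) : ℤ_[p]) = (m : ℤ_[p]) := by
  refine ⟨1 - (Nat.card (CommGroup.torsion ℚ_[p]ˣ) : ℤ) * (n + 1), ⟨?_, ?_⟩, ?_⟩
  · have := card_torsion_pos (p := p)
    have h1 : (1 : ℤ) ≤ Nat.card (CommGroup.torsion ℚ_[p]ˣ) := by exact_mod_cast this
    nlinarith
  · rw [Int.modEq_iff_dvd]
    exact ⟨n + 1, by ring⟩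
  · simp [domainPoint]

theorem IsInterpolation.unique {j : QBar →+* ℂ_[p]} {D : ℂ → ℂ} {F F' : domain p → ℂ_[p]}
    (h : IsInterpolation j D F) (h' : IsInterpolation j D F') : F = F' := by
  refine denseRange_domainPoint.equalizer h.1 h'.1 (funext fun n => ?_)
  obtain ⟨m, hm, hs⟩ := domainPoint_natCast (p := p) n
  obtain ⟨x, hx, hF⟩ := h.2 _ m hm hs
  obtain ⟨y, hy, hF'⟩ := h'.2 _ m hm hs
  simp only [Function.comp_apply]
  rw [hF, hF', Subtype.ext (hx.unique hy)]

theorem interpolation_eq {j : QBar →+* ℂ_[p]} {D : ℂ → ℂ} {F : domain p → ℂ_[p]}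
    (h : IsInterpolation j D F) : interpolation j D = F :=
  (Classical.epsilon_spec (p := IsInterpolation j D) ⟨F, h⟩).unique h

end Torsion

/-! ### The kernel ω(y)⁻¹⟨y⟩^(-s) and its continuity -/

section Kernel

variable {p : ℕ} [Fact p.Prime]

theorem norm_sub_one_le {y : ℤ_[p]} (hy : (p : ℤ_[p]) ∣ y - 1) : ‖y - 1‖ ≤ (p : ℝ)⁻¹ := by
  obtain ⟨c, hc⟩ := hy
  rw [hc, norm_mul, PadicInt.norm_p]
  exact mul_le_of_le_one_right (by positivity) (PadicInt.norm_le_one _)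

theorem summable_inv_pow : Summable fun n : ℕ => ((p : ℝ)⁻¹) ^ n :=
  summable_geometric_of_lt_one (by positivity)
    (inv_lt_one_of_one_lt₀ (by exact_mod_cast (Fact.out : p.Prime).one_lt))

/-- Uniform convergence: binomial coefficients lie in ℤ_p and |g - 1| ≤ 1/p, so p^(-n) is a
majorant. -/
theorem continuous_onePow_comp {X : Type*} [TopologicalSpace X] {g h : X → ℤ_[p]}
    (hg : Continuous g) (hh : Continuous h) (hg1 : ∀ x, (p : ℤ_[p]) ∣ g x - 1) :
    Continuous fun x => onePow (g x) (h x) := by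
  refine continuous_tsum (u := fun n : ℕ => ((p : ℝ)⁻¹) ^ n) (fun n => ?_) summable_inv_pow
    fun n x => ?_
  · exact ((PadicInt.continuous_choose n).comp hh).mul ((hg.sub continuous_const).pow n)
  · rw [norm_mul, norm_pow]
    refine (mul_le_of_le_one_left (by positivity) (PadicInt.norm_le_one _)).trans ?_
    gcongr
    exact norm_sub_one_le (hg1 x)

theorem onePow_natCast (y : ℤ_[p]) (n : ℕ) : onePow y n = y ^ n := by
  unfold onePow
  rw [tsum_eq_sum (s := Finset.range (n + 1))]
  · have h := add_pow (y - 1) 1 n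
    rw [sub_add_cancel] at h
    rw [h]
    refine Finset.sum_congr rfl fun i _ => ?_
    rw [Ring.choose_natCast, one_pow, mul_one, mul_comm]
  · intro i hi
    rw [Finset.mem_range, not_lt] at hi
    rw [Ring.choose_natCast, Nat.choose_eq_zero_of_lt (by omega), Nat.cast_zero, zero_mul]

/-- Both sides are continuous in (s, t) and agree at natural numbers. -/
theorem onePow_add {y : ℤ_[p]} (hy : (p : ℤ_[p]) ∣ y - 1) (s t : ℤ_[p]) :
    onePow y (s + t) = onePow y s * onePow y t := by
  have h := (PadicInt.denseRange_natCast (p := p)).prodMap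
    (PadicInt.denseRange_natCast (p := p))
  have h1 : Continuous fun q : ℤ_[p] × ℤ_[p] => onePow y (q.1 + q.2) :=
    continuous_onePow_comp continuous_const (continuous_fst.add continuous_snd) fun _ => hy
  have h2 : Continuous fun q : ℤ_[p] × ℤ_[p] => onePow y q.1 * onePow y q.2 :=
    (continuous_onePow_comp continuous_const continuous_fst fun _ => hy).mul
      (continuous_onePow_comp continuous_const continuous_snd fun _ => hy)
  refine congrFun (h.equalizer h1 h2 (funext fun q => ?_)) (s, t)
  simp only [Function.comp_apply, Prod.map]
  rw [← Nat.cast_add, onePow_natCast, onePow_natCast, onePow_natCast, pow_add]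

theorem onePow_zero (y : ℤ_[p]) : onePow y 0 = 1 := by
  have := onePow_natCast y 0
  rwa [Nat.cast_zero, pow_zero] at this

theorem onePow_one (y : ℤ_[p]) : onePow y 1 = y := by
  have := onePow_natCast y 1
  rwa [Nat.cast_one, pow_one] at this

theorem onePow_neg_mul {y : ℤ_[p]} (hy : (p : ℤ_[p]) ∣ y - 1) (s : ℤ_[p]) :
    onePow y (-s) * onePow y s = 1 := by
  rw [← onePow_add hy, neg_add_cancel, onePow_zero]

theorem onePow_intCast_of_unit {u : ℤ_[p]ˣ} (hu : (p : ℤ_[p]) ∣ (u : ℤ_[p]) - 1) (m : ℤ) :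
    onePow (u : ℤ_[p]) m = ((u ^ m : ℤ_[p]ˣ) : ℤ_[p]) := by
  obtain ⟨n, rfl | rfl⟩ := m.eq_nat_or_neg
  · rw [Int.cast_natCast, onePow_natCast, zpow_natCast, Units.val_pow_eq_pow_val]
  · rw [Int.cast_neg, Int.cast_natCast, zpow_neg, zpow_natCast]
    have h := onePow_neg_mul hu (n : ℤ_[p])
    rw [onePow_natCast, ← Units.val_pow_eq_pow_val] at h
    exact (Units.inv_eq_of_mul_eq_one_left h).symm

theorem isOfFinOrder_teichmuller (x : ℤ_[p]ˣ) : IsOfFinOrder (teichmuller x) :=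
  (exists_teichmuller x).choose_spec.1

theorem dvd_angle_sub_one (x : ℤ_[p]ˣ) : (teichModulus p : ℤ_[p]) ∣ ((angle x : ℤ_[p]ˣ) : ℤ_[p]) - 1 :=
  (exists_teichmuller x).choose_spec.2

theorem prime_dvd_angle_sub_one (x : ℤ_[p]ˣ) : (p : ℤ_[p]) ∣ ((angle x : ℤ_[p]ˣ) : ℤ_[p]) - 1 :=
  prime_dvd_teichModulus.trans (dvd_angle_sub_one x)

theorem teichmuller_mul_angle (x : ℤ_[p]ˣ) : teichmuller x * angle x = x := mul_inv_cancel_left _ _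

theorem dvd_sub_teichmuller (x : ℤ_[p]ˣ) :
    (teichModulus p : ℤ_[p]) ∣ (x : ℤ_[p]) - (teichmuller x : ℤ_[p]) := by
  have h : (x : ℤ_[p]) - (teichmuller x : ℤ_[p]) =
      (teichmuller x : ℤ_[p]) * (((angle x : ℤ_[p]ˣ) : ℤ_[p]) - 1) := by
    rw [mul_sub, ← Units.val_mul, teichmuller_mul_angle, mul_one]
  rw [h]
  exact (dvd_angle_sub_one x).mul_left _

/-- The quotient of the two values is a root of unity congruent to 1, hence equal to 1. Thus ω is
locally constant, and continuity of the kernel follows. -/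
theorem teichmuller_congr {x y : ℤ_[p]ˣ} (h : (teichModulus p : ℤ_[p]) ∣ (x : ℤ_[p]) - y) :
    teichmuller x = teichmuller y := by
  rw [← mul_inv_eq_one]
  refine eq_one_of_isOfFinOrder ?_ ?_
  · exact (isOfFinOrder_teichmuller x).mul (isOfFinOrder_teichmuller y).inv
  · have h1 : ((teichmuller x * (teichmuller y)⁻¹ : ℤ_[p]ˣ) : ℤ_[p]) - 1 =
        (((teichmuller y)⁻¹ : ℤ_[p]ˣ) : ℤ_[p]) *
          ((x : ℤ_[p]) - y - ((x : ℤ_[p]) - teichmuller x) + ((y : ℤ_[p]) - teichmuller y)) := by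
      have := Units.inv_mul (teichmuller y)
      rw [Units.val_mul]
      linear_combination this
    rw [h1]
    exact ((h.sub (dvd_sub_teichmuller x)).add (dvd_sub_teichmuller y)).mul_left _

theorem eventually_dvd_sub (y : ℤ_[p]) : ∀ᶠ x in nhds y, (teichModulus p : ℤ_[p]) ∣ x - y := by
  have hdvd : (teichModulus p : ℤ_[p]) ∣ (p : ℤ_[p]) ^ 2 := by
    unfold teichModulus
    split_ifs with h
    · subst h; norm_num
    · exact dvd_pow_self _ two_ne_zero
  have hpos : (0 : ℝ) < (p : ℝ) ^ (-(2 : ℕ) : ℤ) :=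
    zpow_pos (by exact_mod_cast (Fact.out : p.Prime).pos) _
  filter_upwards [Metric.closedBall_mem_nhds y hpos] with x hx
  rw [Metric.mem_closedBall, dist_eq_norm, PadicInt.norm_le_pow_iff_mem_span_pow,
    Ideal.mem_span_singleton] at hx
  exact hdvd.trans hx

open Classical in
/-- The function `⟨y⟩` on units, extended by `1`. -/
noncomputable def angleExt (y : ℤ_[p]) : ℤ_[p] := if h : IsUnit y then (angle h.unit : ℤ_[p]ˣ) else 1

open Classical in
/-- The function `ω(y)⁻¹` on units, extended by `0`. -/
noncomputable def teichInvExt (y : ℤ_[p]) : ℤ_[p] :=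
  if h : IsUnit y then ((teichmuller h.unit)⁻¹ : ℤ_[p]ˣ) else 0

theorem isUnit_of_dvd_sub {x y : ℤ_[p]} (h : (p : ℤ_[p]) ∣ x - y) (hy : IsUnit y) : IsUnit x := by
  by_contra hx
  have hx' : (p : ℤ_[p]) ∣ x := by
    rw [← PadicInt.norm_lt_one_iff_dvd]
    exact PadicInt.mem_nonunits.1 hx
  have hy' : (p : ℤ_[p]) ∣ y := by
    have := dvd_sub hx' h
    rwa [sub_sub_cancel] at this
  exact PadicInt.prime_p.not_isUnit (isUnit_of_dvd_unit hy' hy)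

theorem isUnit_congr {x y : ℤ_[p]} (h : (p : ℤ_[p]) ∣ x - y) : IsUnit x ↔ IsUnit y :=
  ⟨isUnit_of_dvd_sub (by rwa [dvd_sub_comm]), isUnit_of_dvd_sub h⟩

theorem teichInvExt_congr {x y : ℤ_[p]} (h : (teichModulus p : ℤ_[p]) ∣ x - y) :
    teichInvExt x = teichInvExt y := by
  have hiff := isUnit_congr (prime_dvd_teichModulus.trans h)
  unfold teichInvExt
  by_cases hx : IsUnit x
  · have hy := hiff.1 hx
    rw [dif_pos hx, dif_pos hy, teichmuller_congr (x := hx.unit) (y := hy.unit) h]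
  · rw [dif_neg hx, dif_neg (fun hy => hx (hiff.2 hy))]

theorem continuous_teichInvExt : Continuous (teichInvExt (p := p)) := by
  rw [continuous_iff_continuousAt]
  intro y
  refine (continuousAt_const (y := teichInvExt y)).congr ?_
  filter_upwards [eventually_dvd_sub y] with x hx
  exact (teichInvExt_congr hx).symm

theorem angleExt_of_isUnit {y : ℤ_[p]} (h : IsUnit y) : angleExt y = teichInvExt y * y := by
  rw [angleExt, teichInvExt, dif_pos h, dif_pos h, angle, Units.val_mul, IsUnit.unit_spec]

theorem continuous_angleExt : Continuous (angleExt (p := p)) := by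
  rw [continuous_iff_continuousAt]
  intro y
  by_cases hy : IsUnit y
  · refine (continuous_teichInvExt.mul continuous_id).continuousAt.congr ?_
    filter_upwards [eventually_dvd_sub y] with x hx
    exact (angleExt_of_isUnit (isUnit_of_dvd_sub (prime_dvd_teichModulus.trans hx) hy)).symm
  · refine (continuousAt_const (y := (1 : ℤ_[p]))).congr ?_
    filter_upwards [eventually_dvd_sub y] with x hx
    rw [angleExt, dif_neg]
    rwa [isUnit_congr (prime_dvd_teichModulus.trans hx)]

theorem prime_dvd_angleExt_sub_one (y : ℤ_[p]) : (p : ℤ_[p]) ∣ angleExt y - 1 := by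
  unfold angleExt
  split_ifs with h
  · exact prime_dvd_angle_sub_one _
  · rw [sub_self]; exact dvd_zero _

/-- The function `ω(y)⁻¹ ⟨y⟩ ^ (-s)` of `s` and `y`, extended by `0` to the non-units `y`. -/
noncomputable def padicKernel (s y : ℤ_[p]) : ℤ_[p] := teichInvExt y * onePow (angleExt y) (-s)

theorem continuous_padicKernel {X : Type*} [TopologicalSpace X] {f g : X → ℤ_[p]}
    (hf : Continuous f) (hg : Continuous g) : Continuous fun x => padicKernel (f x) (g x) :=
  (continuous_teichInvExt.comp hg).mul
    (continuous_onePow_comp (continuous_angleExt.comp hg) hf.neg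
      fun _ => prime_dvd_angleExt_sub_one _)

theorem padicKernel_of_not_isUnit (s : ℤ_[p]) {y : ℤ_[p]} (hy : ¬ IsUnit y) :
    padicKernel s y = 0 := by
  rw [padicKernel, teichInvExt, dif_neg hy, zero_mul]

theorem padicKernel_of_isUnit (s : ℤ_[p]) (y : ℤ_[p]ˣ) :
    padicKernel s y = ((teichmuller y)⁻¹ : ℤ_[p]ˣ) * onePow (angle y : ℤ_[p]ˣ) (-s) := by
  rw [padicKernel, teichInvExt, angleExt, dif_pos y.isUnit, dif_pos y.isUnit, IsUnit.unit_of_val_units]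

theorem padicKernel_one_mul (y : ℤ_[p]ˣ) : padicKernel 1 (y : ℤ_[p]) * y = 1 := by
  rw [padicKernel_of_isUnit]
  have h := onePow_neg_mul (prime_dvd_angle_sub_one y) 1
  rw [onePow_one] at h
  have h2 : (y : ℤ_[p]) = teichmuller y * (angle y : ℤ_[p]ˣ) := by
    rw [← Units.val_mul, teichmuller_mul_angle]
  have h3 := Units.inv_mul (teichmuller y)
  linear_combination (((teichmuller y)⁻¹ : ℤ_[p]ˣ) : ℤ_[p]) * onePow (angle y : ℤ_[p]ˣ) (-1) * h2 +
    onePow (angle y : ℤ_[p]ˣ) (-1) * (angle y : ℤ_[p]ˣ) * h3 + h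

/-- For -n in M(p) one has ω(y)^(-n) = ω(y), so ω(y)⁻¹⟨y⟩^n = (ω(y)⟨y⟩)^n. This is why interpolation
is restricted to M(p). -/
theorem padicKernel_neg_natCast {n : ℕ} (hn : (-(n : ℤ)) ∈ interpSet p) (y : ℤ_[p]ˣ) :
    padicKernel (-(n : ℤ_[p])) (y : ℤ_[p]) = (y : ℤ_[p]) ^ n := by
  rw [padicKernel_of_isUnit, neg_neg, onePow_natCast]
  have h := zpow_eq_one_of_mem_interpSet (isOfFinOrder_teichmuller y) hn
  rw [zpow_neg, zpow_natCast, inv_eq_iff_eq_inv] at h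
  rw [← h, ← Units.val_pow_eq_pow_val, ← Units.val_mul, ← mul_pow, teichmuller_mul_angle,
    Units.val_pow_eq_pow_val]

theorem teichmuller_mul_onePow {m : ℤ} (hm : m ∈ interpSet p) (N : ℤ_[p]ˣ) :
    (teichmuller N : ℤ_[p]) * onePow (angle N : ℤ_[p]ˣ) m = ((N ^ m : ℤ_[p]ˣ) : ℤ_[p]) := by
  rw [onePow_intCast_of_unit (prime_dvd_angle_sub_one N), ← Units.val_mul]
  congr 1
  nth_rewrite 1 [← zpow_eq_one_of_mem_interpSet (isOfFinOrder_teichmuller N) hm]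
  rw [← mul_zpow, teichmuller_mul_angle]

end Kernel

/-! ### The regularised sum ∑ z^m φ(m) as a functional on C(ℤ_p, K) -/

section Functional

variable {p : ℕ} [Fact p.Prime] {K : Type*} [NontriviallyNormedField K] [CompleteSpace K]
  [IsUltrametricDist K] [Module ℤ_[p] K] [IsBoundedSMul ℤ_[p] K]

set_option linter.unusedSectionVars false

theorem norm_abelWeight_le {z : K} (hz : ‖z‖ ≤ 1) (hz1 : ‖1 - z‖ = 1) (k : ℕ) :
    ‖abelWeight z k‖ ≤ 1 := by
  rw [abelWeight, norm_div, norm_pow, norm_pow, hz1, one_pow, div_one]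
  exact pow_le_one₀ (norm_nonneg _) hz

/-- The weights have norm at most 1, and by Mahler's theorem the differences at 0 of a continuous
function tend to 0; that suffices in a complete ultrametric field. -/
theorem summable_abelWeight {z : K} (hz : ‖z‖ ≤ 1) (hz1 : ‖1 - z‖ = 1) (φ : C(ℤ_[p], K)) :
    Summable fun k => abelWeight z k * Δ_[1] ^[k] (φ : ℤ_[p] → K) 0 := by
  refine NonarchimedeanAddGroup.summable_of_tendsto_cofinite_zero ?_
  rw [Nat.cofinite_eq_atTop]
  refine squeeze_zero_norm (fun k => ?_) (tendsto_zero_iff_norm_tendsto_zero.1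
    (PadicInt.fwdDiff_tendsto_zero φ))
  rw [norm_mul]
  exact mul_le_of_le_one_left (norm_nonneg _) (norm_abelWeight_le hz hz1 k)

/-- The linear functional on `C(ℤ_p, K)` which extends the Abel summation of `∑ z ^ m φ(m)`. -/
noncomputable def abelFunctional (z : K) (hz : ‖z‖ ≤ 1) (hz1 : ‖1 - z‖ = 1) : C(ℤ_[p], K) →L[K] K :=
  LinearMap.mkContinuous
    { toFun := fun φ => ∑' k, abelWeight z k * Δ_[1] ^[k] (φ : ℤ_[p] → K) 0
      map_add' := fun φ ψ => by
        rw [← (summable_abelWeight hz hz1 φ).tsum_add (summable_abelWeight hz hz1 ψ)]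
        refine tsum_congr fun k => ?_
        rw [ContinuousMap.coe_add, fwdDiff_iter_add, Pi.add_apply, mul_add]
      map_smul' := fun c φ => by
        rw [RingHom.id_apply, smul_eq_mul, ← tsum_mul_left]
        refine tsum_congr fun k => ?_
        rw [ContinuousMap.coe_smul, fwdDiff_iter_const_smul, Pi.smul_apply, smul_eq_mul]
        ring } 1 fun φ => by
    rw [one_mul]
    have h := (summable_abelWeight hz hz1 φ).hasSum
    refine le_of_tendsto h.norm (Filter.Eventually.of_forall fun s => ?_)
    refine IsUltrametricDist.norm_sum_le_of_forall_le_of_nonneg (norm_nonneg _) fun k _ => ?_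
    rw [norm_mul]
    refine (mul_le_of_le_one_left (norm_nonneg _) (norm_abelWeight_le hz hz1 k)).trans ?_
    exact IsUltrametricDist.norm_fwdDiff_iter_apply_le 1 φ 0 k

theorem abelFunctional_apply {z : K} (hz : ‖z‖ ≤ 1) (hz1 : ‖1 - z‖ = 1) (φ : C(ℤ_[p], K)) :
    abelFunctional z hz hz1 φ = ∑' k, abelWeight z k * Δ_[1] ^[k] (φ : ℤ_[p] → K) 0 := rfl

/-- Precomposition with a continuous map, as a continuous linear map. -/
noncomputable def precomp {X Y : Type*} [TopologicalSpace X] [CompactSpace X] [TopologicalSpace Y]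
    [CompactSpace Y] (g : C(X, Y)) : C(Y, K) →L[K] C(X, K) :=
  LinearMap.mkContinuous
    { toFun := fun φ => φ.comp g
      map_add' := fun _ _ => rfl
      map_smul' := fun _ _ => rfl } 1 fun φ => by
    rw [one_mul, ContinuousMap.norm_le _ (norm_nonneg _)]
    exact fun x => φ.norm_coe_le_norm (g x)

theorem precomp_apply {X Y : Type*} [TopologicalSpace X] [CompactSpace X] [TopologicalSpace Y]
    [CompactSpace Y] (g : C(X, Y)) (φ : C(Y, K)) : precomp g φ = φ.comp g := rfl

/-- The map `a ↦ b + c a` on `ℤ_p`. -/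
noncomputable def affineMap (b c : ℤ_[p]) : C(ℤ_[p], ℤ_[p]) := ⟨fun a => b + c * a, by fun_prop⟩

theorem affineMap_apply (b c a : ℤ_[p]) : affineMap b c a = b + c * a := rfl

/-- The recursion satisfied formally by ∑ z^m φ(m). It comes from z · weight(k) = (1 - z) · weight(k
+ 1), the shift being 1 + Δ. -/
theorem abelFunctional_shift {z : K} (hz : ‖z‖ ≤ 1) (hz1 : ‖1 - z‖ = 1) (φ : C(ℤ_[p], K)) :
    abelFunctional z hz hz1 φ =
      φ 0 + z * abelFunctional z hz hz1 (φ.comp (affineMap 1 1)) := by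
  have hne : (1 : K) - z ≠ 0 := fun h => by rw [h, norm_zero] at hz1; exact zero_ne_one hz1
  have hS := summable_abelWeight hz hz1 φ
  have hstep : ∀ k, z * (abelWeight z k * Δ_[1] ^[k] (φ.comp (affineMap 1 1) : ℤ_[p] → K) 0) =
      z * (abelWeight z k * Δ_[1] ^[k] (φ : ℤ_[p] → K) 0) +
        (1 - z) * (abelWeight z (k + 1) * Δ_[1] ^[k + 1] (φ : ℤ_[p] → K) 0) := by
    intro k
    have h1 : Δ_[1] ^[k] (φ.comp (affineMap 1 1) : ℤ_[p] → K) 0 =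
        Δ_[1] ^[k] (φ : ℤ_[p] → K) 0 + Δ_[1] ^[k + 1] (φ : ℤ_[p] → K) 0 := by
      have h2 : Δ_[1] ^[k + 1] (φ : ℤ_[p] → K) 0 =
          Δ_[1] ^[k] (φ : ℤ_[p] → K) 1 - Δ_[1] ^[k] (φ : ℤ_[p] → K) 0 := by
        rw [Function.iterate_succ_apply', fwdDiff, zero_add]
      rw [h2, add_sub_cancel, fwdDiff_iter_eq_sum_shift, fwdDiff_iter_eq_sum_shift]
      refine Finset.sum_congr rfl fun i _ => ?_
      simp only [ContinuousMap.comp_apply, affineMap_apply, one_mul, zero_add]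
    have h3 : z * abelWeight z k = (1 - z) * abelWeight z (k + 1) := by
      unfold abelWeight
      field_simp
      ring
    rw [h1, mul_add, mul_add, ← mul_assoc z _ (Δ_[1] ^[k + 1] _ _), h3, mul_assoc]
  have hS1 : Summable fun k => abelWeight z (k + 1) * Δ_[1] ^[k + 1] (φ : ℤ_[p] → K) 0 :=
    (summable_nat_add_iff 1).2 hS
  rw [abelFunctional_apply, abelFunctional_apply, ← tsum_mul_left, tsum_congr hstep,
    (hS.mul_left z).tsum_add (hS1.mul_left (1 - z)), tsum_mul_left, tsum_mul_left,
    hS.tsum_eq_zero_add]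
  have h0 : (1 - z) * abelWeight z 0 = 1 := by
    unfold abelWeight
    rw [pow_zero, zero_add, pow_one, mul_one_div_cancel hne]
  have h4 : Δ_[1] ^[0] (φ : ℤ_[p] → K) 0 = φ 0 := rfl
  rw [h4]
  linear_combination φ 0 * h0

/-- A functional `F` with `F(φ) = z F(φ(· + 1))` vanishes. -/
theorem eq_zero_of_shift {z : K} (hz : z ≠ 1) (F : C(ℤ_[p], K) →L[K] K)
    (h : ∀ φ, F φ = z * F (φ.comp (affineMap 1 1))) : F = 0 := by
  -- Pascal's rule and induction give (1 - z)F = 0 on each binomial polynomial; Mahler expansions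
  -- then give F = 0.
  have hterm : ∀ n (a : K), F (PadicInt.mahlerTerm a n) = 0 := by
    have h1z : (1 : K) - z ≠ 0 := sub_ne_zero.2 hz.symm
    intro n
    induction n with
    | zero =>
      intro a
      have h1 := h (PadicInt.mahlerTerm a 0)
      have h2 : (PadicInt.mahlerTerm a 0).comp (affineMap (p := p) 1 1) = PadicInt.mahlerTerm a 0 := by
        ext x
        simp [PadicInt.mahlerTerm_apply, mahler_apply]
      rw [h2] at h1
      have : (1 - z) * F (PadicInt.mahlerTerm a 0) = 0 := by linear_combination h1
      exact (mul_eq_zero.1 this).resolve_left h1z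
    | succ n ih =>
      intro a
      have h1 := h (PadicInt.mahlerTerm a (n + 1))
      have h2 : (PadicInt.mahlerTerm a (n + 1)).comp (affineMap (p := p) 1 1) =
          PadicInt.mahlerTerm a n + PadicInt.mahlerTerm a (n + 1) := by
        ext x
        rw [ContinuousMap.add_apply, ContinuousMap.comp_apply, PadicInt.mahlerTerm_apply,
          PadicInt.mahlerTerm_apply, PadicInt.mahlerTerm_apply, mahler_apply,
          mahler_apply, mahler_apply, affineMap_apply, one_mul, add_comm 1 x,
          Ring.choose_succ_succ, add_smul]
      rw [h2, map_add, ih, zero_add] at h1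
      have : (1 - z) * F (PadicInt.mahlerTerm a (n + 1)) = 0 := by linear_combination h1
      exact (mul_eq_zero.1 this).resolve_left h1z
  ext φ
  have h1 := (PadicInt.hasSum_mahler φ).mapL F
  simp only [hterm] at h1
  exact h1.unique hasSum_zero

/-- Formally, ∑ z^m φ(m) sorted by m modulo p. Both sides satisfy the same shift recursion, so their
difference satisfies the homogeneous one and vanishes by `eq_zero_of_shift`. -/
theorem abelFunctional_residue {z : K} (hz : ‖z‖ ≤ 1) (hz1 : ‖1 - z‖ = 1) (hzp : ‖z ^ p‖ ≤ 1)
    (hzp1 : ‖1 - z ^ p‖ = 1) (φ : C(ℤ_[p], K)) :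
    abelFunctional z hz hz1 φ =
      ∑ i : Fin p, z ^ (i : ℕ) * abelFunctional (z ^ p) hzp hzp1 (φ.comp (affineMap (i : ℕ) p)) := by
  let F : C(ℤ_[p], K) →L[K] K := abelFunctional z hz hz1 -
    ∑ i : Fin p, z ^ (i : ℕ) • (abelFunctional (z ^ p) hzp hzp1).comp (precomp (affineMap (i : ℕ) p))
  have hF : ∀ φ, F φ = abelFunctional z hz hz1 φ -
      ∑ i : Fin p, z ^ (i : ℕ) * abelFunctional (z ^ p) hzp hzp1 (φ.comp (affineMap (i : ℕ) p)) := by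
    intro φ
    simp only [F, sub_apply, sum_apply,
      smul_apply, ContinuousLinearMap.comp_apply, precomp_apply, smul_eq_mul]
  have hne : z ≠ 1 := fun h => by rw [h, sub_self, norm_zero] at hz1; exact zero_ne_one hz1
  have h0 : F = 0 := by
    refine eq_zero_of_shift hne F fun φ => ?_
    rw [hF, hF, abelFunctional_shift hz hz1 φ]
    let u : ℕ → K := fun i =>
      z ^ i * abelFunctional (z ^ p) hzp hzp1 (φ.comp (affineMap (i : ℤ_[p]) p))
    have hu : ∀ i : ℕ, z * (z ^ i * abelFunctional (z ^ p) hzp hzp1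
        ((φ.comp (affineMap 1 1)).comp (affineMap (i : ℤ_[p]) p))) = u (i + 1) := by
      intro i
      have : (φ.comp (affineMap 1 1)).comp (affineMap (i : ℤ_[p]) p) =
          φ.comp (affineMap ((i + 1 : ℕ) : ℤ_[p]) p) := by
        ext a
        simp only [ContinuousMap.comp_apply, affineMap_apply]
        congr 1
        push_cast
        ring
      rw [this, ← mul_assoc, ← pow_succ']
    have h1 : ∑ i : Fin p, z ^ (i : ℕ) *
        abelFunctional (z ^ p) hzp hzp1 (φ.comp (affineMap (i : ℕ) p)) =
          ∑ i ∈ Finset.range p, u i := Fin.sum_univ_eq_sum_range u p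
    rw [mul_sub, Finset.mul_sum]
    simp only [hu]
    rw [h1, Fin.sum_univ_eq_sum_range (fun i => u (i + 1)) p]
    have h2 := Finset.sum_range_succ u p
    rw [Finset.sum_range_succ'] at h2
    -- Shifting by one moves the class i to i + 1; the class p is the class 0 without its first term
    -- φ(0).
    have h3 : u 0 = φ 0 + u p := by
      simp only [u, pow_zero, one_mul]
      rw [abelFunctional_shift hzp hzp1]
      congr 1
      · simp [affineMap_apply]
      · congr 2
        ext a
        simp only [ContinuousMap.comp_apply, affineMap_apply]
        congr 1
        push_cast
        ring
    linear_combination h2 - h3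
  have := hF φ
  rw [h0, zero_apply] at this
  exact (sub_eq_zero.1 this.symm)

/-- The bridge to the complex values: on functions polynomial along ℕ the functional is the finite
sum found by complex continuation. -/
theorem abelFunctional_eq_abelSum {z : K} (hz : ‖z‖ ≤ 1) (hz1 : ‖1 - z‖ = 1) (φ : C(ℤ_[p], K))
    (N : ℕ) (h : ∀ k, N ≤ k → Δ_[1] ^[k] (fun a : ℕ => φ a) 0 = 0) :
    abelFunctional z hz hz1 φ = abelSum z N fun a => φ a := by
  have hcast : ∀ k, Δ_[1] ^[k] (φ : ℤ_[p] → K) 0 = Δ_[1] ^[k] (fun a : ℕ => φ a) 0 := by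
    intro k
    rw [fwdDiff_iter_comp_natCast, Nat.cast_zero]
  rw [abelFunctional_apply, tsum_eq_sum (s := Finset.range N), abelSum]
  · exact Finset.sum_congr rfl fun k _ => by rw [hcast]
  · intro k hk
    rw [Finset.mem_range, not_lt] at hk
    rw [hcast, h k hk, mul_zero]

theorem abelFunctional_mem {z : K} (hz : ‖z‖ ≤ 1) (hz1 : ‖1 - z‖ = 1) (φ : C(ℤ_[p], K))
    {S : Subring K} (hS : IsClosed (S : Set K)) (hzS : z ∈ S) (hzS' : (1 - z)⁻¹ ∈ S)
    (hφ : ∀ a : ℕ, φ a ∈ S) : abelFunctional z hz hz1 φ ∈ S := by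
  have h := (summable_abelWeight hz hz1 φ).hasSum
  rw [← abelFunctional_apply hz hz1] at h
  refine hS.mem_of_tendsto h (Filter.Eventually.of_forall fun s => ?_)
  refine S.sum_mem fun k _ => S.mul_mem ?_ ?_
  · rw [abelWeight, div_eq_mul_inv, ← inv_pow]
    exact S.mul_mem (S.pow_mem hzS k) (S.pow_mem hzS' _)
  · rw [fwdDiff_iter_eq_sum_shift]
    refine S.sum_mem fun i _ => S.zsmul_mem ?_ _
    have := hφ i
    rwa [zero_add, nsmul_eq_mul, mul_one]

end Functional

/-! ### The functional in two variables -/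

section Functional2

variable {p : ℕ} [Fact p.Prime] {K : Type*} [NontriviallyNormedField K] [CompleteSpace K]
  [IsUltrametricDist K] [Module ℤ_[p] K] [IsBoundedSMul ℤ_[p] K]

set_option linter.unusedSectionVars false

/-- The partial functional `φ ↦ (a ↦ F (φ(a, ·)))`. -/
noncomputable def partialFunctional (F : C(ℤ_[p], K) →L[K] K) :
    C(ℤ_[p] × ℤ_[p], K) →L[K] C(ℤ_[p], K) :=
  LinearMap.mkContinuous
    { toFun := fun φ => ⟨fun a => F (φ.curry a), F.continuous.comp φ.curry.continuous⟩
      map_add' := fun φ ψ => by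
        ext a
        exact F.map_add (φ.curry a) (ψ.curry a)
      map_smul' := fun c φ => by
        ext a
        exact F.map_smul c (φ.curry a) } ‖F‖ fun φ => by
    rw [ContinuousMap.norm_le _ (by positivity)]
    intro a
    refine (F.le_opNorm (φ.curry a)).trans (mul_le_mul_of_nonneg_left ?_ (norm_nonneg _))
    rw [ContinuousMap.norm_le _ (norm_nonneg _)]
    exact fun b => φ.norm_coe_le_norm (a, b)

theorem partialFunctional_apply (F : C(ℤ_[p], K) →L[K] K) (φ : C(ℤ_[p] × ℤ_[p], K)) (a : ℤ_[p]) :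
    partialFunctional F φ a = F (φ.curry a) := rfl

/-- The data of two elements `z, w` with `‖z‖, ‖w‖ ≤ 1` and `‖1 - z‖ = ‖1 - w‖ = 1`. -/
structure AbelPair (z w : K) : Prop where
  fst_le : ‖z‖ ≤ 1
  fst_eq : ‖1 - z‖ = 1
  snd_le : ‖w‖ ≤ 1
  snd_eq : ‖1 - w‖ = 1

variable {z w : K}

/-- The linear functional on `C(ℤ_p × ℤ_p, K)` which extends the Abel summation of
`∑ z ^ m w ^ n φ(m, n)`. -/
noncomputable def abelFunctional₂ (h : AbelPair z w) : C(ℤ_[p] × ℤ_[p], K) →L[K] K :=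
  (abelFunctional z h.fst_le h.fst_eq).comp
    (partialFunctional (abelFunctional w h.snd_le h.snd_eq))

theorem abelFunctional₂_apply (h : AbelPair z w) (φ : C(ℤ_[p] × ℤ_[p], K)) :
    abelFunctional₂ h φ = abelFunctional z h.fst_le h.fst_eq
      (partialFunctional (abelFunctional w h.snd_le h.snd_eq) φ) := rfl

/-- The map `(a, b) ↦ (u + c a, v + d b)` on `ℤ_p × ℤ_p`. -/
noncomputable def affineMap₂ (u c v d : ℤ_[p]) : C(ℤ_[p] × ℤ_[p], ℤ_[p] × ℤ_[p]) :=
  (affineMap u c).prodMap (affineMap v d)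

theorem affineMap₂_apply (u c v d a b : ℤ_[p]) :
    affineMap₂ u c v d (a, b) = (u + c * a, v + d * b) := rfl

theorem partialFunctional_comp (F : C(ℤ_[p], K) →L[K] K) (φ : C(ℤ_[p] × ℤ_[p], K))
    (u c v d : ℤ_[p]) : partialFunctional F (φ.comp (affineMap₂ u c v d)) =
      (partialFunctional F (φ.comp (affineMap₂ 0 1 v d))).comp (affineMap u c) := by
  ext a
  rw [ContinuousMap.comp_apply, partialFunctional_apply, partialFunctional_apply]
  congr 1
  ext b
  simp only [ContinuousMap.curry_apply, ContinuousMap.comp_apply, affineMap₂_apply, affineMap_apply,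
    zero_add, one_mul]

theorem partialFunctional_comp_curry (F : C(ℤ_[p], K) →L[K] K) (φ : C(ℤ_[p] × ℤ_[p], K))
    (v d : ℤ_[p]) (a : ℤ_[p]) : partialFunctional F (φ.comp (affineMap₂ 0 1 v d)) a =
      F ((φ.curry a).comp (affineMap v d)) := by
  rw [partialFunctional_apply]
  congr 1
  ext b
  simp only [ContinuousMap.curry_apply, ContinuousMap.comp_apply, affineMap₂_apply, affineMap_apply,
    zero_add, one_mul]

theorem comp_affineMap₂_id (φ : C(ℤ_[p] × ℤ_[p], K)) : φ.comp (affineMap₂ 0 1 0 1) = φ := by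
  ext ⟨a, b⟩
  simp only [ContinuousMap.comp_apply, affineMap₂_apply, zero_add, one_mul]

/-- The relation (1 - zS₁)(1 - wS₂)L = evaluation at the origin, S₁ and S₂ being the two shifts. It
mirrors the denominator of the Shintani series. -/
theorem abelFunctional₂_shift (h : AbelPair z w) (φ : C(ℤ_[p] × ℤ_[p], K)) :
    φ (0, 0) = abelFunctional₂ h φ - z * abelFunctional₂ h (φ.comp (affineMap₂ 1 1 0 1)) -
      w * abelFunctional₂ h (φ.comp (affineMap₂ 0 1 1 1)) +
        z * w * abelFunctional₂ h (φ.comp (affineMap₂ 1 1 1 1)) := by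
  have h1 : ∀ ψ : C(ℤ_[p] × ℤ_[p], K), abelFunctional₂ h ψ -
      z * abelFunctional₂ h (ψ.comp (affineMap₂ 1 1 0 1)) =
        abelFunctional w h.snd_le h.snd_eq (ψ.curry 0) := by
    intro ψ
    rw [abelFunctional₂_apply, abelFunctional_shift h.fst_le h.fst_eq, abelFunctional₂_apply,
      partialFunctional_comp, comp_affineMap₂_id, add_sub_cancel_right, partialFunctional_apply]
  have h2 := h1 φ
  have h3 := h1 (φ.comp (affineMap₂ 0 1 1 1))
  have h4 : (φ.comp (affineMap₂ 0 1 1 1)).comp (affineMap₂ 1 1 0 1) =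
      φ.comp (affineMap₂ 1 1 1 1) := by
    ext ⟨a, b⟩
    simp only [ContinuousMap.comp_apply, affineMap₂_apply, zero_add, one_mul]
  have h5 : (φ.comp (affineMap₂ 0 1 1 1)).curry 0 = (φ.curry 0).comp (affineMap 1 1) := by
    ext b
    simp only [ContinuousMap.curry_apply, ContinuousMap.comp_apply, affineMap₂_apply,
      affineMap_apply, zero_add, one_mul]
  rw [h4, h5] at h3
  have h6 := abelFunctional_shift h.snd_le h.snd_eq (φ.curry 0)
  rw [ContinuousMap.curry_apply] at h6
  linear_combination h2 * (-1) + w * h3 - h6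

/-- Whether the norm is a unit depends only on the residues modulo p, so this cuts the functional as
the complex series was cut. -/
theorem abelFunctional₂_residue (h : AbelPair z w) (h' : AbelPair (z ^ p) (w ^ p))
    (φ : C(ℤ_[p] × ℤ_[p], K)) :
    abelFunctional₂ h φ = ∑ t : Fin p × Fin p, z ^ (t.1 : ℕ) * w ^ (t.2 : ℕ) *
      abelFunctional₂ h' (φ.comp (affineMap₂ (t.1 : ℕ) p (t.2 : ℕ) p)) := by
  have h1 : partialFunctional (abelFunctional w h.snd_le h.snd_eq) φ =
      ∑ i : Fin p, w ^ (i : ℕ) • partialFunctional (abelFunctional (w ^ p) h'.snd_le h'.snd_eq)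
        (φ.comp (affineMap₂ 0 1 (i : ℕ) p)) := by
    ext a
    rw [partialFunctional_apply, abelFunctional_residue h.snd_le h.snd_eq h'.snd_le h'.snd_eq,
      ContinuousMap.sum_apply]
    refine Finset.sum_congr rfl fun i _ => ?_
    rw [ContinuousMap.smul_apply, partialFunctional_comp_curry, smul_eq_mul]
  rw [abelFunctional₂_apply, h1, map_sum, Fintype.sum_prod_type_right]
  refine Finset.sum_congr rfl fun l _ => ?_
  rw [map_smul, abelFunctional_residue h.fst_le h.fst_eq h'.fst_le h'.fst_eq, smul_eq_mul,
    Finset.mul_sum]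
  refine Finset.sum_congr rfl fun i _ => ?_
  rw [abelFunctional₂_apply, partialFunctional_comp _ φ (i : ℕ)]
  ring

theorem fwdDiff_iter_abelSum (f : ℕ → ℕ → K) (N k : ℕ) :
    Δ_[1] ^[k] (fun a : ℕ => abelSum w N (f a)) 0 =
      abelSum w N fun b => Δ_[1] ^[k] (fun a : ℕ => f a b) 0 := by
  let S : (ℕ → K) →+ K :=
    { toFun := abelSum w N
      map_zero' := by
        simp [abelSum, fwdDiff_iter_eq_sum_shift]
      map_add' := fun f g => by
        simp only [abelSum, fwdDiff_iter_add, Pi.add_apply, mul_add, Finset.sum_add_distrib] }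
  have h1 := map_fwdDiff_iter S 1 f k 0
  have h2 : Δ_[1] ^[k] f 0 = fun b => Δ_[1] ^[k] (fun a : ℕ => f a b) 0 := by
    funext b
    exact map_fwdDiff_iter (Pi.evalAddMonoidHom (fun _ : ℕ => K) b) 1 f k 0
  rw [h2] at h1
  exact h1.symm

theorem abelFunctional₂_eq_abelSum₂ (h : AbelPair z w) (φ : C(ℤ_[p] × ℤ_[p], K)) (N : ℕ)
    (h1 : ∀ a k : ℕ, N ≤ k → Δ_[1] ^[k] (fun b : ℕ => φ (a, b)) 0 = 0)
    (h2 : ∀ b k : ℕ, N ≤ k → Δ_[1] ^[k] (fun a : ℕ => φ (a, b)) 0 = 0) :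
    abelFunctional₂ h φ = abelSum₂ z w N fun a b => φ (a, b) := by
  have h3 : ∀ a : ℕ, partialFunctional (abelFunctional w h.snd_le h.snd_eq) φ a =
      abelSum w N fun b => φ (a, b) := fun a => by
    rw [partialFunctional_apply, abelFunctional_eq_abelSum h.snd_le h.snd_eq _ N (h1 a)]
    rfl
  rw [abelFunctional₂_apply, abelFunctional_eq_abelSum h.fst_le h.fst_eq _ N, abelSum₂]
  · simp only [h3]
  · intro k hk
    simp only [h3]
    rw [fwdDiff_iter_abelSum (fun a b => φ (a, b))]
    simp only [h2 _ k hk]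
    refine Finset.sum_eq_zero fun l _ => ?_
    have : Δ_[1] ^[l] (fun _ : ℕ => (0 : K)) 0 = 0 := by
      simp [fwdDiff_iter_eq_sum_shift]
    rw [this, mul_zero]

theorem abelFunctional₂_mem (h : AbelPair z w) (φ : C(ℤ_[p] × ℤ_[p], K))
    {S : Subring K} (hS : IsClosed (S : Set K)) (hz : z ∈ S) (hz' : (1 - z)⁻¹ ∈ S) (hw : w ∈ S)
    (hw' : (1 - w)⁻¹ ∈ S) (hφ : ∀ a, φ a ∈ S) : abelFunctional₂ h φ ∈ S :=
  abelFunctional_mem h.fst_le h.fst_eq _ hS hz hz' fun a =>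
    abelFunctional_mem h.snd_le h.snd_eq _ hS hw hw' fun b => hφ (a, b)

end Functional2

/-! ### Roots of unity of order prime to p in ℂ_p; the ring ℤ_p[μ_f] -/

section Cp

variable {p : ℕ} [Fact p.Prime]

noncomputable instance algebraPadicInt : Algebra ℤ_[p] ℂ_[p] := (toCp (p := p)).toAlgebra

theorem norm_toCp (x : ℤ_[p]) : ‖toCp x‖ = ‖x‖ := norm_algebraMap' ℂ_[p] (x : ℚ_[p])

instance isBoundedSMul_padicInt :
    @IsBoundedSMul ℤ_[p] ℂ_[p] _ _ _ _ (algebraPadicInt (p := p)).toSMul :=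
  letI := (algebraPadicInt (p := p)).toModule
  IsBoundedSMul.of_norm_smul_le fun x y => by
    rw [← norm_toCp x, ← norm_mul]
    exact le_of_eq (congrArg norm (Algebra.smul_def x y))

theorem toCp_injective : Function.Injective (toCp (p := p)) := by
  refine (injective_iff_map_eq_zero _).2 fun x hx => ?_
  rwa [← norm_eq_zero, norm_toCp, norm_eq_zero] at hx

theorem continuous_toCp : Continuous (toCp (p := p)) := by
  refine AddMonoidHomClass.continuous_of_bound (toCp (p := p)) 1 fun x => ?_
  rw [norm_toCp, one_mul]

theorem isUnit_natCast {f : ℕ} (hf : ¬ p ∣ f) : IsUnit (f : ℤ_[p]) := by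
  rw [PadicInt.isUnit_iff]
  refine le_antisymm (PadicInt.norm_le_one _) (not_lt.1 fun hlt => hf ?_)
  have := (PadicInt.norm_int_lt_one_iff_dvd (p := p) (f : ℤ)).1 (by exact_mod_cast hlt)
  exact_mod_cast this

theorem norm_natCast_eq_one {f : ℕ} (hf : ¬ p ∣ f) : ‖(f : ℂ_[p])‖ = 1 := by
  rw [← map_natCast (toCp (p := p)), norm_toCp, ← PadicInt.isUnit_iff]
  exact isUnit_natCast hf

theorem norm_eq_one_of_pow_eq_one {f : ℕ} (hf : f ≠ 0) {ζ : ℂ_[p]} (hζ : ζ ^ f = 1) : ‖ζ‖ = 1 := by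
  have h2 : ‖ζ‖ ^ f = 1 := by rw [← norm_pow, hζ, norm_one]
  exact (pow_eq_one_iff_of_nonneg (norm_nonneg _) hf).1 h2

/-- The quotient of `f` by `1 - ζ`, for `ζ ^ f = 1` and `ζ ≠ 1`. -/
theorem one_sub_mul_geom_sum {K : Type*} [Field K] {f : ℕ} {ζ : K} (hζ : ζ ^ f = 1) (h1 : ζ ≠ 1) :
    (1 - ζ) * ∑ i ∈ Finset.range f, ∑ l ∈ Finset.range i, ζ ^ l = f := by
  rw [Finset.mul_sum]
  have h2 : ∀ i, (1 - ζ) * ∑ l ∈ Finset.range i, ζ ^ l = 1 - ζ ^ i := fun i => by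
    rw [mul_comm]
    have := geom_sum_mul ζ i
    linear_combination -this
  have h3 : ∑ i ∈ Finset.range f, ζ ^ i = 0 := by
    have := geom_sum_mul ζ f
    rw [hζ, sub_self] at this
    exact (mul_eq_zero.1 this).resolve_right (sub_ne_zero.2 h1)
  rw [Finset.sum_congr rfl fun i _ => h2 i, Finset.sum_sub_distrib, h3]
  simp

/-- 1 - ζ divides the unit f with an integral quotient, by `one_sub_mul_geom_sum`. -/
theorem norm_one_sub_eq_one {f : ℕ} (hf : ¬ p ∣ f) {ζ : ℂ_[p]} (hζ : ζ ^ f = 1) (h1 : ζ ≠ 1) :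
    ‖1 - ζ‖ = 1 := by
  have hf0 : f ≠ 0 := fun h => hf (h ▸ dvd_zero p)
  have hn := norm_eq_one_of_pow_eq_one hf0 hζ
  have h := congrArg norm (one_sub_mul_geom_sum hζ h1)
  rw [norm_mul, norm_natCast_eq_one hf] at h
  have h2 : ‖∑ i ∈ Finset.range f, ∑ l ∈ Finset.range i, ζ ^ l‖ ≤ 1 :=
    IsUltrametricDist.norm_sum_le_of_forall_le_of_nonneg zero_le_one fun i _ =>
      IsUltrametricDist.norm_sum_le_of_forall_le_of_nonneg zero_le_one fun l _ => by
        rw [norm_pow, hn, one_pow]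
  have h3 : ‖1 - ζ‖ ≤ 1 := by
    have h4 := IsUltrametricDist.norm_add_le_max 1 (-ζ)
    rwa [norm_neg, norm_one, hn, max_self, ← sub_eq_add_neg] at h4
  refine le_antisymm h3 ?_
  calc (1 : ℝ) = ‖1 - ζ‖ * _ := h.symm
    _ ≤ ‖1 - ζ‖ * 1 := mul_le_mul_of_nonneg_left h2 (norm_nonneg _)
    _ = ‖1 - ζ‖ := mul_one _

theorem toCp_mem_zpMu (f : ℕ) (x : ℤ_[p]) : toCp x ∈ zpMu p f :=
  Subring.subset_closure (Or.inl ⟨x, rfl⟩)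

theorem mem_zpMu_of_pow_eq_one {f : ℕ} {ζ : ℂ_[p]} (hζ : ζ ^ f = 1) : ζ ∈ zpMu p f :=
  Subring.subset_closure (Or.inr hζ)

theorem inv_one_sub_mem_zpMu {f : ℕ} (hf : ¬ p ∣ f) {ζ : ℂ_[p]} (hζ : ζ ^ f = 1) (h1 : ζ ≠ 1) :
    (1 - ζ)⁻¹ ∈ zpMu p f := by
  have h := one_sub_mul_geom_sum hζ h1
  obtain ⟨u, hu⟩ := isUnit_natCast hf
  have hu2 : (f : ℂ_[p]) * toCp ((u⁻¹ : ℤ_[p]ˣ) : ℤ_[p]) = 1 := by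
    rw [← map_natCast (toCp (p := p)), ← hu, ← map_mul, Units.mul_inv, map_one]
  have h2 : (1 - ζ)⁻¹ = (∑ i ∈ Finset.range f, ∑ l ∈ Finset.range i, ζ ^ l) *
      toCp ((u⁻¹ : ℤ_[p]ˣ) : ℤ_[p]) :=
    inv_eq_of_mul_eq_one_right (by rw [← mul_assoc, h, hu2])
  rw [h2]
  refine Subring.mul_mem _ (Subring.sum_mem _ fun i _ => Subring.sum_mem _ fun l _ => ?_)
    (toCp_mem_zpMu f _)
  exact Subring.pow_mem _ (mem_zpMu_of_pow_eq_one hζ) l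

/-- Such a module is the image of the compact space ℤ_p^n under a continuous map. -/
theorem isClosed_of_fg {M : Submodule ℤ_[p] ℂ_[p]} (hM : M.FG) : IsClosed (M : Set ℂ_[p]) := by
  obtain ⟨n, s, hs⟩ := Submodule.fg_iff_exists_fin_generating_family.1 hM
  have hr : (M : Set ℂ_[p]) = Set.range fun c : Fin n → ℤ_[p] => ∑ i, toCp (c i) * s i := by
    ext x
    rw [← hs, SetLike.mem_coe, Submodule.mem_span_range_iff_exists_fun]
    rfl
  rw [hr]
  refine (isCompact_range ?_).isClosed
  exact continuous_finsetSum _ fun i _ =>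
    (continuous_toCp.comp (continuous_apply i)).mul continuous_const

/-- The ring is generated over ℤ_p by finitely many integral elements, hence finitely generated as a
module. Closedness keeps the infinite sums defining the functional inside it. -/
theorem isClosed_zpMu {f : ℕ} (hf : f ≠ 0) : IsClosed (zpMu p f : Set ℂ_[p]) := by
  have hfin : {ζ : ℂ_[p] | ζ ^ f = 1}.Finite := by
    refine (Polynomial.nthRootsFinset f (1 : ℂ_[p])).finite_toSet.subset fun ζ hζ => ?_
    rw [Finset.mem_coe, Polynomial.mem_nthRootsFinset (Nat.pos_of_ne_zero hf)]
    exact hζ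
  have hint : ∀ ζ ∈ {ζ : ℂ_[p] | ζ ^ f = 1}, IsIntegral ℤ_[p] ζ := fun ζ hζ => by
    refine IsIntegral.of_pow (Nat.pos_of_ne_zero hf) ?_
    rw [show ζ ^ f = 1 from hζ]
    exact isIntegral_one
  have h1 := isClosed_of_fg (fg_adjoin_of_finite hfin hint)
  have h2 : (zpMu p f : Set ℂ_[p]) =
      ((Algebra.adjoin ℤ_[p] {ζ : ℂ_[p] | ζ ^ f = 1}).toSubring : Set ℂ_[p]) := by
    rw [Algebra.adjoin_eq_ring_closure]
    rfl
  rw [h2]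
  exact h1

end Cp

/-! ### The p-adic function attached to a cone -/

section PadicCone

variable {k : Type*} [Field k] [NumberField k] {p : ℕ} [Fact p.Prime] {𝔣 : Ideal (𝓞 k)}

set_option linter.unusedSectionVars false

/-- The two `p`-adic coordinates of the elements of `I`, when `p` splits and `I` is prime to `p`. -/
structure PadicCoords (P : CharPair 𝔣) (p : ℕ) [Fact p.Prime] where
  /-- The coordinates. -/
  coord : Fin 2 → (P.mod →+ ℤ_[p])
  norm_eq : ∀ a : P.mod, toCp (coord 0 a * coord 1 a) = ((Algebra.norm ℚ (a : k) : ℚ) : ℂ_[p])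
  dvd_iff : ∀ a : P.mod, p ∣ idealIndex P.I (a : k) ↔ ¬ IsUnit (coord 0 a * coord 1 a)

theorem isUnit_natCast_iff {n : ℕ} : IsUnit (n : ℤ_[p]) ↔ ¬ p ∣ n := by
  refine ⟨fun h hd => ?_, isUnit_natCast⟩
  exact PadicInt.prime_p.not_isUnit (isUnit_of_dvd_unit (Nat.cast_dvd_cast hd) h)

theorem ratCast_eq_algebraMap (q : ℚ) : (q : ℂ_[p]) = algebraMap ℚ_[p] ℂ_[p] (q : ℚ_[p]) :=
  (map_ratCast _ q).symm

/-- The two embeddings followed by `j` land in ℤ_p on I. Up to sign the norm is |I:(a)| · NI with NI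
a p-adic unit, which gives the divisibility criterion. -/
theorem exists_padicCoords (hk : Module.finrank ℚ k = 2)
    (hsplit : ∃ 𝔭₁ 𝔭₂ : Ideal (𝓞 k), 𝔭₁.IsPrime ∧ 𝔭₂.IsPrime ∧ 𝔭₁ ≠ 𝔭₂ ∧
      Ideal.span {(p : 𝓞 k)} = 𝔭₁ * 𝔭₂) (P : CharPair 𝔣)
    (hI : ∀ v ∈ primesAbove k p, FractionalIdeal.count k v P.I = 0) (j : QBar →+* ℂ_[p])
    {ι : Fin 2 → (k →+* QBar)} (hι : Function.Injective ι) :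
    ∃ c : PadicCoords P p, ∀ i (a : P.mod), toCp (c.coord i a) = j (ι i (a : k)) := by
  choose s hs using fun (i : Fin 2) (a : P.mod) =>
    exists_toCp_eq hk hsplit P.ne_zero hI (j.comp (ι i)) a.2
  have hadd : ∀ i a b, s i (a + b) = s i a + s i b := fun i a b => toCp_injective (by
    rw [map_add, ← hs, ← hs, ← hs, Submodule.coe_add, map_add])
  let c : Fin 2 → (P.mod →+ ℤ_[p]) := fun i => AddMonoidHom.mk' (s i) (hadd i)
  have hc : ∀ i a, toCp (c i a) = j (ι i (a : k)) := fun i a => (hs i a).symm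
  have hne : ι 0 ≠ ι 1 := fun h => zero_ne_one (hι h)
  have hnorm : ∀ a : P.mod, toCp (c 0 a * c 1 a) = ((Algebra.norm ℚ (a : k) : ℚ) : ℂ_[p]) := by
    intro a
    rw [map_mul, hc, hc, ← map_mul, ← norm_eq_mul_of_ne hk (algebraMap QBar ℂ) hne, map_ratCast]
  refine ⟨⟨c, hnorm, fun a => ?_⟩, hc⟩
  obtain ⟨N, hN⟩ := exists_unit_eq_absNorm p P.ne_zero hI
  have hidx := idealIndex_mul_absNorm (a := (a : k)) a.2
  have h1 : toCp ((idealIndex P.I (a : k) : ℤ_[p]) * (N : ℤ_[p])) =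
      ((|Algebra.norm ℚ (a : k)| : ℚ) : ℂ_[p]) := by
    rw [← hidx, map_mul, map_natCast, toCp_apply, hN, Rat.cast_mul, Rat.cast_natCast,
      ← ratCast_eq_algebraMap]
  have h2 : IsUnit (c 0 a * c 1 a) ↔ IsUnit ((idealIndex P.I (a : k) : ℤ_[p]) * (N : ℤ_[p])) := by
    rcases abs_choice (Algebra.norm ℚ (a : k)) with h | h
    · rw [h, ← hnorm] at h1
      rw [toCp_injective h1]
    · rw [h, Rat.cast_neg, ← hnorm, ← map_neg] at h1
      rw [toCp_injective h1, IsUnit.neg_iff]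
  rw [h2, Units.isUnit_mul_units, isUnit_natCast_iff, not_not]

variable {P : CharPair 𝔣} (c : PadicCoords P p)

/-- The norm of `x + a τ₁ + b τ₂`, as a function on `ℤ_p × ℤ_p`. -/
noncomputable def PadicCoords.normForm (τ₁ τ₂ x : P.mod) (q : ℤ_[p] × ℤ_[p]) : ℤ_[p] :=
  (c.coord 0 x + c.coord 0 τ₁ * q.1 + c.coord 0 τ₂ * q.2) *
    (c.coord 1 x + c.coord 1 τ₁ * q.1 + c.coord 1 τ₂ * q.2)

theorem PadicCoords.continuous_normForm (τ₁ τ₂ x : P.mod) :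
    Continuous (c.normForm τ₁ τ₂ x) := by
  unfold PadicCoords.normForm
  fun_prop

theorem PadicCoords.dvd_add_smul_iff (c : PadicCoords P p) (a b : P.mod) :
    p ∣ idealIndex P.I ((a + p • b : P.mod) : k) ↔ p ∣ idealIndex P.I (a : k) := by
  rw [c.dvd_iff, c.dvd_iff, not_iff_not]
  refine isUnit_congr ?_
  simp only [map_add, map_nsmul, nsmul_eq_mul]
  exact ⟨c.coord 0 a * c.coord 1 b + c.coord 0 b * c.coord 1 a +
    p * (c.coord 0 b * c.coord 1 b), by ring⟩

theorem PadicCoords.normForm_conePoint (τ₁ τ₂ : P.mod) (t : P.mod × Fin p × Fin p)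
    (q : ℤ_[p] × ℤ_[p]) : c.normForm τ₁ τ₂ t.1
        (affineMap₂ ((t.2.1 : ℕ) : ℤ_[p]) p ((t.2.2 : ℕ) : ℤ_[p]) p q) =
      (c.coord 0 (conePoint p τ₁ τ₂ t 0) + p * c.coord 0 τ₁ * q.1 + p * c.coord 0 τ₂ * q.2) *
      (c.coord 1 (conePoint p τ₁ τ₂ t 0) + p * c.coord 1 τ₁ * q.1 + p * c.coord 1 τ₂ * q.2) := by
  obtain ⟨a, b⟩ := q
  rw [affineMap₂_apply]
  simp only [PadicCoords.normForm, conePoint, map_add, map_nsmul, nsmul_eq_mul, Prod.fst_zero,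
    Prod.snd_zero, mul_zero, add_zero]
  ring

theorem PadicCoords.isUnit_normForm_iff (τ₁ τ₂ : P.mod) (t : P.mod × Fin p × Fin p)
    (q : ℤ_[p] × ℤ_[p]) : IsUnit (c.normForm τ₁ τ₂ t.1
        (affineMap₂ ((t.2.1 : ℕ) : ℤ_[p]) p ((t.2.2 : ℕ) : ℤ_[p]) p q)) ↔
      ¬ p ∣ idealIndex P.I ((conePoint p τ₁ τ₂ t 0 : P.mod) : k) := by
  rw [c.normForm_conePoint, c.dvd_iff, not_not]
  refine isUnit_congr ?_
  set u := c.coord 0 τ₁ * q.1 + c.coord 0 τ₂ * q.2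
  set v := c.coord 1 τ₁ * q.1 + c.coord 1 τ₂ * q.2
  exact ⟨c.coord 0 (conePoint p τ₁ τ₂ t 0) * v + u * c.coord 1 (conePoint p τ₁ τ₂ t 0) + p * (u * v),
    by ring⟩

theorem PadicCoords.continuous_toCp_padicKernel (τ₁ τ₂ x : P.mod) :
    Continuous fun q : ℤ_[p] × (ℤ_[p] × ℤ_[p]) =>
      toCp (padicKernel q.1 (c.normForm τ₁ τ₂ x q.2)) := by
  have h1 : Continuous fun q : ℤ_[p] × (ℤ_[p] × ℤ_[p]) => c.normForm τ₁ τ₂ x q.2 :=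
    (c.continuous_normForm τ₁ τ₂ x).comp continuous_snd
  exact continuous_toCp.comp (continuous_padicKernel continuous_fst h1)

/-- The function `(s, q) ↦ ω(y)⁻¹ ⟨y⟩ ^ (-s)`, with `y` the norm of `x + q₁ τ₁ + q₂ τ₂`. -/
noncomputable def PadicCoords.kernel (τ₁ τ₂ x : P.mod) : C(ℤ_[p] × (ℤ_[p] × ℤ_[p]), ℂ_[p]) :=
  ⟨fun q => toCp (padicKernel q.1 (c.normForm τ₁ τ₂ x q.2)),
    c.continuous_toCp_padicKernel τ₁ τ₂ x⟩

theorem PadicCoords.kernel_curry_apply (τ₁ τ₂ x : P.mod) (s : ℤ_[p]) (q : ℤ_[p] × ℤ_[p]) :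
    (c.kernel τ₁ τ₂ x).curry s q = toCp (padicKernel s (c.normForm τ₁ τ₂ x q)) := rfl

/-- The `p`-adic function attached to the cone on `τ₁, τ₂`. -/
noncomputable def PadicCoords.coneFun (j : QBar →+* ℂ_[p]) (τ₁ τ₂ : P.mod)
    (h : AbelPair (j (P.ξ τ₁)) (j (P.ξ τ₂))) [Fintype (ParPoint τ₁ τ₂)] (s : ℤ_[p]) : ℂ_[p] :=
  ∑ x : ParPoint τ₁ τ₂, j (P.ξ x.1) * abelFunctional₂ h ((c.kernel τ₁ τ₂ x.1).curry s)

variable (j : QBar →+* ℂ_[p]) {τ₁ τ₂ : P.mod} [Fintype (ParPoint τ₁ τ₂)]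

theorem PadicCoords.continuous_coneFun (h : AbelPair (j (P.ξ τ₁)) (j (P.ξ τ₂))) :
    Continuous (c.coneFun j τ₁ τ₂ h) :=
  continuous_finsetSum _ fun x _ => continuous_const.mul
    ((abelFunctional₂ h).continuous.comp (c.kernel τ₁ τ₂ x.1).curry.continuous)

/-- On a residue class of units the kernel at -n is the n-th power of the norm, a polynomial of
degree at most 2n in each variable. The functional therefore reduces to the truncated Abel sum. -/
theorem PadicCoords.abelFunctional₂_kernel (h' : AbelPair (j (P.ξ τ₁) ^ p) (j (P.ξ τ₂) ^ p))
    (t : P.mod × Fin p × Fin p) {n N : ℕ} (hn : (-(n : ℤ)) ∈ interpSet p) (hN : 2 * n < N)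
    (hu : ¬ p ∣ idealIndex P.I ((conePoint p τ₁ τ₂ t 0 : P.mod) : k)) :
    abelFunctional₂ h' (((c.kernel τ₁ τ₂ t.1).curry (-(n : ℤ_[p]))).comp
        (affineMap₂ ((t.2.1 : ℕ) : ℤ_[p]) p ((t.2.2 : ℕ) : ℤ_[p]) p)) =
      j (abelSum₂ (P.ξ τ₁ ^ p) (P.ξ τ₂ ^ p) N fun a b =>
        ((Algebra.norm ℚ ((conePoint p τ₁ τ₂ t (a, b) : P.mod) : k) : ℚ) : QBar) ^ n) := by
  set φ := ((c.kernel τ₁ τ₂ t.1).curry (-(n : ℤ_[p]))).comp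
        (affineMap₂ ((t.2.1 : ℕ) : ℤ_[p]) p ((t.2.2 : ℕ) : ℤ_[p]) p) with hφ
  have hval : ∀ q : ℤ_[p] × ℤ_[p], φ q = toCp ((c.coord 0 (conePoint p τ₁ τ₂ t 0) + (p : ℤ_[p]) * c.coord 0 τ₁ * q.1 +
      (p : ℤ_[p]) * c.coord 0 τ₂ * q.2) ^ n * (c.coord 1 (conePoint p τ₁ τ₂ t 0) + (p : ℤ_[p]) * c.coord 1 τ₁ * q.1 +
        (p : ℤ_[p]) * c.coord 1 τ₂ * q.2) ^ n) := by
    intro q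
    obtain ⟨y, hy⟩ := (c.isUnit_normForm_iff τ₁ τ₂ t q).2 hu
    rw [hφ, ContinuousMap.comp_apply, c.kernel_curry_apply, ← mul_pow, ← c.normForm_conePoint,
      ← hy, padicKernel_neg_natCast hn]
  have hnorm : ∀ a b : ℕ, φ (a, b) =
      j (((Algebra.norm ℚ ((conePoint p τ₁ τ₂ t (a, b) : P.mod) : k) : ℚ) : QBar) ^ n) := by
    intro a b
    rw [hval, map_pow, map_ratCast, ← c.norm_eq, ← map_pow, mul_pow, conePoint_eq p τ₁ τ₂ t (a, b)]
    simp only [map_add, map_nsmul, nsmul_eq_mul]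
    ring_nf
  rw [abelFunctional₂_eq_abelSum₂ h' φ N, map_abelSum₂, map_pow, map_pow]
  · congr 1
    funext a b
    exact hnorm a b
  · intro a l hl
    have h1 := fwdDiff_iter_affine_pow_mul_pow
      (c.coord 0 (conePoint p τ₁ τ₂ t 0) + p * c.coord 0 τ₁ * a) (p * c.coord 0 τ₂)
      (c.coord 1 (conePoint p τ₁ τ₂ t 0) + p * c.coord 1 τ₁ * a) (p * c.coord 1 τ₂)
      (hN.trans_le hl) 0
    have h2 := congrArg (toCp (p := p)).toAddMonoidHom h1
    rw [map_fwdDiff_iter, map_zero] at h2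
    rw [show (fun b : ℕ => φ (a, b)) = _ from funext fun b => hval (a, b)]
    exact h2
  · intro b l hl
    have h1 := fwdDiff_iter_affine_pow_mul_pow
      (c.coord 0 (conePoint p τ₁ τ₂ t 0) + p * c.coord 0 τ₂ * b) (p * c.coord 0 τ₁)
      (c.coord 1 (conePoint p τ₁ τ₂ t 0) + p * c.coord 1 τ₂ * b) (p * c.coord 1 τ₁)
      (hN.trans_le hl) 0
    have h2 := congrArg (toCp (p := p)).toAddMonoidHom h1
    rw [map_fwdDiff_iter, map_zero] at h2
    rw [show (fun a : ℕ => φ (a, b)) = _ from funext fun a => by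
      rw [hval (a, b), add_right_comm, add_right_comm (c.coord 1 _)]]
    exact h2

theorem PadicCoords.abelFunctional₂_kernel_eq_zero
    (h' : AbelPair (j (P.ξ τ₁) ^ p) (j (P.ξ τ₂) ^ p))
    (t : P.mod × Fin p × Fin p) (s : ℤ_[p])
    (hu : p ∣ idealIndex P.I ((conePoint p τ₁ τ₂ t 0 : P.mod) : k)) :
    abelFunctional₂ h' (((c.kernel τ₁ τ₂ t.1).curry s).comp
        (affineMap₂ ((t.2.1 : ℕ) : ℤ_[p]) p ((t.2.2 : ℕ) : ℤ_[p]) p)) = 0 := by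
  rw [show ((c.kernel τ₁ τ₂ t.1).curry s).comp
        (affineMap₂ ((t.2.1 : ℕ) : ℤ_[p]) p ((t.2.2 : ℕ) : ℤ_[p]) p) = 0 from ?_, map_zero]
  ext q
  rw [ContinuousMap.comp_apply, c.kernel_curry_apply, padicKernel_of_not_isUnit, map_zero,
    ContinuousMap.zero_apply]
  rw [c.isUnit_normForm_iff, not_not]
  exact hu

/-- Term by term over residue classes: classes of non-units contribute 0 on both sides, and the
others agree by `abelFunctional₂_kernel`. -/
theorem PadicCoords.coneFun_neg_natCast (h : AbelPair (j (P.ξ τ₁)) (j (P.ξ τ₂)))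
    (h' : AbelPair (j (P.ξ τ₁) ^ p) (j (P.ξ τ₂) ^ p)) {n N : ℕ}
    (hn : (-(n : ℤ)) ∈ interpSet p) (hN : 2 * n < N) :
    c.coneFun j τ₁ τ₂ h (-(n : ℤ_[p])) = j (P.coneValue p τ₁ τ₂ n N) := by
  rw [CharPair.coneValue, map_sum, PadicCoords.coneFun, Fintype.sum_prod_type]
  refine Finset.sum_congr rfl fun x _ => ?_
  rw [abelFunctional₂_residue h h', Finset.mul_sum]
  refine Finset.sum_congr rfl fun i _ => ?_
  split_ifs with hu
  · rw [c.abelFunctional₂_kernel_eq_zero j h' (x.1, i) _ hu, mul_zero, mul_zero, map_zero]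
  · rw [c.abelFunctional₂_kernel j h' (x.1, i) hn hN hu, map_mul]
    have : P.ξ (conePoint p τ₁ τ₂ (x.1, i) 0) =
        P.ξ x.1 * (P.ξ τ₁ ^ (i.1 : ℕ) * P.ξ τ₂ ^ (i.2 : ℕ)) := by
      simp only [conePoint, Prod.fst_zero, Prod.snd_zero, mul_zero, add_zero,
        AddChar.map_add_eq_mul, AddChar.map_nsmul_eq_pow, mul_assoc]
    rw [this, map_mul, map_mul, map_pow, map_pow]
    ring

end PadicCone

/-! ### The interpolation property and its consequences -/

section Interpolation

variable {k : Type*} [Field k] [NumberField k] {p : ℕ} [Fact p.Prime] {𝔣 : Ideal (𝓞 k)}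

set_option linter.unusedSectionVars false

theorem natCast_mem_of_comap_eq {f : ℕ}
    (hff : 𝔣.comap (algebraMap ℤ (𝓞 k)) = Ideal.span {(f : ℤ)}) : (f : 𝓞 k) ∈ 𝔣 := by
  have h : (f : ℤ) ∈ 𝔣.comap (algebraMap ℤ (𝓞 k)) := by
    rw [hff]
    exact Ideal.mem_span_singleton_self _
  rw [Ideal.mem_comap] at h
  simpa using h

theorem ne_bot_of_comap_eq {f : ℕ} (hf : 0 < f)
    (hff : 𝔣.comap (algebraMap ℤ (𝓞 k)) = Ideal.span {(f : ℤ)}) : 𝔣 ≠ ⊥ := by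
  rintro rfl
  have h := natCast_mem_of_comap_eq hff
  rw [Ideal.mem_bot, Nat.cast_eq_zero] at h
  omega

/-- If f = pg, coprimality of p and 𝔣 puts g in 𝔣, against f being the generator of 𝔣 ∩ ℤ. -/
theorem not_dvd_of_isCoprime {f : ℕ} (hf : 0 < f)
    (hff : 𝔣.comap (algebraMap ℤ (𝓞 k)) = Ideal.span {(f : ℤ)})
    (hpf : IsCoprime (Ideal.span {(p : 𝓞 k)}) 𝔣) : ¬ p ∣ f := by
  rintro ⟨g, rfl⟩
  have hp : p.Prime := Fact.out
  obtain ⟨a, ha, b, hb, hab⟩ := Ideal.isCoprime_iff_exists.1 hpf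
  obtain ⟨c, rfl⟩ := Ideal.mem_span_singleton.1 ha
  have hmem := natCast_mem_of_comap_eq hff
  have hg : (g : 𝓞 k) ∈ 𝔣 := by
    have h1 : (g : 𝓞 k) = c * ((p * g : ℕ) : 𝓞 k) + g * b := by
      push_cast
      linear_combination -(g : 𝓞 k) * hab
    rw [h1]
    exact 𝔣.add_mem (𝔣.mul_mem_left _ hmem) (𝔣.mul_mem_left _ hb)
  have h2 : (g : ℤ) ∈ 𝔣.comap (algebraMap ℤ (𝓞 k)) := by
    rw [Ideal.mem_comap]
    simpa using hg
  rw [hff, Ideal.mem_span_singleton] at h2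
  have h3 : p * g ∣ g := by exact_mod_cast h2
  have hg0 : 0 < g := Nat.pos_of_mul_pos_left hf
  have := Nat.le_of_dvd hg0 h3
  have := hp.one_lt
  nlinarith

theorem CharPair.ξ_pow_eq_one (P : CharPair 𝔣) {f : ℕ} (hf : (f : 𝓞 k) ∈ 𝔣) (x : P.mod) :
    P.ξ x ^ f = 1 := by
  have h : (f : 𝓞 k) ∈ charAnnihilator P.I P.ξ := by rw [P.annihilator]; exact hf
  have h1 := h x
  rwa [Nat.cast_smul_eq_nsmul, AddChar.map_nsmul_eq_pow] at h1

theorem pow_prime_ne_one {G : Type*} [Monoid G] {f : ℕ} (hf : ¬ p ∣ f) {z : G} (hz : z ^ f = 1)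
    (hz1 : z ≠ 1) : z ^ p ≠ 1 := by
  intro h
  have h1 := Nat.dvd_gcd (orderOf_dvd_of_pow_eq_one h) (orderOf_dvd_of_pow_eq_one hz)
  rw [(Nat.Prime.coprime_iff_not_dvd Fact.out).2 hf, Nat.dvd_one, orderOf_eq_one_iff] at h1
  exact hz1 h1

theorem ne_zero_of_not_dvd {f : ℕ} (hf : ¬ p ∣ f) : f ≠ 0 := by
  rintro rfl
  exact hf (dvd_zero p)

theorem abelPair_of_pow_eq_one {f : ℕ} (hf : ¬ p ∣ f) {z w : ℂ_[p]} (hz : z ^ f = 1) (hz1 : z ≠ 1)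
    (hw : w ^ f = 1) (hw1 : w ≠ 1) : AbelPair z w where
  fst_le := (norm_eq_one_of_pow_eq_one (ne_zero_of_not_dvd hf) hz).le
  fst_eq := norm_one_sub_eq_one hf hz hz1
  snd_le := (norm_eq_one_of_pow_eq_one (ne_zero_of_not_dvd hf) hw).le
  snd_eq := norm_one_sub_eq_one hf hw hw1

theorem exists_eq_neg_natCast {m : ℤ} (hm : m ∈ interpSet p) : ∃ n : ℕ, m = -(n : ℤ) :=
  ⟨(-m).toNat, by rw [Int.toNat_of_nonneg (by linarith [hm.1]), neg_neg]⟩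

variable {P : CharPair 𝔣} (c : PadicCoords P p) (j : QBar →+* ℂ_[p]) {τ₁ τ₂ : P.mod}
  [Fintype (ParPoint τ₁ τ₂)]

theorem pow_eq_one_of_map (j : QBar →+* ℂ_[p]) {f : ℕ} {z : QBar} (h : z ^ f = 1) : j z ^ f = 1 := by
  rw [← map_pow, h, map_one]

theorem map_ne_one (j : QBar →+* ℂ_[p]) {z : QBar} (h : z ≠ 1) : j z ≠ 1 := fun h' =>
  h (j.injective (by rw [h', map_one]))

variable {f : ℕ}

theorem CharPair.abelPair (P : CharPair 𝔣) (j : QBar →+* ℂ_[p]) {τ₁ τ₂ : P.mod} (hf : ¬ p ∣ f)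
    (hmem : (f : 𝓞 k) ∈ 𝔣) (h₁ : P.ξ τ₁ ≠ 1) (h₂ : P.ξ τ₂ ≠ 1) :
    AbelPair (j (P.ξ τ₁)) (j (P.ξ τ₂)) :=
  abelPair_of_pow_eq_one hf (pow_eq_one_of_map j (P.ξ_pow_eq_one hmem _)) (map_ne_one j h₁)
    (pow_eq_one_of_map j (P.ξ_pow_eq_one hmem _)) (map_ne_one j h₂)

theorem CharPair.abelPair_pow (P : CharPair 𝔣) (j : QBar →+* ℂ_[p]) {τ₁ τ₂ : P.mod} (hf : ¬ p ∣ f)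
    (hmem : (f : 𝓞 k) ∈ 𝔣) (h₁ : P.ξ τ₁ ≠ 1) (h₂ : P.ξ τ₂ ≠ 1) :
    AbelPair (j (P.ξ τ₁) ^ p) (j (P.ξ τ₂) ^ p) := by
  have hpow : ∀ x, (j (P.ξ x) ^ p) ^ f = 1 := fun x => by
    rw [← pow_mul, mul_comm, pow_mul, pow_eq_one_of_map j (P.ξ_pow_eq_one hmem x), one_pow]
  have hne : ∀ x, P.ξ x ≠ 1 → j (P.ξ x) ^ p ≠ 1 := fun x hx =>
    pow_prime_ne_one hf (pow_eq_one_of_map j (P.ξ_pow_eq_one hmem x)) (map_ne_one j hx)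
  exact abelPair_of_pow_eq_one hf (hpow _) (hne _ h₁) (hpow _) (hne _ h₂)

theorem PadicCoords.isInterpolation_coneFun [NumberField.IsTotallyReal k]
    (hk : Module.finrank ℚ k = 2) (h₁ : TotallyPositive (τ₁ : k)) (h₂ : TotallyPositive (τ₂ : k))
    (hli : ∀ l m l' m' : ℚ, l • (τ₁ : k) + m • (τ₂ : k) = l' • (τ₁ : k) + m' • (τ₂ : k) →
      l = l' ∧ m = m') (hf : ¬ p ∣ f) (hmem : (f : 𝓞 k) ∈ 𝔣) (hξ₁ : P.ξ τ₁ ≠ 1)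
    (hξ₂ : P.ξ τ₂ ≠ 1) (h : AbelPair (j (P.ξ τ₁)) (j (P.ξ τ₂))) :
    IsInterpolation j (P.coneZeta p τ₁ τ₂) fun s => c.coneFun j τ₁ τ₂ h s := by
  refine ⟨(c.continuous_coneFun j h).comp continuous_subtype_val, fun s m hm hs => ?_⟩
  obtain ⟨n, rfl⟩ := exists_eq_neg_natCast hm
  obtain ⟨G, hG, hG1, hG2⟩ := P.exists_entire_coneZeta hk p h₁ h₂ hli
    (pow_prime_ne_one hf (P.ξ_pow_eq_one hmem _) hξ₁)
    (pow_prime_ne_one hf (P.ξ_pow_eq_one hmem _) hξ₂) c.dvd_add_smul_iff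
  -- The least truncation allowed by 2n + 2 < N; the value does not depend on it.
  refine ⟨P.coneValue p τ₁ τ₂ n (2 * n + 3), ?_, ?_⟩
  · have := isContinuedValue_of_entire hG hG1 (-(n : ℂ))
    rw [hG2 n (2 * n + 3) (by omega)] at this
    push_cast
    exact this
  · simp only [hs]
    push_cast
    exact c.coneFun_neg_natCast j h (P.abelPair_pow j hf hmem hξ₁ hξ₂) hm (by omega)

theorem toCp_units_zpow (N : ℤ_[p]ˣ) (m : ℤ) :
    toCp ((N ^ m : ℤ_[p]ˣ) : ℤ_[p]) = toCp (N : ℤ_[p]) ^ m := by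
  have h := congrArg Units.val (map_zpow (Units.map (toCp (p := p)).toMonoidHom) N m)
  rw [Units.val_zpow_eq_zpow_val] at h
  exact h

/-- At m in M(p) the factor NI^m of the complex formula is rational, and equals ω(NI)⟨NI⟩^m because
ω(NI)^m = ω(NI). -/
theorem PadicCoords.isInterpolation_zeta [NumberField.IsTotallyReal k]
    (hk : Module.finrank ℚ k = 2) (hf : ¬ p ∣ f) (hmem : (f : 𝓞 k) ∈ 𝔣) (h𝔣 : 𝔣 ≠ ⊥)
    {ε : (𝓞 k)ˣ} (hε : Subgroup.zpowers ε = unitsPlus 𝔣) (ρ : P.mod)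
    [Fintype (ParPoint ρ ((ε : 𝓞 k) • ρ))] (hρ : TotallyPositive (ρ : k))
    (h₂ : TotallyPositive (((ε : 𝓞 k) • ρ : P.mod) : k))
    (hli : ∀ l m l' m' : ℚ, l • (ρ : k) + m • (((ε : 𝓞 k) • ρ : P.mod) : k) =
      l' • (ρ : k) + m' • (((ε : 𝓞 k) • ρ : P.mod) : k) → l = l' ∧ m = m')
    (hξ₁ : P.ξ ρ ≠ 1) (hξ₂ : P.ξ ((ε : 𝓞 k) • ρ) ≠ 1)
    (h : AbelPair (j (P.ξ ρ)) (j (P.ξ ((ε : 𝓞 k) • ρ)))) {N : ℤ_[p]ˣ}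
    (hN : ((N : ℤ_[p]) : ℚ_[p]) = ((FractionalIdeal.absNorm P.I : ℚ) : ℚ_[p])) :
    IsInterpolation j (P.zeta (primesAbove k p)) fun s =>
      toCp (teichmuller N : ℤ_[p]) * toCp (onePow (angle N : ℤ_[p]) (s : ℤ_[p])) *
        c.coneFun j ρ ((ε : 𝓞 k) • ρ) h s := by
  have hNC : ((FractionalIdeal.absNorm P.I : ℚ) : ℂ) ≠ 0 := by
    exact_mod_cast (absNorm_pos P.ne_zero).ne'
  refine ⟨?_, fun s m hm hs => ?_⟩
  · refine (continuous_const.mul (continuous_toCp.comp ?_)).mul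
      ((c.continuous_coneFun j h).comp continuous_subtype_val)
    exact continuous_onePow_comp continuous_const continuous_subtype_val
      fun _ => prime_dvd_angle_sub_one N
  obtain ⟨n, rfl⟩ := exists_eq_neg_natCast hm
  obtain ⟨G, hG, hG1, hG2⟩ := P.exists_entire_coneZeta hk p hρ h₂ hli
    (pow_prime_ne_one hf (P.ξ_pow_eq_one hmem _) hξ₁)
    (pow_prime_ne_one hf (P.ξ_pow_eq_one hmem _) hξ₂) c.dvd_add_smul_iff
  refine ⟨((FractionalIdeal.absNorm P.I : ℚ) : QBar) ^ (-(n : ℤ)) *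
    P.coneValue p ρ ((ε : 𝓞 k) • ρ) n (2 * n + 3), ?_, ?_⟩
  · have hdiff : Differentiable ℂ fun s : ℂ =>
        ((FractionalIdeal.absNorm P.I : ℚ) : ℂ) ^ s * G s :=
      (differentiable_id.const_cpow (Or.inl hNC)).mul hG
    have hval := isContinuedValue_of_entire hdiff (D := P.zeta (primesAbove k p)) (fun s hs => by
      rw [hG1 s hs, zeta_eq_mul_coneZeta hk h𝔣 P p hε ρ hρ s]) (((-(n : ℤ)) : ℤ) : ℂ)
    rw [Complex.cpow_intCast] at hval
    have hG3 : G (((-(n : ℤ)) : ℤ) : ℂ) =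
        (P.coneValue p ρ ((ε : 𝓞 k) • ρ) n (2 * n + 3) : ℂ) := by
      push_cast
      exact hG2 n (2 * n + 3) (by omega)
    rw [hG3] at hval
    have hcoe : ((((FractionalIdeal.absNorm P.I : ℚ) : QBar) ^ (-(n : ℤ)) *
        P.coneValue p ρ ((ε : 𝓞 k) • ρ) n (2 * n + 3) : QBar) : ℂ) =
        ((FractionalIdeal.absNorm P.I : ℚ) : ℂ) ^ (-(n : ℤ)) *
          (P.coneValue p ρ ((ε : 𝓞 k) • ρ) n (2 * n + 3) : ℂ) := by
      have hc : ∀ x : QBar, (x : ℂ) = algebraMap QBar ℂ x := fun x => rfl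
      rw [hc, hc, map_mul, map_zpow₀, map_ratCast]
    rw [hcoe]
    exact hval
  · simp only [hs]
    rw [← map_mul, teichmuller_mul_onePow hm, toCp_units_zpow, map_mul, map_zpow₀, map_ratCast,
      toCp_apply, hN, ← ratCast_eq_algebraMap]
    congr 1
    push_cast
    exact c.coneFun_neg_natCast j h (P.abelPair_pow j hf hmem hξ₁ hξ₂) hm (by omega)

end Interpolation

/-! ### Formal binomial series in two variables -/

section Series

variable {R : Type*} [CommRing R] [BinomialRing R]

/-- The exponent `(i, l)` as a finitely supported function on `Fin 2`. -/
noncomputable abbrev expPair (i l : ℕ) : Fin 2 →₀ ℕ := Finsupp.single 0 i + Finsupp.single 1 l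

theorem expPair_fst (i l : ℕ) : expPair i l 0 = i := by simp

theorem expPair_snd (i l : ℕ) : expPair i l 1 = l := by simp

theorem expPair_eta (n : Fin 2 →₀ ℕ) : expPair (n 0) (n 1) = n := by
  ext i
  fin_cases i
  · exact expPair_fst _ _
  · exact expPair_snd _ _

/-- The power series `(1 + X₁) ^ u₁ (1 + X₂) ^ u₂` over a binomial ring. -/
noncomputable def powSeries (u : Fin 2 → R) : MvPowerSeries (Fin 2) R :=
  fun n => Ring.choose (u 0) (n 0) * Ring.choose (u 1) (n 1)

theorem coeff_powSeries (u : Fin 2 → R) (n : Fin 2 →₀ ℕ) :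
    MvPowerSeries.coeff n (powSeries u) = Ring.choose (u 0) (n 0) * Ring.choose (u 1) (n 1) := rfl

/-- Vandermonde's identity in each variable. -/
theorem powSeries_add (u v : Fin 2 → R) : powSeries (u + v) = powSeries u * powSeries v := by
  classical
  ext n
  rw [MvPowerSeries.coeff_mul, coeff_powSeries, Pi.add_apply, Pi.add_apply,
    Ring.add_choose_eq _ (Commute.all _ _), Ring.add_choose_eq _ (Commute.all _ _),
    Finset.sum_mul_sum, ← Finset.sum_product']
  refine Finset.sum_bij' (fun q _ => (expPair q.1.1 q.2.1, expPair q.1.2 q.2.2))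
    (fun m _ => ((m.1 0, m.2 0), (m.1 1, m.2 1))) ?_ ?_ ?_ ?_ ?_
  · rintro ⟨⟨a, b⟩, ⟨c, d⟩⟩ h
    rw [Finset.mem_product, Finset.HasAntidiagonal.mem_antidiagonal, Finset.HasAntidiagonal.mem_antidiagonal] at h
    rw [Finset.HasAntidiagonal.mem_antidiagonal, ← expPair_eta n]
    dsimp only at h ⊢
    rw [← h.1, ← h.2]
    simp only [expPair, Finsupp.single_add]
    abel
  · intro m h
    rw [Finset.HasAntidiagonal.mem_antidiagonal] at h
    rw [Finset.mem_product, Finset.HasAntidiagonal.mem_antidiagonal, Finset.HasAntidiagonal.mem_antidiagonal, ← h]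
    exact ⟨rfl, rfl⟩
  · rintro ⟨⟨a, b⟩, ⟨c, d⟩⟩ _
    simp only [expPair_fst, expPair_snd]
  · rintro ⟨m, m'⟩ _
    simp only [expPair_eta]
  · rintro ⟨⟨a, b⟩, ⟨c, d⟩⟩ _
    simp only [coeff_powSeries, expPair_fst, expPair_snd]
    ring

theorem constantCoeff_powSeries (u : Fin 2 → R) :
    MvPowerSeries.constantCoeff (powSeries u) = 1 := by
  rw [← MvPowerSeries.coeff_zero_eq_constantCoeff_apply, coeff_powSeries]
  simp

theorem map_powSeries {S : Type*} [CommRing S] [BinomialRing S] (φ : R →+* S) (u : Fin 2 → R) :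
    MvPowerSeries.map φ (powSeries u) = powSeries fun i => φ (u i) := by
  ext n
  rw [MvPowerSeries.coeff_map, coeff_powSeries, coeff_powSeries, map_mul, Ring.map_choose,
    Ring.map_choose]

theorem choose_one_eq (n : ℕ) : Ring.choose (1 : R) n = if n = 0 ∨ n = 1 then 1 else 0 := by
  have h := Ring.choose_natCast (R := R) 1 n
  rw [Nat.cast_one] at h
  rw [h]
  split_ifs with hn
  · rcases hn with rfl | rfl <;> simp
  · rw [Nat.choose_eq_zero_of_lt (by omega), Nat.cast_zero]

theorem powSeries_one : powSeries (1 : Fin 2 → R) =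
    (1 + MvPowerSeries.X 0) * (1 + MvPowerSeries.X 1) := by
  classical
  have h01 : (1 : Fin 2 → R) = Pi.single 0 1 + Pi.single 1 1 := by
    ext i; fin_cases i <;> simp
  have hX : ∀ i : Fin 2, powSeries (Pi.single i 1 : Fin 2 → R) = 1 + MvPowerSeries.X i := by
    intro i
    ext n
    rw [map_add, MvPowerSeries.coeff_one, MvPowerSeries.coeff_X, coeff_powSeries]
    have e0 : n = 0 ↔ n 0 = 0 ∧ n 1 = 0 := by
      rw [Finsupp.ext_iff, Fin.forall_fin_two]; rfl
    have e1 : ∀ i, n = Finsupp.single i 1 ↔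
        n 0 = (Finsupp.single i 1 : Fin 2 →₀ ℕ) 0 ∧ n 1 = (Finsupp.single i 1 : Fin 2 →₀ ℕ) 1 := by
      intro i
      rw [Finsupp.ext_iff, Fin.forall_fin_two]
    rw [if_congr (e1 i) rfl rfl, if_congr e0 rfl rfl]
    fin_cases i
    · simp only [Fin.zero_eta, Fin.isValue, Pi.single_eq_same, ne_eq, one_ne_zero, not_false_eq_true,
        Pi.single_eq_of_ne, choose_one_eq, Ring.choose_zero_ite, Finsupp.single_eq_same,
        Finsupp.single_eq_of_ne]
      by_cases h1 : n 1 = 0 <;> by_cases h0 : n 0 = 0 <;> simp [h1, h0]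
    · simp only [Fin.mk_one, Fin.isValue, Pi.single_eq_same, ne_eq, zero_ne_one, not_false_eq_true,
        Pi.single_eq_of_ne, choose_one_eq, Ring.choose_zero_ite, Finsupp.single_eq_same,
        Finsupp.single_eq_of_ne]
      by_cases h1 : n 1 = 0 <;> by_cases h0 : n 0 = 0 <;> simp [h1, h0]
  rw [h01, powSeries_add, hX, hX]

end Series

/-! ### The functional applied to (1 + X)^(u + q₁t₁ + q₂t₂) -/

section Lambda

variable {p : ℕ} [Fact p.Prime]

/-- The vector `u + q₁ t₁ + q₂ t₂`. -/
noncomputable def affineVec (u t₁ t₂ : Fin 2 → ℤ_[p]) (q : ℤ_[p] × ℤ_[p]) : Fin 2 → ℤ_[p] :=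
  fun i => u i + t₁ i * q.1 + t₂ i * q.2

theorem continuous_coeff_powSeries (u t₁ t₂ : Fin 2 → ℤ_[p]) (n : Fin 2 →₀ ℕ) :
    Continuous fun q => toCp (MvPowerSeries.coeff n (powSeries (affineVec u t₁ t₂ q))) := by
  refine continuous_toCp.comp ?_
  simp only [coeff_powSeries]
  refine ((PadicInt.continuous_choose _).comp ?_).mul ((PadicInt.continuous_choose _).comp ?_) <;>
  · unfold affineVec
    fun_prop

/-- The coefficients of `(1 + X) ^ (u + q₁ t₁ + q₂ t₂)`, as functions of `q`. -/
noncomputable def coeffFun (u t₁ t₂ : Fin 2 → ℤ_[p]) (n : Fin 2 →₀ ℕ) :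
    C(ℤ_[p] × ℤ_[p], ℂ_[p]) :=
  ⟨fun q => toCp (MvPowerSeries.coeff n (powSeries (affineVec u t₁ t₂ q))),
    continuous_coeff_powSeries u t₁ t₂ n⟩

theorem coeffFun_apply (u t₁ t₂ : Fin 2 → ℤ_[p]) (n : Fin 2 →₀ ℕ) (q : ℤ_[p] × ℤ_[p]) :
    coeffFun u t₁ t₂ n q = toCp (MvPowerSeries.coeff n (powSeries (affineVec u t₁ t₂ q))) := rfl

theorem norm_coeffFun_le (u t₁ t₂ : Fin 2 → ℤ_[p]) (n : Fin 2 →₀ ℕ) : ‖coeffFun u t₁ t₂ n‖ ≤ 1 := by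
  rw [ContinuousMap.norm_le _ zero_le_one]
  intro q
  rw [coeffFun_apply, norm_toCp]
  exact PadicInt.norm_le_one _

variable {z w : ℂ_[p]}

/-- The power series with coefficients the values of the functional at `coeffFun`. -/
noncomputable def functionalSeries (h : AbelPair z w) (u t₁ t₂ : Fin 2 → ℤ_[p]) :
    MvPowerSeries (Fin 2) ℂ_[p] :=
  fun n => abelFunctional₂ h (coeffFun u t₁ t₂ n)

theorem coeff_functionalSeries (h : AbelPair z w) (u t₁ t₂ : Fin 2 → ℤ_[p]) (n : Fin 2 →₀ ℕ) :
    MvPowerSeries.coeff n (functionalSeries h u t₁ t₂) =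
      abelFunctional₂ h (coeffFun u t₁ t₂ n) := rfl

theorem functionalSeries_mul (h : AbelPair z w) (u v t₁ t₂ : Fin 2 → ℤ_[p]) :
    functionalSeries h u t₁ t₂ * MvPowerSeries.map toCp (powSeries v) =
      functionalSeries h (u + v) t₁ t₂ := by
  classical
  ext n
  rw [MvPowerSeries.coeff_mul, coeff_functionalSeries]
  have h1 : coeffFun (u + v) t₁ t₂ n = ∑ m ∈ Finset.HasAntidiagonal.antidiagonal n,
      toCp (MvPowerSeries.coeff m.2 (powSeries v)) • coeffFun u t₁ t₂ m.1 := by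
    ext q
    rw [ContinuousMap.sum_apply, coeffFun_apply]
    have h2 : affineVec (u + v) t₁ t₂ q = affineVec u t₁ t₂ q + v := by
      ext i
      simp only [affineVec, Pi.add_apply]
      ring
    rw [h2, powSeries_add, MvPowerSeries.coeff_mul, map_sum]
    refine Finset.sum_congr rfl fun m _ => ?_
    rw [ContinuousMap.smul_apply, coeffFun_apply, map_mul, smul_eq_mul, mul_comm]
  rw [h1, map_sum]
  refine Finset.sum_congr rfl fun m _ => ?_
  rw [map_smul, smul_eq_mul, mul_comm, coeff_functionalSeries, MvPowerSeries.coeff_map]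

/-- Multiplication by (1+X)^t₁ or (1+X)^t₂ is the shift in q₁ or q₂, so the product with the
denominator is the shift relation `abelFunctional₂_shift`, leaving the value at q = 0. This is a
geometric series summed by the functional. -/
theorem functionalSeries_mul_denom (h : AbelPair z w) (u t₁ t₂ : Fin 2 → ℤ_[p]) :
    functionalSeries h u t₁ t₂ *
      ((1 - MvPowerSeries.C z * MvPowerSeries.map toCp (powSeries t₁)) *
        (1 - MvPowerSeries.C w * MvPowerSeries.map toCp (powSeries t₂))) =
      MvPowerSeries.map toCp (powSeries u) := by
  have h1 : functionalSeries h u t₁ t₂ *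
      ((1 - MvPowerSeries.C z * MvPowerSeries.map toCp (powSeries t₁)) *
        (1 - MvPowerSeries.C w * MvPowerSeries.map toCp (powSeries t₂))) =
      functionalSeries h u t₁ t₂ - MvPowerSeries.C z * functionalSeries h (u + t₁) t₁ t₂ -
        MvPowerSeries.C w * functionalSeries h (u + t₂) t₁ t₂ +
          MvPowerSeries.C (z * w) * functionalSeries h (u + t₁ + t₂) t₁ t₂ := by
    rw [← functionalSeries_mul, ← functionalSeries_mul, ← functionalSeries_mul,
      ← functionalSeries_mul, map_mul]
    ring
  rw [h1]
  ext n
  rw [map_add, map_sub, map_sub, MvPowerSeries.coeff_C_mul, MvPowerSeries.coeff_C_mul,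
    MvPowerSeries.coeff_C_mul, coeff_functionalSeries, coeff_functionalSeries,
    coeff_functionalSeries, coeff_functionalSeries, MvPowerSeries.coeff_map]
  have hsh := abelFunctional₂_shift h (coeffFun u t₁ t₂ n)
  have hcomp : ∀ (v : Fin 2 → ℤ_[p]) (a b : ℤ_[p]), (∀ i, v i = t₁ i * a + t₂ i * b) →
      (coeffFun u t₁ t₂ n).comp (affineMap₂ a 1 b 1) = coeffFun (u + v) t₁ t₂ n := by
    intro v a b hv
    ext ⟨c, d⟩
    rw [ContinuousMap.comp_apply, affineMap₂_apply, coeffFun_apply, coeffFun_apply]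
    congr 3
    ext i
    simp only [affineVec, Pi.add_apply, hv]
    ring
  rw [hcomp t₁ 1 0 (fun i => by ring), hcomp t₂ 0 1 (fun i => by ring),
    hcomp (t₁ + t₂) 1 1 (fun i => by simp), ← add_assoc] at hsh
  rw [← hsh, coeffFun_apply]
  congr 3
  ext i
  simp [affineVec]

end Lambda

/-! ### Mahler expansion of 1/y on the units of ℤ_p -/

section ValueAtOne

variable {p : ℕ} [Fact p.Prime]

theorem norm_prime_lt_one : ‖(p : ℂ_[p])‖ < 1 := by
  rw [← map_natCast (toCp (p := p)), norm_toCp, PadicInt.norm_p]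
  exact inv_lt_one_of_one_lt₀ (by exact_mod_cast (Fact.out : p.Prime).one_lt)

theorem norm_natCast_le_one (n : ℕ) : ‖(n : ℂ_[p])‖ ≤ 1 := by
  rw [← map_natCast (toCp (p := p)), norm_toCp]
  exact PadicInt.norm_le_one _

theorem add_one_pow_eq {R : Type*} [CommRing R] (x : R) {n : ℕ} (hn : 0 < n) :
    (x + 1) ^ n = x ^ n + ∑ i ∈ Finset.range (n - 1), x ^ (i + 1) * (n.choose (i + 1) : R) + 1 := by
  obtain ⟨m, rfl⟩ := Nat.exists_eq_succ_of_ne_zero hn.ne'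
  rw [add_pow, Finset.sum_range_succ, Nat.succ_eq_add_one, Finset.sum_range_succ',
    Nat.add_sub_cancel]
  simp only [one_pow, mul_one, pow_zero, Nat.choose_zero_right, Nat.cast_one, Nat.choose_self]
  ring

/-- Expanding ((ζ - 1) + 1)^p = 1 shows that (ζ - 1)^p is p times an integral element. -/
theorem norm_root_sub_one_lt_one {ζ : ℂ_[p]} (hζ : ζ ^ p = 1) : ‖ζ - 1‖ < 1 := by
  have hp : p.Prime := Fact.out
  have hn := norm_eq_one_of_pow_eq_one hp.ne_zero hζ
  have hle : ‖ζ - 1‖ ≤ 1 := by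
    have h4 := IsUltrametricDist.norm_add_le_max ζ (-1)
    rwa [norm_neg, norm_one, hn, max_self, ← sub_eq_add_neg] at h4
  have h1 := add_one_pow_eq (ζ - 1) hp.pos
  rw [sub_add_cancel, hζ] at h1
  have h2 : (ζ - 1) ^ p = -∑ i ∈ Finset.range (p - 1),
      (ζ - 1) ^ (i + 1) * (p.choose (i + 1) : ℂ_[p]) := by
    linear_combination -h1
  have h3 : ‖(ζ - 1) ^ p‖ ≤ ‖(p : ℂ_[p])‖ := by
    rw [h2, norm_neg]
    refine IsUltrametricDist.norm_sum_le_of_forall_le_of_nonneg (norm_nonneg _) fun i hi => ?_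
    rw [Finset.mem_range] at hi
    obtain ⟨c, hc⟩ := hp.dvd_choose_self (k := i + 1) (by omega) (by omega)
    rw [norm_mul, hc, Nat.cast_mul, norm_mul, norm_pow]
    have e1 := norm_natCast_le_one (p := p) c
    have e2 : ‖ζ - 1‖ ^ (i + 1) ≤ 1 := pow_le_one₀ (norm_nonneg _) hle
    calc ‖ζ - 1‖ ^ (i + 1) * (‖(p : ℂ_[p])‖ * ‖(c : ℂ_[p])‖)
        ≤ 1 * (‖(p : ℂ_[p])‖ * 1) := by gcongr
      _ = ‖(p : ℂ_[p])‖ := by ring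
  rw [norm_pow] at h3
  exact lt_of_pow_lt_pow_left₀ p zero_le_one (by
    rw [one_pow]
    exact h3.trans_lt norm_prime_lt_one)

/-- Take r to be the largest |ζ - 1|; c_n is the sum of the (ζ - 1)^n and the norm is ultrametric.
-/
theorem exists_norm_cCoeff_le : ∃ r : ℝ, 0 ≤ r ∧ r < 1 ∧ ∀ n, ‖(cCoeff p n : ℂ_[p])‖ ≤ r ^ n := by
  have hp : p.Prime := Fact.out
  obtain ⟨ζ, hζ, hmax⟩ := Finset.exists_max_image (Polynomial.nthRootsFinset p (1 : ℂ_[p]))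
    (fun ζ => ‖ζ - 1‖) ⟨1, Polynomial.one_mem_nthRootsFinset hp.pos⟩
  refine ⟨‖ζ - 1‖, norm_nonneg _, norm_root_sub_one_lt_one
    ((Polynomial.mem_nthRootsFinset hp.pos _).1 hζ), fun n => ?_⟩
  rw [cCoeff_eq]
  refine IsUltrametricDist.norm_sum_le_of_forall_le_of_nonneg (by positivity) fun η hη => ?_
  rw [norm_pow]
  exact pow_le_pow_left₀ (norm_nonneg _) (hmax η hη) n

theorem one_le_mul_norm_natCast {n : ℕ} (hn : n ≠ 0) : 1 ≤ n * ‖(n : ℂ_[p])‖ := by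
  have hp : p.Prime := Fact.out
  obtain ⟨e, m, hm, rfl⟩ := Nat.exists_eq_pow_mul_and_not_dvd hn p hp.ne_one
  have hm0 : 1 ≤ m := Nat.pos_of_ne_zero fun h => hm (by rw [h]; exact dvd_zero p)
  rw [Nat.cast_mul (α := ℂ_[p]), norm_mul, norm_natCast_eq_one hm, mul_one, Nat.cast_pow, norm_pow,
    ← map_natCast (toCp (p := p)), norm_toCp, PadicInt.norm_p]
  push_cast
  have hpp : (p : ℝ) ^ e * ((p : ℝ)⁻¹) ^ e = 1 := by
    rw [← mul_pow, mul_inv_cancel₀ (by exact_mod_cast hp.ne_zero), one_pow]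
  have hm1 : (1 : ℝ) ≤ m := by exact_mod_cast hm0
  calc (1 : ℝ) ≤ m := hm1
    _ = (p : ℝ) ^ e * m * ((p : ℝ)⁻¹) ^ e := by linear_combination -(m : ℝ) * hpp

variable (p) in
/-- The numbers `c_{i+1} / (i + 1)`. -/
noncomputable def dCoeff (i : ℕ) : ℂ_[p] := (cCoeff p (i + 1) : ℂ_[p]) / ((i : ℂ_[p]) + 1)

/-- Since |i + 1| ≥ 1/(i + 1) p-adically, the terms are at most (i + 1)r^(i+1) with r < 1. Absolute
convergence permits products of two such series. -/
theorem summable_norm_dCoeff : Summable fun i => ‖dCoeff p i‖ := by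
  obtain ⟨r, hr0, hr1, hr⟩ := exists_norm_cCoeff_le (p := p)
  have hg : Summable fun i : ℕ => (i : ℝ) * r ^ i := by
    simpa only [pow_one] using summable_pow_mul_geometric_of_norm_lt_one (R := ℝ) 1
      (by rwa [Real.norm_of_nonneg hr0])
  refine Summable.of_nonneg_of_le (fun _ => norm_nonneg _) (fun i => ?_)
    (hg.comp_injective (add_left_injective 1))
  have h1 := one_le_mul_norm_natCast (p := p) (Nat.succ_ne_zero i)
  have h2 : (i : ℂ_[p]) + 1 = ((i + 1 : ℕ) : ℂ_[p]) := by push_cast; rfl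
  have hpos : 0 < ‖((i + 1 : ℕ) : ℂ_[p])‖ := norm_pos_iff.2 (Nat.cast_ne_zero.2 (Nat.succ_ne_zero i))
  rw [dCoeff, h2, norm_div, div_le_iff₀ hpos, Function.comp_apply]
  refine (hr (i + 1)).trans ?_
  rw [mul_right_comm]
  exact le_mul_of_one_le_left (pow_nonneg hr0 _) h1

theorem norm_dCoeff_mul_le (i : ℕ) (y : ℤ_[p]) : ‖dCoeff p i * toCp y‖ ≤ ‖dCoeff p i‖ := by
  rw [norm_mul, norm_toCp]
  exact mul_le_of_le_one_right (norm_nonneg _) (PadicInt.norm_le_one _)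

/-- As (n+1)/(i+1) · binom(n, i) = binom(n+1, i+1), the left side becomes ∑ over ζ^p = 1 of ζ^(n+1)
- 1. -/
theorem sum_dCoeff_mul_choose (n : ℕ) :
    ((n + 1 : ℕ) : ℂ_[p]) * ∑ i ∈ Finset.range (n + 1), dCoeff p i * (n.choose i : ℂ_[p]) =
      (if p ∣ n + 1 then (p : ℂ_[p]) else 0) - p := by
  have hp : p.Prime := Fact.out
  have h1 : ((n + 1 : ℕ) : ℂ_[p]) * ∑ i ∈ Finset.range (n + 1), dCoeff p i * (n.choose i : ℂ_[p]) =
      ∑ i ∈ Finset.range (n + 1), ∑ ζ ∈ Polynomial.nthRootsFinset p (1 : ℂ_[p]),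
        (ζ - 1) ^ (i + 1) * ((n + 1).choose (i + 1) : ℂ_[p]) := by
    rw [Finset.mul_sum]
    refine Finset.sum_congr rfl fun i _ => ?_
    rw [← Finset.sum_mul, ← cCoeff_eq, dCoeff]
    have h2 : ((n + 1 : ℕ) : ℂ_[p]) * (n.choose i : ℂ_[p]) =
        ((n + 1).choose (i + 1) : ℂ_[p]) * ((i : ℂ_[p]) + 1) := by
      exact_mod_cast congrArg (Nat.cast : ℕ → ℂ_[p]) (Nat.add_one_mul_choose_eq n i)
    have h3 : (i : ℂ_[p]) + 1 ≠ 0 := by exact_mod_cast Nat.succ_ne_zero i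
    rw [div_mul_eq_mul_div, mul_div_assoc', div_eq_iff h3]
    linear_combination (cCoeff p (i + 1) : ℂ_[p]) * h2
  have h4 : ∀ ζ : ℂ_[p], ∑ i ∈ Finset.range (n + 1),
      (ζ - 1) ^ (i + 1) * ((n + 1).choose (i + 1) : ℂ_[p]) = ζ ^ (n + 1) - 1 := by
    intro ζ
    have h5 := add_pow (ζ - 1) 1 (n + 1)
    rw [sub_add_cancel, Finset.sum_range_succ'] at h5
    simp only [one_pow, mul_one, pow_zero, Nat.choose_zero_right, Nat.cast_one] at h5
    linear_combination -h5
  rw [h1, Finset.sum_comm, Finset.sum_congr rfl fun ζ _ => h4 ζ, Finset.sum_sub_distrib,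
    sum_pow_nthRootsFinset]
  congr 1
  have h6 := sum_pow_nthRootsFinset p 0
  simpa using h6

theorem denseRange_natCast_succ : DenseRange fun n : ℕ => ((n + 1 : ℕ) : ℤ_[p]) := by
  have h : DenseRange ((fun t : ℤ_[p] => t + 1) ∘ (Nat.cast : ℕ → ℤ_[p])) :=
    DenseRange.comp (Function.Surjective.denseRange fun t => ⟨t - 1, sub_add_cancel _ _⟩)
      PadicInt.denseRange_natCast (by fun_prop)
  convert h using 1
  funext n
  simp

/-- Both sides are continuous in y and agree at the dense set of positive integers y = n + 1 by
`sum_dCoeff_mul_choose`: the sum over p-th roots of unity detects whether p divides y. -/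
theorem tsum_dCoeff_mul_choose (y : ℤ_[p]) :
    ∑' i, dCoeff p i * toCp (Ring.choose (y - 1) i) = -(p : ℂ_[p]) * toCp (padicKernel 1 y) := by
  have hp : p.Prime := Fact.out
  have hc1 : Continuous fun y : ℤ_[p] => ∑' i, dCoeff p i * toCp (Ring.choose (y - 1) i) := by
    refine continuous_tsum (fun i => ?_) summable_norm_dCoeff fun i y => norm_dCoeff_mul_le i _
    exact continuous_const.mul (continuous_toCp.comp
      ((PadicInt.continuous_choose i).comp (continuous_id.sub continuous_const)))
  have hc2 : Continuous fun y : ℤ_[p] => -(p : ℂ_[p]) * toCp (padicKernel 1 y) :=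
    continuous_const.mul (continuous_toCp.comp (continuous_padicKernel continuous_const continuous_id))
  refine congrFun (denseRange_natCast_succ.equalizer hc1 hc2 (funext fun n => ?_)) y
  simp only [Function.comp_apply]
  have hn : ((n + 1 : ℕ) : ℂ_[p]) ≠ 0 := by exact_mod_cast Nat.succ_ne_zero n
  apply mul_left_cancel₀ hn
  have hsum : ∑' i, dCoeff p i * toCp (Ring.choose (((n + 1 : ℕ) : ℤ_[p]) - 1) i) =
      ∑ i ∈ Finset.range (n + 1), dCoeff p i * (n.choose i : ℂ_[p]) := by
    have h0 : ((n + 1 : ℕ) : ℤ_[p]) - 1 = (n : ℤ_[p]) := by push_cast; ring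
    rw [h0, tsum_eq_sum (s := Finset.range (n + 1))]
    · refine Finset.sum_congr rfl fun i _ => ?_
      rw [Ring.choose_natCast, map_natCast]
    · intro i hi
      rw [Finset.mem_range, not_lt] at hi
      rw [Ring.choose_natCast, Nat.choose_eq_zero_of_lt (by omega), Nat.cast_zero, map_zero, mul_zero]
  rw [hsum, sum_dCoeff_mul_choose]
  by_cases hd : p ∣ n + 1
  · rw [if_pos hd, padicKernel_of_not_isUnit, map_zero]
    · ring
    · intro hu
      exact PadicInt.prime_p.not_isUnit (isUnit_of_dvd_unit (Nat.cast_dvd_cast hd) hu)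
  · obtain ⟨u, hu⟩ := isUnit_natCast hd
    have h := congrArg toCp (padicKernel_one_mul u)
    rw [hu, map_mul, map_one, map_natCast] at h
    rw [if_neg hd]
    linear_combination (p : ℂ_[p]) * h

theorem padicKernel_one_mul_mul (x y : ℤ_[p]) :
    padicKernel 1 (x * y) = padicKernel 1 x * padicKernel 1 y := by
  by_cases hx : IsUnit x
  · by_cases hy : IsUnit y
    · obtain ⟨u, rfl⟩ := hx
      obtain ⟨v, rfl⟩ := hy
      apply mul_right_cancel₀ (b := ((u * v : ℤ_[p]ˣ) : ℤ_[p])) (u * v).ne_zero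
      rw [← Units.val_mul, padicKernel_one_mul, Units.val_mul]
      have h1 := padicKernel_one_mul u
      have h2 := padicKernel_one_mul v
      linear_combination -(padicKernel 1 (u : ℤ_[p]) * u) * h2 - h1
    · rw [padicKernel_of_not_isUnit 1 hy, padicKernel_of_not_isUnit, mul_zero]
      exact fun h => hy (isUnit_of_mul_isUnit_right h)
  · rw [padicKernel_of_not_isUnit 1 hx, padicKernel_of_not_isUnit, zero_mul]
    exact fun h => hx (isUnit_of_mul_isUnit_left h)

/-- The product of two one-variable expansions, the signs of the factors -p cancelling. Convergence
is in the supremum norm, so a bounded functional may be applied termwise. -/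
theorem hasSum_dCoeff_smul_coeffFun (v t₁ t₂ : Fin 2 → ℤ_[p]) {Φ : C(ℤ_[p] × ℤ_[p], ℂ_[p])}
    (hΦ : ∀ q, Φ q = toCp (padicKernel 1 (affineVec v t₁ t₂ q 0 * affineVec v t₁ t₂ q 1))) :
    HasSum (fun n : ℕ × ℕ => (dCoeff p n.1 * dCoeff p n.2) •
      coeffFun (v - 1) t₁ t₂ (expPair n.1 n.2)) ((p : ℂ_[p]) ^ 2 • Φ) := by
  have hnorm := summable_norm_dCoeff (p := p)
  have hs : Summable fun n : ℕ × ℕ => (dCoeff p n.1 * dCoeff p n.2) •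
      coeffFun (v - 1) t₁ t₂ (expPair n.1 n.2) := by
    refine Summable.of_norm_bounded (hnorm.mul_of_nonneg hnorm (fun _ => norm_nonneg _)
      fun _ => norm_nonneg _) fun n => ?_
    rw [norm_smul, norm_mul]
    exact mul_le_of_le_one_right (by positivity) (norm_coeffFun_le _ _ _ _)
  have hval : ∑' n : ℕ × ℕ, (dCoeff p n.1 * dCoeff p n.2) •
      coeffFun (v - 1) t₁ t₂ (expPair n.1 n.2) = (p : ℂ_[p]) ^ 2 • Φ := by
    ext q
    have h1 := (ContinuousMap.hasSum_apply hs.hasSum q).tsum_eq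
    rw [← h1]
    have hterm : ∀ n : ℕ × ℕ, ((dCoeff p n.1 * dCoeff p n.2) •
        coeffFun (v - 1) t₁ t₂ (expPair n.1 n.2)) q =
        (dCoeff p n.1 * toCp (Ring.choose (affineVec v t₁ t₂ q 0 - 1) n.1)) *
          (dCoeff p n.2 * toCp (Ring.choose (affineVec v t₁ t₂ q 1 - 1) n.2)) := by
      intro n
      have hv : affineVec (v - 1) t₁ t₂ q = affineVec v t₁ t₂ q - 1 := by
        ext i
        simp only [affineVec, Pi.sub_apply, Pi.one_apply]
        ring
      rw [ContinuousMap.smul_apply, coeffFun_apply, hv, coeff_powSeries, expPair_fst, expPair_snd,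
        map_mul, smul_eq_mul, Pi.sub_apply, Pi.sub_apply, Pi.one_apply, Pi.one_apply]
      ring
    have hsn : ∀ y : ℤ_[p], Summable fun i => ‖dCoeff p i * toCp (Ring.choose (y - 1) i)‖ :=
      fun y => Summable.of_nonneg_of_le (fun _ => norm_nonneg _)
        (fun i => norm_dCoeff_mul_le i _) hnorm
    rw [tsum_congr hterm, ← tsum_mul_tsum_of_summable_norm (hsn _) (hsn _), tsum_dCoeff_mul_choose,
      tsum_dCoeff_mul_choose, ContinuousMap.smul_apply, hΦ, padicKernel_one_mul_mul, map_mul,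
      smul_eq_mul]
    ring
  rw [← hval]
  exact hs.hasSum

end ValueAtOne

/-! ### Comparison with the Shintani series and the value at 1 -/

section Shintani

variable {k : Type*} [Field k] [NumberField k] {p : ℕ} [Fact p.Prime] {𝔣 : Ideal (𝓞 k)}
  {P : CharPair 𝔣} (c : PadicCoords P p) (j : QBar →+* ℂ_[p]) {τ₁ τ₂ : P.mod}
  [Fintype (ParPoint τ₁ τ₂)]

/-- The two coordinates of an element of `I`. -/
noncomputable def PadicCoords.vec (a : P.mod) : Fin 2 → ℤ_[p] := fun i => c.coord i a

/-- The power series `(1 + X)⁻¹ F`, obtained from the functional. -/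
noncomputable def PadicCoords.functionalSum (h : AbelPair (j (P.ξ τ₁)) (j (P.ξ τ₂))) :
    MvPowerSeries (Fin 2) ℂ_[p] :=
  ∑ x : ParPoint τ₁ τ₂, MvPowerSeries.C (j (P.ξ x.1)) *
    functionalSeries h (c.vec x.1 - 1) (c.vec τ₁) (c.vec τ₂)

theorem PadicCoords.hasSum_functionalSum (h : AbelPair (j (P.ξ τ₁)) (j (P.ξ τ₂))) :
    HasSum (fun n : ℕ × ℕ => dCoeff p n.1 * dCoeff p n.2 *
      MvPowerSeries.coeff (expPair n.1 n.2) (c.functionalSum j h))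
      ((p : ℂ_[p]) ^ 2 * c.coneFun j τ₁ τ₂ h 1) := by
  have h1 : ∀ x : ParPoint τ₁ τ₂, HasSum (fun n : ℕ × ℕ => j (P.ξ x.1) *
      (dCoeff p n.1 * dCoeff p n.2 * MvPowerSeries.coeff (expPair n.1 n.2)
        (functionalSeries h (c.vec x.1 - 1) (c.vec τ₁) (c.vec τ₂))))
      (j (P.ξ x.1) * ((p : ℂ_[p]) ^ 2 * abelFunctional₂ h ((c.kernel τ₁ τ₂ x.1).curry 1))) := by
    intro x
    refine HasSum.mul_left _ ?_
    have h2 := (abelFunctional₂ h).hasSum (hasSum_dCoeff_smul_coeffFun (c.vec x.1) (c.vec τ₁)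
      (c.vec τ₂) (Φ := (c.kernel τ₁ τ₂ x.1).curry 1) fun q => rfl)
    simpa only [map_smul, smul_eq_mul, coeff_functionalSeries] using h2
  convert hasSum_sum fun x (_ : x ∈ (Finset.univ : Finset (ParPoint τ₁ τ₂))) => h1 x using 1
  · funext n
    rw [PadicCoords.functionalSum, map_sum, Finset.mul_sum]
    refine Finset.sum_congr rfl fun x _ => ?_
    rw [MvPowerSeries.coeff_C_mul]
    ring
  · rw [PadicCoords.coneFun, Finset.mul_sum]
    exact Finset.sum_congr rfl fun x _ => by ring

theorem constantCoeff_one_sub_C_mul {K : Type*} [CommRing K] (z : K) {B : MvPowerSeries (Fin 2) K}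
    (hB : MvPowerSeries.constantCoeff B = 1) :
    MvPowerSeries.constantCoeff (1 - MvPowerSeries.C z * B) = 1 - z := by
  rw [map_sub, map_one, map_mul, hB, MvPowerSeries.constantCoeff_C, mul_one]

theorem binomialSeries_eq_powSeries (u : Fin 2 → QBar) : binomialSeries u = powSeries u := rfl

theorem PadicCoords.map_binomialSeries {ι : Fin 2 → (k →+* QBar)}
    (hc : ∀ i (a : P.mod), toCp (c.coord i a) = j (ι i (a : k))) (a : P.mod) :
    MvPowerSeries.map j (binomialSeries fun i => ι i (a : k)) =
      MvPowerSeries.map toCp (powSeries (c.vec a)) := by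
  rw [binomialSeries_eq_powSeries, map_powSeries, map_powSeries]
  congr 1
  funext i
  exact (hc i a).symm

/-- Both sides become the same numerator after multiplication by (1+X₁)(1+X₂) and the Shintani
denominator. The latter is invertible because its constant term is (1 - ξ(τ₁))(1 - ξ(τ₂)),
transported by `j`. -/
theorem PadicCoords.inv_mul_map_shintaniSeries {ι : Fin 2 → (k →+* QBar)}
    (hc : ∀ i (a : P.mod), toCp (c.coord i a) = j (ι i (a : k)))
    (h₁ : P.ξ τ₁ ≠ 1) (h₂ : P.ξ τ₂ ≠ 1) (h : AbelPair (j (P.ξ τ₁)) (j (P.ξ τ₂))) :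
    ((1 + MvPowerSeries.X 0) * (1 + MvPowerSeries.X 1))⁻¹ *
      MvPowerSeries.map j (P.shintaniSeries ι τ₁ τ₂) = c.functionalSum j h := by
  set D : MvPowerSeries (Fin 2) QBar :=
    (1 - MvPowerSeries.C (P.ξ τ₁) * binomialSeries (fun i => ι i (τ₁ : k))) *
      (1 - MvPowerSeries.C (P.ξ τ₂) * binomialSeries (fun i => ι i (τ₂ : k))) with hD
  have hD0 : MvPowerSeries.constantCoeff D ≠ 0 := by
    have hB : ∀ a : P.mod, MvPowerSeries.constantCoeff (binomialSeries fun i => ι i (a : k)) = 1 :=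
      fun a => by rw [binomialSeries_eq_powSeries, constantCoeff_powSeries]
    rw [hD, map_mul, constantCoeff_one_sub_C_mul _ (hB _), constantCoeff_one_sub_C_mul _ (hB _)]
    exact mul_ne_zero (sub_ne_zero.2 h₁.symm) (sub_ne_zero.2 h₂.symm)
  set E : MvPowerSeries (Fin 2) ℂ_[p] :=
    (1 - MvPowerSeries.C (j (P.ξ τ₁)) * MvPowerSeries.map toCp (powSeries (c.vec τ₁))) *
      (1 - MvPowerSeries.C (j (P.ξ τ₂)) * MvPowerSeries.map toCp (powSeries (c.vec τ₂))) with hE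
  have hDE : MvPowerSeries.map j D = E := by
    rw [hD, hE, map_mul, map_sub, map_sub, map_mul, map_mul, map_one, MvPowerSeries.map_C,
      MvPowerSeries.map_C, c.map_binomialSeries j hc, c.map_binomialSeries j hc]
  have hE0 : MvPowerSeries.constantCoeff E ≠ 0 := by
    rw [← hDE, MvPowerSeries.constantCoeff_map]
    exact (map_ne_zero j).2 hD0
  have hF : P.shintaniSeries ι τ₁ τ₂ * D =
      ∑ x : ParPoint τ₁ τ₂, MvPowerSeries.C (P.ξ x.1) *
        binomialSeries (fun i => ι i ((x.1 : P.mod) : k)) := by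
    rw [CharPair.shintaniSeries, ← hD, mul_assoc, MvPowerSeries.inv_mul_cancel _ hD0, mul_one,
      ← finsum_eq_sum_of_fintype]
    exact (finsum_set_coe_eq_finsum_mem {a : P.mod | (a : k) ∈ parallelogram (τ₁ : k) (τ₂ : k)}
      (f := fun a : P.mod => MvPowerSeries.C (P.ξ a) * binomialSeries fun i => ι i (a : k))).symm
  set U : MvPowerSeries (Fin 2) ℂ_[p] := (1 + MvPowerSeries.X 0) * (1 + MvPowerSeries.X 1) with hU
  have hU1 : MvPowerSeries.map toCp (powSeries (1 : Fin 2 → ℤ_[p])) = U := by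
    rw [powSeries_one]
    simp [hU]
  have hU0 : MvPowerSeries.constantCoeff U ≠ 0 := by simp [hU]
  have hEU : IsUnit (E * U) := by
    rw [MvPowerSeries.isUnit_iff_constantCoeff, map_mul]
    exact (mul_ne_zero hE0 hU0).isUnit
  refine hEU.mul_right_cancel ?_
  have hl : U⁻¹ * MvPowerSeries.map j (P.shintaniSeries ι τ₁ τ₂) * (E * U) =
      MvPowerSeries.map j (P.shintaniSeries ι τ₁ τ₂ * D) := by
    rw [map_mul, hDE]
    linear_combination (MvPowerSeries.map j (P.shintaniSeries ι τ₁ τ₂) * E) *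
      MvPowerSeries.inv_mul_cancel U hU0
  rw [hl, hF, map_sum, PadicCoords.functionalSum, Finset.sum_mul]
  refine Finset.sum_congr rfl fun x _ => ?_
  rw [← mul_assoc, mul_assoc (MvPowerSeries.C _), hE, functionalSeries_mul_denom, map_mul,
    MvPowerSeries.map_C, c.map_binomialSeries j hc, mul_assoc, ← hU1, ← map_mul, ← powSeries_add,
    sub_add_cancel]

theorem PadicCoords.hasSum_seriesTerm {ι : Fin 2 → (k →+* QBar)}
    (hc : ∀ i (a : P.mod), toCp (c.coord i a) = j (ι i (a : k)))
    (h₁ : P.ξ τ₁ ≠ 1) (h₂ : P.ξ τ₂ ≠ 1) (h : AbelPair (j (P.ξ τ₁)) (j (P.ξ τ₂))) :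
    HasSum (seriesTerm j (P.shintaniSeries ι τ₁ τ₂))
      ((p : ℂ_[p]) ^ 2 * c.coneFun j τ₁ τ₂ h 1) := by
  convert c.hasSum_functionalSum j h using 1
  funext n
  rw [seriesTerm, aCoeff, c.inv_mul_map_shintaniSeries j hc h₁ h₂ h, dCoeff, dCoeff,
    div_mul_div_comm, div_mul_eq_mul_div]

theorem PadicCoords.coneFun_mem_zpMu {f : ℕ} (hf : ¬ p ∣ f) (hmem : (f : 𝓞 k) ∈ 𝔣)
    (h₁ : P.ξ τ₁ ≠ 1) (h₂ : P.ξ τ₂ ≠ 1) (h : AbelPair (j (P.ξ τ₁)) (j (P.ξ τ₂))) (s : ℤ_[p]) :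
    c.coneFun j τ₁ τ₂ h s ∈ zpMu p f := by
  have hpow : ∀ x, j (P.ξ x) ^ f = 1 := fun x => pow_eq_one_of_map j (P.ξ_pow_eq_one hmem x)
  refine Subring.sum_mem _ fun x _ => Subring.mul_mem _ (mem_zpMu_of_pow_eq_one (hpow _)) ?_
  refine abelFunctional₂_mem h _ (isClosed_zpMu (ne_zero_of_not_dvd hf))
    (mem_zpMu_of_pow_eq_one (hpow _)) (inv_one_sub_mem_zpMu hf (hpow _) (map_ne_one j h₁))
    (mem_zpMu_of_pow_eq_one (hpow _)) (inv_one_sub_mem_zpMu hf (hpow _) (map_ne_one j h₂))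
    fun q => ?_
  rw [c.kernel_curry_apply]
  exact toCp_mem_zpMu f _

theorem toCp_teichmuller_mul_onePow_one (N : ℤ_[p]ˣ) :
    toCp (teichmuller N : ℤ_[p]) * toCp (onePow (angle N : ℤ_[p]) 1) = toCp (N : ℤ_[p]) := by
  rw [onePow_one, ← map_mul, ← Units.val_mul, teichmuller_mul_angle]

end Shintani

end PadicTwisted

/-! ### Assembly of the two formulas -/

theorem corollary3 {k : Type*} [Field k] [NumberField k] [NumberField.IsTotallyReal k]
    (hk : Module.finrank ℚ k = 2)
    (𝔣 : Ideal (NumberField.RingOfIntegers k)) (h𝔣 : 𝔣 ≠ ⊤)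
    (f : ℕ) (hf : 0 < f)
    (hff : 𝔣.comap (algebraMap ℤ (NumberField.RingOfIntegers k)) = Ideal.span {(f : ℤ)})
    (P : PadicTwisted.CharPair 𝔣)
    (p : ℕ) [Fact p.Prime]
    (hpf : IsCoprime (Ideal.span {(p : NumberField.RingOfIntegers k)}) 𝔣)
    (hsplit : ∃ 𝔭₁ 𝔭₂ : Ideal (NumberField.RingOfIntegers k), 𝔭₁.IsPrime ∧ 𝔭₂.IsPrime ∧ 𝔭₁ ≠ 𝔭₂ ∧
      Ideal.span {(p : NumberField.RingOfIntegers k)} = 𝔭₁ * 𝔭₂)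
    (hI : ∀ v ∈ PadicTwisted.primesAbove k p, FractionalIdeal.count k v P.I = 0)
    (j : PadicTwisted.QBar →+* ℂ_[p])
    (ε : (NumberField.RingOfIntegers k)ˣ)
    (hε : Subgroup.zpowers ε = PadicTwisted.unitsPlus 𝔣)
    (ρ : P.mod) (hρ : PadicTwisted.TotallyPositive (ρ : k)) (hξ : P.ξ ρ ≠ 1) :
    -- The two `p`-adic functions exist and are characterised by the interpolation property.
    (∃! Z, PadicTwisted.IsInterpolation j
      (P.toClass.zeta (PadicTwisted.primesAbove k p)) Z) ∧
    (∃! z, PadicTwisted.IsInterpolation j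
      (P.coneZeta p ρ ((ε : NumberField.RingOfIntegers k) • ρ)) z) ∧
    -- The norm of `I` is a `p`-adic unit, and the first formula holds on `D(p)`.
    (∃ N : ℤ_[p]ˣ, ((N : ℤ_[p]) : ℚ_[p]) = ((FractionalIdeal.absNorm P.I : ℚ) : ℚ_[p]) ∧
      ∀ s : PadicTwisted.domain p,
        P.toClass.padicZeta j s =
          PadicTwisted.toCp (PadicTwisted.teichmuller N : ℤ_[p]) *
            PadicTwisted.toCp (PadicTwisted.onePow (PadicTwisted.angle N : ℤ_[p]) (s : ℤ_[p])) *
            P.padicConeZeta j ρ ((ε : NumberField.RingOfIntegers k) • ρ) s) ∧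
    -- The value at `1`, for either ordering of the two embeddings.
    (∀ ι : Fin 2 → (k →+* PadicTwisted.QBar), Function.Injective ι →
      Summable (PadicTwisted.seriesTerm j
        (P.shintaniSeries ι ρ ((ε : NumberField.RingOfIntegers k) • ρ))) ∧
      P.toClass.padicZeta j (PadicTwisted.domainOne p) =
        ((FractionalIdeal.absNorm P.I : ℚ) : ℂ_[p]) / (p : ℂ_[p]) ^ 2 *
          ∑' n : ℕ × ℕ, PadicTwisted.seriesTerm j
            (P.shintaniSeries ι ρ ((ε : NumberField.RingOfIntegers k) • ρ)) n) ∧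
    P.toClass.padicZeta j (PadicTwisted.domainOne p) ∈ PadicTwisted.zpMu p f := by

  have hp0 : (p : ℂ_[p]) ≠ 0 := Nat.cast_ne_zero.2 (Fact.out : p.Prime).ne_zero
  have h𝔣' := PadicTwisted.ne_bot_of_comap_eq hf hff
  have hf' := PadicTwisted.not_dvd_of_isCoprime hf hff hpf
  have hmem := PadicTwisted.natCast_mem_of_comap_eq hff
  have hεm : ε ∈ PadicTwisted.unitsPlus 𝔣 := PadicTwisted.mk_mem_of_unitsPlus hε
  have hξ₂ : P.ξ ((ε : NumberField.RingOfIntegers k) • ρ) ≠ 1 := by rwa [P.ξ_smul hεm]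
  have hcoe : (((ε : NumberField.RingOfIntegers k) • ρ : P.mod) : k) =
      algebraMap (NumberField.RingOfIntegers k) k ε * (ρ : k) := by
    rw [Submodule.coe_smul, Algebra.smul_def]
  have h₂ : PadicTwisted.TotallyPositive
      (((ε : NumberField.RingOfIntegers k) • ρ : P.mod) : k) := by
    rw [hcoe]
    exact hεm.2.mul hρ
  obtain ⟨φ₀, φ₁, -, hφ, hφ'⟩ := PadicTwisted.exists_one_lt_embedding hk h𝔣' hε
  have hli := (PadicTwisted.linearIndependent_pair hk hρ.1
    (PadicTwisted.smul_ne_of_one_lt hφ hφ' hρ.1)).2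
  rw [← hcoe] at hli
  let _ : Fintype (PadicTwisted.ParPoint ρ ((ε : NumberField.RingOfIntegers k) • ρ)) :=
    (PadicTwisted.finite_parallelogram P.I _ _).fintype
  obtain ⟨N, hN⟩ := PadicTwisted.exists_unit_eq_absNorm p P.ne_zero hI
  have h := P.abelPair j hf' hmem hξ hξ₂
  have hzeta := fun c : PadicTwisted.PadicCoords P p =>
    c.isInterpolation_zeta j hk hf' hmem h𝔣' hε ρ hρ h₂ hli hξ hξ₂ h hN
  have hcone := fun c : PadicTwisted.PadicCoords P p =>
    c.isInterpolation_coneFun j hk hρ h₂ hli hf' hmem hξ hξ₂ h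
  have hvalue : ∀ c : PadicTwisted.PadicCoords P p,
      P.toClass.padicZeta j (PadicTwisted.domainOne p) = PadicTwisted.toCp (N : ℤ_[p]) *
        c.coneFun j ρ ((ε : NumberField.RingOfIntegers k) • ρ) h 1 := by
    intro c
    rw [← PadicTwisted.toCp_teichmuller_mul_onePow_one]
    exact congrFun (PadicTwisted.interpolation_eq (hzeta c)) _
  obtain ⟨ι₀, hι₀⟩ := PadicTwisted.exists_algebraicEmbeddings hk
  -- Existence, the first formula and integrality use one auxiliary ordering of the embeddings.
  obtain ⟨c₀, -⟩ := PadicTwisted.exists_padicCoords hk hsplit P hI j hι₀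
  refine ⟨⟨_, hzeta c₀, fun F hF => hF.unique (hzeta c₀)⟩,
    ⟨_, hcone c₀, fun F hF => hF.unique (hcone c₀)⟩, ⟨N, hN, fun s => ?_⟩, fun ι hι => ?_, ?_⟩
  · rw [PadicTwisted.CharPair.padicConeZeta, PadicTwisted.interpolation_eq (hcone c₀)]
    exact congrFun (PadicTwisted.interpolation_eq (hzeta c₀)) s
  -- For the value at 1 the coordinates are those of the given ordering. Uniqueness of the
  -- interpolation ensures that they compute the same p-adic function.
  · obtain ⟨c, hc⟩ := PadicTwisted.exists_padicCoords hk hsplit P hI j hι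
    have hs := c.hasSum_seriesTerm j hc hξ hξ₂ h
    refine ⟨hs.summable, ?_⟩
    rw [hs.tsum_eq, hvalue c, PadicTwisted.toCp_apply, hN, ← PadicTwisted.ratCast_eq_algebraMap]
    field_simp
  · rw [hvalue c₀]
    exact Subring.mul_mem _ (PadicTwisted.toCp_mem_zpMu f _)
      (c₀.coneFun_mem_zpMu j hf' hmem hξ hξ₂ h 1)
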